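/- Let $\mathbb K=\mathbb R$ or $\mathbb C$, $d\ge 0$, and let $V=\mathbb R^d\oplus(\mathbb R^d)^*$ with basis $e_1,\dots,e_d,e_1^*,\dots,e_d^*$ (the starred vectors are the dual basis; $\mathcal H^*$ is identified with $\mathcal H$). **Connes space.** ${\rm CO}_{\infty-}$ is the space of sequences $F=\sum_n F^n$, where $F^n:(S^1)^n\to (V\otimes\mathbb K)^{\otimes n}$ ($S^1=\mathbb R/\mathbb Z$) is $C^\infty$ and symmetric (under simultaneous permutation of variables and tensor slots), such that for all $k\in\mathbb N$, $C\ge 0$ $$\|F\|_{k,C}=\sum_n C^n\sum_{m\in\{0,\dots,k\}^n}\big\|\partial_{s_1}^{m_1}\cdots\partial_{s_n}^{m_n}F^n\big\|_\infty<\infty ,$$ with the topology of the norms $\|\cdot\|_{k,C}$. The Wick product is ${:}F.G{:}=\sum_{a,b}F^a\hat\otimes G^b$, where $\hat\otimes$ is the symmetrized tensor product (mean over all permutations). **Derivations.** Let $c_0=1$, $c_k(s)=\sqrt2\cos(2\pi ks)/\sqrt{4\pi^2k^2+1}$ for $k>0$ and $c_k(s)=\sqrt2\sin(2\pi ks)/\sqrt{4\pi^2k^2+1}$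 for $k<0$, and put $\gamma_{i,k}=c_k e_i$, $\gamma^*_{i,k}=c_k e_i^*$ $(1\le i\le d,\ k\in\mathbb Z)$. These form an orthonormal basis for the inner product $\int_0^1\langle x,y\rangle+\int_0^1\langle x',y'\rangle$. For a loop $h$ let $D_h$ be the annihilation operator $$(D_hF)^n=\sum_{i=1}^{n+1}\int_0^1\Big(\big\langle F^{n+1},h(u)\big\rangle_i+\big\langle \partial_{s_i}F^{n+1},h'(u)\big\rangle_i\Big)\Big|_{s_i=u}\,du,$$ where $\langle\cdot,\cdot\rangle_i$ contracts the $i$-th tensor slot and the remaining variables are $s_1,\dots,s_n$ in order. (Under the Stratonovich chaos map this is the Gâteaux derivative in the direction $h$.) **Products.** Let $\{F,G\}=\sum_{i,k}\big({:}D_{\gamma_{i,k}}F.D_{\gamma^*_{i,k}}G{:}-{:}D_{\gamma^*_{i,k}}F.D_{\gamma_{i,k}}G{:}\big)$, let $P^r$ be the $r$-th power of the bidifferential operator $\{\cdot,\cdot\}$, and let $F\star_\hbar G=\sum_{r\ge0}\frac{\hbar^r}{r!}P^r(F,G)$ be the Moyal product. Let $A:\gamma_{i,k}\mapsto\alpha_k\gamma_{i,k}$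 with $\alpha_k\in\mathbb K$, $|\alpha_k|\le K|k|^\mu$ for $k\ne0$ and some $K$ and $\mu>0$. Put $$C_1^A(F,G)=\{F,G\}+\sum_{i,k}\alpha_k\big({:}D_{\gamma_{i,k}}F.D_{\gamma^*_{i,k}}G{:}+{:}D_{\gamma_{i,k}}G.D_{\gamma^*_{i,k}}F{:}\big),$$ let $C^A_r$ be its $r$-th power as a bidifferential operator, and let $F\star^A_\hbar G=\sum_{r\ge0}\frac{\hbar^r}{r!}C_r^A(F,G)$. Both products are extended $\mathbb K[[\hbar]]$-bilinearly to ${\rm CO}_{\infty-}[[\hbar]]$. **Proposition 5.** The series defining $\{\cdot,\cdot\}$, $P^r$ and $C_r^A$ converge in ${\rm CO}_{\infty-}$; $\{\cdot,\cdot\}$ is a Poisson structure on $({\rm CO}_{\infty-},{:}\cdot{:})$ (bilinear, antisymmetric, Jacobi identity, Leibniz rule, and for every $(k,C)$ a bound $\|\{F,G\}\|_{k,C}\le K'\|F\|_{k_1,C_1}\|G\|_{k_1,C_1}$); and $\star_\hbar$ and $\star^A_\hbar$ are deformation quantizations of it ($\mathbb K[[\hbar]]$-bilinear and associative, with zeroth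 term the Wick product, with antisymmetrized first term $2\{\cdot,\cdot\}$, and with every term of positive order bounded in the same sense). They are equivalent: for every $F$ the series $$T_1F=-\sum_{i,k}\alpha_kD_{\gamma_{i,k}}D_{\gamma^*_{i,k}}F$$ converges in ${\rm CO}_{\infty-}$ and defines a continuous linear operator $T_1$, and the $\mathbb K[[\hbar]]$-linear operator $T=\exp(\hbar T_1)=\sum_r\frac{\hbar^r}{r!}T_1^r$ on ${\rm CO}_{\infty-}[[\hbar]]$ satisfies $T(F\star^A_\hbar G)=T(F)\star_\hbar T(G)$ for all $F,G\in{\rm CO}_{\infty-}[[\hbar]]$. -/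

import Mathlib

namespace ConnesSpace

open scoped ContDiff NNReal ENNReal PowerSeries
open Finset

universe u

/-! ### Iterated partial derivatives on `ℝⁿ` -/

section Derivatives

variable {n : ℕ} {E : Type u} [NormedAddCommGroup E] [NormedSpace ℝ E]

/-- The partial derivative `∂f/∂sᵢ`. -/
noncomputable def pderiv (i : Fin n) (f : (Fin n → ℝ) → E) : (Fin n → ℝ) → E :=
  fun s => fderiv ℝ f s (Pi.single i 1)

/-- The iterated partial derivative along a list of coordinates. -/
noncomputable def pderivList (l : List (Fin n)) (f : (Fin n → ℝ) → E) : (Fin n → ℝ) → E :=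
  l.foldr pderiv f

/-- The list that contains each coordinate `i` exactly `m i` times. -/
def indexList (m : Fin n → ℕ) : List (Fin n) :=
  (List.finRange n).flatMap fun i => List.replicate (m i) i

/-- The mixed partial derivative in which the variable `sᵢ` is differentiated `m i` times. -/
noncomputable def mixedDeriv (m : Fin n → ℕ) (f : (Fin n → ℝ) → E) : (Fin n → ℝ) → E :=
  pderivList (indexList m) f

/-- The sum, over all ways to differentiate each of the `n` variables at most `k` times, of the
sup norms of the mixed derivatives. -/
noncomputable def derivNorm (k : ℕ) (f : (Fin n → ℝ) → E) : ℝ≥0∞ :=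
  ∑ m : Fin n → Fin (k + 1), ⨆ s, ‖mixedDeriv (fun i => (m i : ℕ)) f s‖ₑ

theorem contDiff_pderiv (i : Fin n) {f : (Fin n → ℝ) → E} (hf : ContDiff ℝ ∞ f) :
    ContDiff ℝ ∞ (pderiv i f) :=
  (hf.fderiv_right (m := ∞) (by simp)).clm_apply contDiff_const

theorem contDiff_pderivList (l : List (Fin n)) {f : (Fin n → ℝ) → E} (hf : ContDiff ℝ ∞ f) :
    ContDiff ℝ ∞ (pderivList l f) := by
  induction l with
  | nil => exact hf
  | cons i l ih => exact contDiff_pderiv i ih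

theorem pderiv_comm (i j : Fin n) {f : (Fin n → ℝ) → E} (hf : ContDiff ℝ ∞ f) :
    pderiv i (pderiv j f) = pderiv j (pderiv i f) := by
  funext s
  have hd : DifferentiableAt ℝ (fderiv ℝ f) s :=
    ((hf.fderiv_right (m := ∞) (by simp)).differentiable (by simp)) s
  have h2 : IsSymmSndFDerivAt ℝ f s :=
    (hf.contDiffAt).isSymmSndFDerivAt (by
      rw [minSmoothness_of_isRCLikeNormedField]
      exact WithTop.coe_le_coe.2 (le_top : (2 : ℕ∞) ≤ ⊤))
  have key : ∀ a b : Fin n, pderiv a (pderiv b f) s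
      = fderiv ℝ (fderiv ℝ f) s (Pi.single a 1) (Pi.single b 1) := by
    intro a b
    unfold pderiv
    rw [fderiv_clm_apply hd (by fun_prop)]
    simp
  rw [key, key, h2.eq]

theorem pderivList_perm {l l' : List (Fin n)} (h : l.Perm l') {f : (Fin n → ℝ) → E}
    (hf : ContDiff ℝ ∞ f) : pderivList l f = pderivList l' f := by
  induction h with
  | nil => rfl
  | cons i _ ih => simpa [pderivList] using congrArg (pderiv i) ih
  | swap i j l => exact pderiv_comm _ _ (contDiff_pderivList l hf)
  | trans _ _ h1 h2 => exact h1.trans h2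

theorem count_indexList (m : Fin n → ℕ) (j : Fin n) : (indexList m).count j = m j := by
  simp [indexList, List.count_flatMap, List.count_replicate, Function.comp_def,
    ← Fin.sum_univ_def, Finset.sum_ite_eq']

theorem pderivList_eq_mixedDeriv (l : List (Fin n)) {f : (Fin n → ℝ) → E}
    (hf : ContDiff ℝ ∞ f) : pderivList l f = mixedDeriv (fun i => l.count i) f :=
  pderivList_perm (List.perm_iff_count.2 fun i => by rw [count_indexList]) hf

theorem pderivList_add (l : List (Fin n)) {f g : (Fin n → ℝ) → E}
    (hf : ContDiff ℝ ∞ f) (hg : ContDiff ℝ ∞ g) :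
    pderivList l (f + g) = pderivList l f + pderivList l g := by
  induction l with
  | nil => rfl
  | cons i l ih =>
    change pderiv i (pderivList l (f + g)) = _
    rw [ih]
    funext s
    have h1 := (contDiff_pderivList l hf).differentiable (by simp) s
    have h2 := (contDiff_pderivList l hg).differentiable (by simp) s
    change fderiv ℝ (pderivList l f + pderivList l g) s _ = _
    rw [fderiv_add h1 h2]
    rfl

theorem pderivList_smul {𝕜 : Type*} [RCLike 𝕜] [NormedSpace 𝕜 E] [SMulCommClass ℝ 𝕜 E]
    (l : List (Fin n)) (c : 𝕜) {f : (Fin n → ℝ) → E} (hf : ContDiff ℝ ∞ f) :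
    pderivList l (c • f) = c • pderivList l f := by
  induction l with
  | nil => rfl
  | cons i l ih =>
    change pderiv i (pderivList l (c • f)) = _
    rw [ih]
    funext s
    have h1 := (contDiff_pderivList l hf).differentiable (by simp) s
    change fderiv ℝ (c • pderivList l f) s _ = _
    rw [fderiv_const_smul h1]
    rfl

theorem derivNorm_add_le (k : ℕ) {f g : (Fin n → ℝ) → E}
    (hf : ContDiff ℝ ∞ f) (hg : ContDiff ℝ ∞ g) :
    derivNorm k (f + g) ≤ derivNorm k f + derivNorm k g := by
  unfold derivNorm
  rw [← Finset.sum_add_distrib]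
  refine Finset.sum_le_sum fun m _ => iSup_le fun s => ?_
  unfold mixedDeriv
  rw [pderivList_add _ hf hg]
  exact (enorm_add_le _ _).trans (add_le_add (le_iSup_of_le s le_rfl) (le_iSup_of_le s le_rfl))

theorem derivNorm_smul {𝕜 : Type*} [RCLike 𝕜] [NormedSpace 𝕜 E] [SMulCommClass ℝ 𝕜 E]
    (k : ℕ) (c : 𝕜) {f : (Fin n → ℝ) → E} (hf : ContDiff ℝ ∞ f) :
    derivNorm k (c • f) = ‖c‖ₑ * derivNorm k f := by
  unfold derivNorm
  rw [Finset.mul_sum]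
  refine Finset.sum_congr rfl fun m _ => ?_
  unfold mixedDeriv
  rw [pderivList_smul _ c hf, ENNReal.mul_iSup]
  simp [enorm_smul]

theorem derivNorm_sum_le (k : ℕ) {κ : Type*} (t : Finset κ) (f : κ → (Fin n → ℝ) → E)
    (hf : ∀ a ∈ t, ContDiff ℝ ∞ (f a)) :
    derivNorm k (∑ a ∈ t, f a) ≤ ∑ a ∈ t, derivNorm k (f a) := by
  classical
  induction t using Finset.induction_on with
  | empty =>
    have h0 : ContDiff ℝ ∞ (0 : (Fin n → ℝ) → E) := contDiff_const
    have := derivNorm_smul (𝕜 := ℝ) k 0 h0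
    simpa using this.le
  | insert a t ha ih =>
    rw [Finset.sum_insert ha, Finset.sum_insert ha]
    have h2 : ContDiff ℝ ∞ (∑ a ∈ t, f a) := by
      have : (∑ a ∈ t, f a) = fun s => ∑ a ∈ t, f a s := by funext s; simp
      rw [this]
      exact ContDiff.sum fun b hb => hf b (Finset.mem_insert_of_mem hb)
    refine (derivNorm_add_le k (hf a (Finset.mem_insert_self _ _)) h2).trans ?_
    gcongr
    exact ih fun b hb => hf b (Finset.mem_insert_of_mem hb)

end Derivatives

/-! ### The Connes space -/

/-- Index set of the canonical basis of `ℝᵈ ⊕ ℝᵈ`; `Sum.inl i` is the index `i`, and `Sum.inr i` is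
the dual index `i*`. -/
abbrev Coord (d : ℕ) : Type := Fin d ⊕ Fin d

/-- Sequences `(Fⁿ)ₙ` of functions of `n` real variables with values in `(𝕜²ᵈ)^{⊗ n}`; the value
`F n s I` is the component of `Fⁿ(s₁, …, sₙ)` along `e_{I₁} ⊗ ⋯ ⊗ e_{Iₙ}`. -/
abbrev Kernels (𝕜 : Type u) (d : ℕ) : Type u :=
  (n : ℕ) → (Fin n → ℝ) → ((Fin n → Coord d) → 𝕜)

section Connes

variable {𝕜 : Type u} [RCLike 𝕜] {d : ℕ}

/-- The norm `‖F‖_{k,C} = ∑ₙ Cⁿ ‖Fⁿ‖_k`, with values in `[0, ∞]`. -/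
noncomputable def connesNorm (k : ℕ) (C : ℝ≥0) (F : Kernels 𝕜 d) : ℝ≥0∞ :=
  ∑' n, (C : ℝ≥0∞) ^ n * derivNorm k (F n)

/-- The functions `F = ∑ Fⁿ` in the Connes space: every `Fⁿ` is a smooth function on `(S¹)ⁿ`
(a `1`-periodic function of each variable), is symmetric, and all norms `‖F‖_{k,C}` are finite. -/
structure IsConnes (F : Kernels 𝕜 d) : Prop where
  smooth : ∀ n, ContDiff ℝ ∞ (F n)
  periodic : ∀ n (s : Fin n → ℝ) (z : Fin n → ℤ), F n (fun i => s i + z i) = F n s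
  symmetric : ∀ n (σ : Equiv.Perm (Fin n)) (s : Fin n → ℝ) (I : Fin n → Coord d),
    F n (s ∘ σ) (I ∘ σ) = F n s I
  finite : ∀ (k : ℕ) (C : ℝ≥0), connesNorm k C F ≠ ⊤

theorem connesNorm_add_le (k : ℕ) (C : ℝ≥0) {F G : Kernels 𝕜 d}
    (hF : ∀ n, ContDiff ℝ ∞ (F n)) (hG : ∀ n, ContDiff ℝ ∞ (G n)) :
    connesNorm k C (F + G) ≤ connesNorm k C F + connesNorm k C G := by
  unfold connesNorm
  rw [← ENNReal.tsum_add]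
  refine ENNReal.tsum_le_tsum fun n => ?_
  rw [← mul_add]
  gcongr
  exact derivNorm_add_le k (hF n) (hG n)

theorem connesNorm_smul (k : ℕ) (C : ℝ≥0) (c : 𝕜) {F : Kernels 𝕜 d}
    (hF : ∀ n, ContDiff ℝ ∞ (F n)) :
    connesNorm k C (c • F) = ‖c‖ₑ * connesNorm k C F := by
  unfold connesNorm
  rw [← ENNReal.tsum_mul_left]
  refine tsum_congr fun n => ?_
  rw [Pi.smul_apply, derivNorm_smul k c (hF n)]
  ring

variable (𝕜 d) in
/-- The Connes space `CO_{∞-}` over the loop space of `ℝᵈ ⊕ ℝᵈ`. -/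
def CO : Submodule 𝕜 (Kernels 𝕜 d) where
  carrier := {F | IsConnes F}
  zero_mem' := by
    have h0 : ∀ n, ContDiff ℝ ∞ ((0 : Kernels 𝕜 d) n) := fun n => contDiff_const
    refine ⟨h0, fun _ _ _ => rfl, fun _ _ _ _ => rfl, fun k C => ?_⟩
    have := connesNorm_smul k C (0 : 𝕜) h0
    simp only [zero_smul, enorm_zero, zero_mul] at this
    simp [this]
  add_mem' := by
    rintro F G hF hG
    refine ⟨fun n => (hF.smooth n).add (hG.smooth n), fun n s z => ?_, fun n σ s I => ?_,
      fun k C => ?_⟩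
    · simp [hF.periodic, hG.periodic]
    · simp [hF.symmetric, hG.symmetric]
    · exact ((connesNorm_add_le k C hF.smooth hG.smooth).trans_lt
        (ENNReal.add_lt_top.2 ⟨(hF.finite k C).lt_top, (hG.finite k C).lt_top⟩)).ne
  smul_mem' := by
    rintro c F hF
    refine ⟨fun n => (hF.smooth n).const_smul c, fun n s z => ?_, fun n σ s I => ?_,
      fun k C => ?_⟩
    · simp [hF.periodic]
    · simp [hF.symmetric]
    · rw [connesNorm_smul k C c hF.smooth]
      exact ENNReal.mul_ne_top enorm_ne_top (hF.finite k C)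

variable (𝕜 d) in
/-- The seminorms `‖·‖_{k,C}` on the Connes space, indexed by the pairs `(k, C)`. -/
noncomputable def coSeminorm : SeminormFamily 𝕜 (CO 𝕜 d) (ℕ × ℝ≥0) := fun p =>
  Seminorm.of (fun F => (connesNorm p.1 p.2 (F : Kernels 𝕜 d)).toReal)
    (fun F G => by
      rw [← ENNReal.toReal_add (F.2.finite p.1 p.2) (G.2.finite p.1 p.2)]
      exact ENNReal.toReal_mono
        (ENNReal.add_ne_top.2 ⟨F.2.finite p.1 p.2, G.2.finite p.1 p.2⟩)
        (connesNorm_add_le p.1 p.2 F.2.smooth G.2.smooth))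
    (fun c F => by
      rw [Submodule.coe_smul, connesNorm_smul p.1 p.2 c F.2.smooth, ENNReal.toReal_mul,
        toReal_enorm])

/-- The topology of the Connes space: convergence means convergence in all norms `‖·‖_{k,C}`. -/
noncomputable instance : TopologicalSpace (CO 𝕜 d) :=
  (coSeminorm 𝕜 d).moduleFilterBasis.topology

theorem withSeminorms_coSeminorm : WithSeminorms (coSeminorm 𝕜 d) := ⟨rfl⟩

instance : IsTopologicalAddGroup (CO 𝕜 d) := withSeminorms_coSeminorm.topologicalAddGroup

instance : ContinuousSMul 𝕜 (CO 𝕜 d) := withSeminorms_coSeminorm.continuousSMul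

/-! ### The Wick product -/

/-- The tensor product `f ⊗ g` with its variables and tensor slots placed along `σ`. -/
def tensor {a b N : ℕ} (σ : Fin a ⊕ Fin b ≃ Fin N) (f : (Fin a → ℝ) → ((Fin a → Coord d) → 𝕜))
    (g : (Fin b → ℝ) → ((Fin b → Coord d) → 𝕜)) : (Fin N → ℝ) → ((Fin N → Coord d) → 𝕜) :=
  fun s I => f (s ∘ σ ∘ Sum.inl) (I ∘ σ ∘ Sum.inl) * g (s ∘ σ ∘ Sum.inr) (I ∘ σ ∘ Sum.inr)

/-- The Wick product `:F.G: = ∑_{a,b} Fᵃ ⊗̂ Gᵇ`, where `⊗̂` is the symmetric tensor product: the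
mean of the `N!` placements of the variables, `N = a + b`. -/
noncomputable def wickKernel (F G : Kernels 𝕜 d) : Kernels 𝕜 d := fun N =>
  ∑ p ∈ antidiagonal N,
    ((N.factorial : 𝕜)⁻¹ • ∑ σ : Fin p.1 ⊕ Fin p.2 ≃ Fin N, tensor σ (F p.1) (G p.2))

theorem contDiff_tensor {a b N : ℕ} (σ : Fin a ⊕ Fin b ≃ Fin N)
    {f : (Fin a → ℝ) → ((Fin a → Coord d) → 𝕜)} {g : (Fin b → ℝ) → ((Fin b → Coord d) → 𝕜)}
    (hf : ContDiff ℝ ∞ f) (hg : ContDiff ℝ ∞ g) : ContDiff ℝ ∞ (tensor σ f g) := by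
  rw [contDiff_pi]
  intro I
  have h1 : ContDiff ℝ ∞ fun s : Fin N → ℝ => f (s ∘ σ ∘ Sum.inl) :=
    hf.comp (contDiff_pi.2 fun i => contDiff_apply ℝ ℝ _)
  have h2 : ContDiff ℝ ∞ fun s : Fin N → ℝ => g (s ∘ σ ∘ Sum.inr) :=
    hg.comp (contDiff_pi.2 fun i => contDiff_apply ℝ ℝ _)
  exact ((contDiff_pi.1 h1) _).mul ((contDiff_pi.1 h2) _)

theorem hasDerivAt_pderiv {n : ℕ} {κ : Type*} [Fintype κ] (i : Fin n)
    {f : (Fin n → ℝ) → (κ → 𝕜)} (hf : ContDiff ℝ ∞ f) (s : Fin n → ℝ) (x : κ) :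
    HasDerivAt (fun t : ℝ => f (s + t • Pi.single i 1) x) (pderiv i f s x) 0 := by
  have h1 : HasDerivAt (fun t : ℝ => s + t • (Pi.single i 1 : Fin n → ℝ)) (Pi.single i 1) 0 := by
    simpa using ((hasDerivAt_id (0 : ℝ)).smul_const (Pi.single i 1 : Fin n → ℝ)).const_add s
  have h2 : HasFDerivAt f (fderiv ℝ f s) (s + (0 : ℝ) • (Pi.single i 1 : Fin n → ℝ)) := by
    simpa using (hf.differentiable (by simp) s).hasFDerivAt
  exact (hasDerivAt_pi.1 (h2.comp_hasDerivAt (0 : ℝ) h1)) x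

theorem pderiv_tensor_inl {a b N : ℕ} (σ : Fin a ⊕ Fin b ≃ Fin N) (j : Fin a)
    {f : (Fin a → ℝ) → ((Fin a → Coord d) → 𝕜)} {g : (Fin b → ℝ) → ((Fin b → Coord d) → 𝕜)}
    (hf : ContDiff ℝ ∞ f) (hg : ContDiff ℝ ∞ g) :
    pderiv (σ (Sum.inl j)) (tensor σ f g) = tensor σ (pderiv j f) g := by
  funext s I
  refine (hasDerivAt_pderiv (σ (Sum.inl j)) (contDiff_tensor σ hf hg) s I).unique ?_
  have h := (hasDerivAt_pderiv j hf (s ∘ σ ∘ Sum.inl) (I ∘ σ ∘ Sum.inl)).mul_const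
    (g (s ∘ σ ∘ Sum.inr) (I ∘ σ ∘ Sum.inr))
  have z1 : ∀ t : ℝ, (s + t • (Pi.single (σ (Sum.inl j)) 1 : Fin N → ℝ)) ∘ σ ∘ Sum.inl
      = s ∘ σ ∘ Sum.inl + t • (Pi.single j 1 : Fin a → ℝ) := by
    intro t
    funext i
    simp [Pi.single_apply]
  have z2 : ∀ t : ℝ, (s + t • (Pi.single (σ (Sum.inl j)) 1 : Fin N → ℝ)) ∘ σ ∘ Sum.inr
      = s ∘ σ ∘ Sum.inr := by
    intro t
    funext i
    simp [Pi.single_apply]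
  simp only [tensor, z1, z2]
  exact h

theorem tensor_comm {a b N : ℕ} (σ : Fin a ⊕ Fin b ≃ Fin N)
    (f : (Fin a → ℝ) → ((Fin a → Coord d) → 𝕜)) (g : (Fin b → ℝ) → ((Fin b → Coord d) → 𝕜)) :
    tensor σ f g = tensor ((Equiv.sumComm _ _).trans σ) g f := by
  funext s I
  exact mul_comm _ _

theorem pderiv_tensor_inr {a b N : ℕ} (σ : Fin a ⊕ Fin b ≃ Fin N) (j : Fin b)
    {f : (Fin a → ℝ) → ((Fin a → Coord d) → 𝕜)} {g : (Fin b → ℝ) → ((Fin b → Coord d) → 𝕜)}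
    (hf : ContDiff ℝ ∞ f) (hg : ContDiff ℝ ∞ g) :
    pderiv (σ (Sum.inr j)) (tensor σ f g) = tensor σ f (pderiv j g) := by
  rw [tensor_comm σ f g, tensor_comm σ f (pderiv j g)]
  exact pderiv_tensor_inl ((Equiv.sumComm _ _).trans σ) j hg hf

theorem pderivList_tensor {a b N : ℕ} (σ : Fin a ⊕ Fin b ≃ Fin N) (l : List (Fin N))
    {f : (Fin a → ℝ) → ((Fin a → Coord d) → 𝕜)} {g : (Fin b → ℝ) → ((Fin b → Coord d) → 𝕜)}
    (hf : ContDiff ℝ ∞ f) (hg : ContDiff ℝ ∞ g) :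
    pderivList l (tensor σ f g)
      = tensor σ (mixedDeriv (fun i => l.count (σ (Sum.inl i))) f)
          (mixedDeriv (fun i => l.count (σ (Sum.inr i))) g) := by
  suffices h : ∃ (l₁ : List (Fin a)) (l₂ : List (Fin b)),
      (∀ i, l₁.count i = l.count (σ (Sum.inl i))) ∧
      (∀ i, l₂.count i = l.count (σ (Sum.inr i))) ∧
      pderivList l (tensor σ f g) = tensor σ (pderivList l₁ f) (pderivList l₂ g) by
    obtain ⟨l₁, l₂, h₁, h₂, h⟩ := h
    rw [h, pderivList_eq_mixedDeriv l₁ hf, pderivList_eq_mixedDeriv l₂ hg]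
    simp only [h₁, h₂]
  induction l with
  | nil => exact ⟨[], [], by simp, by simp, rfl⟩
  | cons i l ih =>
    obtain ⟨l₁, l₂, h₁, h₂, h⟩ := ih
    obtain ⟨x, rfl⟩ := σ.surjective i
    have hc1 := contDiff_pderivList l₁ hf
    have hc2 := contDiff_pderivList l₂ hg
    rcases x with j | j
    · refine ⟨j :: l₁, l₂, fun i => ?_, fun i => ?_, ?_⟩
      · simp [List.count_cons, h₁]
      · simp [List.count_cons, h₂]
      · change pderiv _ (pderivList l _) = _
        rw [h, pderiv_tensor_inl σ j hc1 hc2]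
        rfl
    · refine ⟨l₁, j :: l₂, fun i => ?_, fun i => ?_, ?_⟩
      · simp [List.count_cons, h₁]
      · simp [List.count_cons, h₂]
      · change pderiv _ (pderivList l _) = _
        rw [h, pderiv_tensor_inr σ j hc1 hc2]
        rfl

theorem enorm_tensor_le {a b N : ℕ} (σ : Fin a ⊕ Fin b ≃ Fin N)
    (f : (Fin a → ℝ) → ((Fin a → Coord d) → 𝕜)) (g : (Fin b → ℝ) → ((Fin b → Coord d) → 𝕜))
    (s : Fin N → ℝ) :
    ‖tensor σ f g s‖ₑ ≤ ‖f (s ∘ σ ∘ Sum.inl)‖ₑ * ‖g (s ∘ σ ∘ Sum.inr)‖ₑ := by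
  simp only [← ofReal_norm]
  rw [← ENNReal.ofReal_mul (norm_nonneg _)]
  refine ENNReal.ofReal_le_ofReal ((pi_norm_le_iff_of_nonneg (by positivity)).2 fun I => ?_)
  rw [tensor, norm_mul]
  gcongr
  · exact norm_le_pi_norm (f (s ∘ σ ∘ Sum.inl)) _
  · exact norm_le_pi_norm (g (s ∘ σ ∘ Sum.inr)) _

theorem derivNorm_tensor_le {a b N : ℕ} (k : ℕ) (σ : Fin a ⊕ Fin b ≃ Fin N)
    {f : (Fin a → ℝ) → ((Fin a → Coord d) → 𝕜)} {g : (Fin b → ℝ) → ((Fin b → Coord d) → 𝕜)}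
    (hf : ContDiff ℝ ∞ f) (hg : ContDiff ℝ ∞ g) :
    derivNorm k (tensor σ f g) ≤ derivNorm k f * derivNorm k g := by
  unfold derivNorm
  rw [Finset.sum_mul_sum, ← Finset.sum_product']
  let e : (Fin N → Fin (k + 1)) ≃ (Fin a → Fin (k + 1)) × (Fin b → Fin (k + 1)) :=
    (Equiv.arrowCongr σ.symm (Equiv.refl _)).trans (Equiv.sumArrowEquivProdArrow _ _ _)
  rw [Finset.univ_product_univ, ← e.sum_comp]
  refine Finset.sum_le_sum fun m _ => iSup_le fun s => ?_
  rw [mixedDeriv, pderivList_tensor σ _ hf hg]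
  simp only [count_indexList]
  refine (enorm_tensor_le σ _ _ s).trans ?_
  refine mul_le_mul' (le_iSup_of_le (s ∘ σ ∘ Sum.inl) ?_) (le_iSup_of_le (s ∘ σ ∘ Sum.inr) ?_)
  · exact le_rfl
  · exact le_rfl

theorem contDiff_wickKernel {F G : Kernels 𝕜 d} (hF : ∀ n, ContDiff ℝ ∞ (F n))
    (hG : ∀ n, ContDiff ℝ ∞ (G n)) (N : ℕ) : ContDiff ℝ ∞ (wickKernel F G N) := by
  have : wickKernel F G N = fun s => ∑ p ∈ antidiagonal N,
      ((N.factorial : 𝕜)⁻¹ • ∑ σ : Fin p.1 ⊕ Fin p.2 ≃ Fin N,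
        tensor σ (F p.1) (G p.2) s) := by
    funext s
    simp [wickKernel]
  rw [this]
  exact ContDiff.sum fun p _ => ContDiff.const_smul _
    (ContDiff.sum fun σ _ => contDiff_tensor σ (hF _) (hG _))

theorem contDiff_sum_tensor {a b : ℕ} (N : ℕ)
    {f : (Fin a → ℝ) → ((Fin a → Coord d) → 𝕜)} {g : (Fin b → ℝ) → ((Fin b → Coord d) → 𝕜)}
    (hf : ContDiff ℝ ∞ f) (hg : ContDiff ℝ ∞ g) :
    ContDiff ℝ ∞ (∑ σ : Fin a ⊕ Fin b ≃ Fin N, tensor σ f g) := by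
  have : (∑ σ : Fin a ⊕ Fin b ≃ Fin N, tensor σ f g)
      = fun s => ∑ σ : Fin a ⊕ Fin b ≃ Fin N, tensor σ f g s := by
    funext s
    simp
  rw [this]
  exact ContDiff.sum fun σ _ => contDiff_tensor σ hf hg

theorem card_sumEquiv {a b N : ℕ} (h : a + b = N) :
    Fintype.card (Fin a ⊕ Fin b ≃ Fin N) = N.factorial := by
  subst h
  rw [Fintype.card_equiv finSumFinEquiv]
  simp

theorem derivNorm_symm_le (k : ℕ) {a b N : ℕ} (h : a + b = N)
    {f : (Fin a → ℝ) → ((Fin a → Coord d) → 𝕜)} {g : (Fin b → ℝ) → ((Fin b → Coord d) → 𝕜)}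
    (hf : ContDiff ℝ ∞ f) (hg : ContDiff ℝ ∞ g) :
    derivNorm k ((N.factorial : 𝕜)⁻¹ • ∑ σ : Fin a ⊕ Fin b ≃ Fin N, tensor σ f g)
      ≤ derivNorm k f * derivNorm k g := by
  have hs := contDiff_sum_tensor N hf hg
  have h1 : derivNorm k (∑ σ : Fin a ⊕ Fin b ≃ Fin N, tensor σ f g)
      ≤ (N.factorial : ℝ≥0∞) * (derivNorm k f * derivNorm k g) := by
    refine (derivNorm_sum_le k _ _ fun σ _ => contDiff_tensor σ hf hg).trans ?_
    refine (Finset.sum_le_sum fun σ _ => derivNorm_tensor_le k σ hf hg).trans ?_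
    rw [Finset.sum_const, Finset.card_univ, card_sumEquiv h, nsmul_eq_mul]
  have h2 : ‖((N.factorial : 𝕜)⁻¹)‖ₑ * (N.factorial : ℝ≥0∞) = 1 := by
    generalize hM : N.factorial = M
    have h3 : (M : 𝕜) ≠ 0 := by
      rw [← hM]
      exact_mod_cast N.factorial_ne_zero
    have h4 : (M : ℝ≥0∞) = ‖(M : 𝕜)‖ₑ := by
      rw [← ofReal_norm, RCLike.norm_natCast]
      simp
    rw [h4, ← enorm_mul, inv_mul_cancel₀ h3]
    simp
  rw [derivNorm_smul k _ hs]
  calc ‖((N.factorial : 𝕜)⁻¹)‖ₑ * derivNorm k (∑ σ : Fin a ⊕ Fin b ≃ Fin N, tensor σ f g)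
      ≤ ‖((N.factorial : 𝕜)⁻¹)‖ₑ
        * ((N.factorial : ℝ≥0∞) * (derivNorm k f * derivNorm k g)) := by gcongr
    _ = derivNorm k f * derivNorm k g := by rw [← mul_assoc, h2, one_mul]

theorem derivNorm_wickKernel_le (k : ℕ) {F G : Kernels 𝕜 d} (hF : ∀ n, ContDiff ℝ ∞ (F n))
    (hG : ∀ n, ContDiff ℝ ∞ (G n)) (N : ℕ) :
    derivNorm k (wickKernel F G N)
      ≤ ∑ p ∈ antidiagonal N, derivNorm k (F p.1) * derivNorm k (G p.2) := by
  have h := derivNorm_sum_le k (antidiagonal N) (fun p : ℕ × ℕ => (N.factorial : 𝕜)⁻¹ •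
    ∑ σ : Fin p.1 ⊕ Fin p.2 ≃ Fin N, tensor σ (F p.1) (G p.2))
    (fun p _ => (contDiff_sum_tensor N (hF p.1) (hG p.2)).const_smul (N.factorial : 𝕜)⁻¹)
  refine h.trans (Finset.sum_le_sum fun p hp => ?_)
  exact derivNorm_symm_le k (mem_antidiagonal.1 hp) (hF p.1) (hG p.2)

theorem connesNorm_wickKernel_le (k : ℕ) (C : ℝ≥0) {F G : Kernels 𝕜 d}
    (hF : ∀ n, ContDiff ℝ ∞ (F n)) (hG : ∀ n, ContDiff ℝ ∞ (G n)) :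
    connesNorm k C (wickKernel F G) ≤ connesNorm k C F * connesNorm k C G := by
  have h1 : connesNorm k C F * connesNorm k C G = ∑' N, ∑ p ∈ antidiagonal N,
      ((C : ℝ≥0∞) ^ p.1 * derivNorm k (F p.1)) * ((C : ℝ≥0∞) ^ p.2 * derivNorm k (G p.2)) := by
    unfold connesNorm
    rw [← ENNReal.tsum_mul_right]
    simp_rw [← ENNReal.tsum_mul_left]
    rw [← ENNReal.tsum_prod (f := fun a b => ((C : ℝ≥0∞) ^ a * derivNorm k (F a))
        * ((C : ℝ≥0∞) ^ b * derivNorm k (G b))), ← (Finset.HasAntidiagonal.sigmaAntidiagonalEquivProd (A := ℕ)).tsum_eq,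
      ENNReal.tsum_sigma']
    refine tsum_congr fun N => ?_
    rw [tsum_fintype]
    exact Finset.sum_coe_sort (antidiagonal N) (fun p : ℕ × ℕ =>
      ((C : ℝ≥0∞) ^ p.1 * derivNorm k (F p.1)) * ((C : ℝ≥0∞) ^ p.2 * derivNorm k (G p.2)))
  rw [h1]
  refine ENNReal.tsum_le_tsum fun N => ?_
  refine (mul_le_mul_right (derivNorm_wickKernel_le k hF hG N) _).trans ?_
  rw [Finset.mul_sum]
  refine Finset.sum_le_sum fun p hp => ?_
  rw [← mem_antidiagonal.1 hp, pow_add]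
  apply le_of_eq
  ring

theorem isConnes_wickKernel {F G : Kernels 𝕜 d} (hF : IsConnes F) (hG : IsConnes G) :
    IsConnes (wickKernel F G) := by
  refine ⟨contDiff_wickKernel hF.smooth hG.smooth, fun N s z => ?_, fun N τ s I => ?_,
    fun k C => ?_⟩
  · simp only [wickKernel, Finset.sum_apply, Pi.smul_apply]
    refine Finset.sum_congr rfl fun p _ => ?_
    congr 1
    refine Finset.sum_congr rfl fun σ _ => ?_
    funext I
    have e1 := hF.periodic p.1 (s ∘ σ ∘ Sum.inl) (z ∘ σ ∘ Sum.inl)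
    have e2 := hG.periodic p.2 (s ∘ σ ∘ Sum.inr) (z ∘ σ ∘ Sum.inr)
    exact congrArg₂ (· * ·) (congrFun e1 _) (congrFun e2 _)
  · simp only [wickKernel, Finset.sum_apply, Pi.smul_apply]
    refine Finset.sum_congr rfl fun p _ => ?_
    congr 1
    exact (Equiv.sum_comp (Equiv.equivCongr (Equiv.refl (Fin p.1 ⊕ Fin p.2)) τ)
      (fun σ => tensor σ (F p.1) (G p.2) s I))
  · exact ((connesNorm_wickKernel_le k C hF.smooth hG.smooth).trans_lt
      (ENNReal.mul_lt_top (hF.finite k C).lt_top (hG.finite k C).lt_top)).ne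

/-- The Wick product on the Connes space. -/
noncomputable def wick (F G : CO 𝕜 d) : CO 𝕜 d :=
  ⟨wickKernel F G, isConnes_wickKernel F.2 G.2⟩


/-! ### Annihilation operators -/

/-- Contraction of the `i`-th variable and tensor slot against the function `u ↦ φ u e_j`. -/
noncomputable def contract {n : ℕ} (i : Fin (n + 1)) (j : Coord d) (φ : ℝ → ℝ)
    (f : (Fin (n + 1) → ℝ) → ((Fin (n + 1) → Coord d) → 𝕜)) :
    (Fin n → ℝ) → ((Fin n → Coord d) → 𝕜) :=
  fun s I => ∫ u in (0 : ℝ)..1, φ u •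
    f (Fin.insertNth (α := fun _ => ℝ) i u s) (Fin.insertNth (α := fun _ => Coord d) i j I)

/-- The annihilation operator `a_h`: every variable of `Fⁿ⁺¹` in turn is contracted against the
loop `h` in the inner product `∫ ⟨γ, h⟩ + ∫ ⟨γ', h'⟩` of the loop space. -/
noncomputable def annihKernel (h : ℝ → Coord d → ℝ) (F : Kernels 𝕜 d) : Kernels 𝕜 d := fun n =>
  ∑ i : Fin (n + 1), ∑ j : Coord d,
    (contract i j (fun u => h u j) (F (n + 1)) +
      contract i j (deriv fun u => h u j) (pderiv i (F (n + 1))))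

theorem hasFDerivAt_paramIntegral {H : Type} [NormedAddCommGroup H] [NormedSpace ℝ H]
    [ProperSpace H] {E : Type u} [NormedAddCommGroup E] [NormedSpace ℝ E]
    {φ : ℝ → ℝ} (hφ : Continuous φ) {f : ℝ × H → E} (hf : ContDiff ℝ 1 f) (x : H) :
    HasFDerivAt (fun y => ∫ u in (0 : ℝ)..1, φ u • f (u, y))
      (∫ u in (0 : ℝ)..1, φ u • (fderiv ℝ f (u, x)).comp (ContinuousLinearMap.inr ℝ ℝ H)) x := by
  have hc : Continuous fun p : ℝ × H =>
      φ p.1 • (fderiv ℝ f p).comp (ContinuousLinearMap.inr ℝ ℝ H) := by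
    have h1 := hf.continuous_fderiv (by simp)
    exact (hφ.comp continuous_fst).smul (h1.clm_comp continuous_const)
  obtain ⟨M, hM⟩ := ((isCompact_Icc (a := (0 : ℝ)) (b := 1)).prod
    (isCompact_closedBall x 1)).exists_bound_of_continuousOn hc.continuousOn
  refine intervalIntegral.hasFDerivAt_integral_of_dominated_of_fderiv_le (𝕜 := ℝ)
    (F := fun y u => φ u • f (u, y))
    (F' := fun y u => φ u • (fderiv ℝ f (u, y)).comp (ContinuousLinearMap.inr ℝ ℝ H))
    (bound := fun _ => M) (Metric.ball_mem_nhds x one_pos) ?_ ?_ ?_ ?_ ?_ ?_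
  · refine Filter.Eventually.of_forall fun y => Continuous.aestronglyMeasurable ?_
    exact hφ.smul (hf.continuous.comp (by fun_prop))
  · exact Continuous.intervalIntegrable
      (hφ.smul (hf.continuous.comp (by fun_prop))) _ _
  · exact (hc.comp (by fun_prop : Continuous fun u : ℝ => (u, x))).aestronglyMeasurable
  · refine Filter.Eventually.of_forall fun u hu y hy => hM (u, y) ⟨?_, ?_⟩
    · rw [Set.uIoc_of_le zero_le_one] at hu
      exact ⟨hu.1.le, hu.2⟩
    · exact Metric.ball_subset_closedBall hy
  · exact intervalIntegrable_const
  · refine Filter.Eventually.of_forall fun u _ y _ => HasFDerivAt.const_smul ?_ _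
    have h1 := (hf.differentiable (by simp) (u, y)).hasFDerivAt
    exact h1.comp y (hasFDerivAt_prodMk_right u y)

theorem contDiff_paramIntegral {H : Type} [NormedAddCommGroup H] [NormedSpace ℝ H]
    [ProperSpace H] {φ : ℝ → ℝ} (hφ : Continuous φ) (m : ℕ) :
    ∀ {E : Type u} [NormedAddCommGroup E] [NormedSpace ℝ E] {f : ℝ × H → E},
      ContDiff ℝ ∞ f → ContDiff ℝ m (fun y => ∫ u in (0 : ℝ)..1, φ u • f (u, y)) := by
  induction m with
  | zero =>
    intro E _ _ f hf
    have h1 : ContDiff ℝ 1 f := hf.of_le (by exact_mod_cast le_top)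
    exact contDiff_zero.2 (continuous_iff_continuousAt.2 fun x =>
      (hasFDerivAt_paramIntegral hφ h1 x).continuousAt)
  | succ m ih =>
    intro E _ _ f hf
    have h1 : ContDiff ℝ 1 f := hf.of_le (by exact_mod_cast le_top)
    have hd := hasFDerivAt_paramIntegral hφ h1
    push_cast
    rw [contDiff_succ_iff_fderiv]
    refine ⟨fun x => (hd x).differentiableAt, by simp, ?_⟩
    have e : fderiv ℝ (fun y => ∫ u in (0 : ℝ)..1, φ u • f (u, y)) = fun y =>
        ∫ u in (0 : ℝ)..1, φ u • (fderiv ℝ f (u, y)).comp (ContinuousLinearMap.inr ℝ ℝ H) :=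
      funext fun x => (hd x).fderiv
    rw [e]
    exact ih (f := fun p => (fderiv ℝ f p).comp (ContinuousLinearMap.inr ℝ ℝ H))
      ((hf.fderiv_right (m := ∞) (by simp)).clm_comp contDiff_const)

theorem contDiff_insertNth {n : ℕ} (i : Fin (n + 1)) :
    ContDiff ℝ ∞ fun p : ℝ × (Fin n → ℝ) => Fin.insertNth (α := fun _ => ℝ) i p.1 p.2 := by
  rw [contDiff_pi]
  intro l
  rcases Fin.eq_self_or_eq_succAbove i l with rfl | ⟨l, rfl⟩
  · simpa using contDiff_fst
  · simpa [Function.comp_def] using (contDiff_apply ℝ ℝ l).comp (contDiff_snd (E := ℝ) (n := ∞))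

theorem contDiff_contract {n : ℕ} (i : Fin (n + 1)) (j : Coord d) {φ : ℝ → ℝ}
    (hφ : Continuous φ) {f : (Fin (n + 1) → ℝ) → ((Fin (n + 1) → Coord d) → 𝕜)}
    (hf : ContDiff ℝ ∞ f) : ContDiff ℝ ∞ (contract i j φ f) := by
  rw [contDiff_pi]
  intro I
  rw [contDiff_infty]
  intro m
  exact contDiff_paramIntegral hφ m (f := fun p : ℝ × (Fin n → ℝ) =>
    f (Fin.insertNth (α := fun _ => ℝ) i p.1 p.2) (Fin.insertNth (α := fun _ => Coord d) i j I))
    (contDiff_pi.1 (hf.comp (contDiff_insertNth i)) _)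

theorem pderiv_contract {n : ℕ} (i : Fin (n + 1)) (j : Coord d) {φ : ℝ → ℝ}
    (hφ : Continuous φ) {f : (Fin (n + 1) → ℝ) → ((Fin (n + 1) → Coord d) → 𝕜)}
    (hf : ContDiff ℝ ∞ f) (l : Fin n) :
    pderiv l (contract i j φ f) = contract i j φ (pderiv (i.succAbove l) f) := by
  funext s I
  set g : ℝ × ℝ → 𝕜 := fun p =>
    f (Fin.insertNth (α := fun _ => ℝ) i p.1 (s + p.2 • Pi.single l 1))
      (Fin.insertNth (α := fun _ => Coord d) i j I) with hg
  have hgs : ContDiff ℝ ∞ g := by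
    have hmap : ContDiff ℝ ∞ fun p : ℝ × ℝ => (p.1, s + p.2 • (Pi.single l 1 : Fin n → ℝ)) := by
      fun_prop
    exact contDiff_pi.1 (hf.comp ((contDiff_insertNth i).comp hmap)) _
  refine (hasDerivAt_pderiv l (contDiff_contract i j hφ hf) s I).unique ?_
  have h1 : ContDiff ℝ 1 g := hgs.of_le (by exact_mod_cast le_top)
  have h2 := (hasFDerivAt_paramIntegral hφ h1 0).hasDerivAt
  have hci : Continuous fun u : ℝ =>
      φ u • (fderiv ℝ g (u, 0)).comp (ContinuousLinearMap.inr ℝ ℝ ℝ) := by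
    have h3 := h1.continuous_fderiv (by simp)
    exact hφ.smul ((h3.comp (by fun_prop : Continuous fun u : ℝ => (u, (0 : ℝ)))).clm_comp
      continuous_const)
  rw [ContinuousLinearMap.intervalIntegral_apply (hci.intervalIntegrable _ _)] at h2
  refine h2.congr_deriv ?_
  unfold contract
  refine intervalIntegral.integral_congr fun u _ => ?_
  simp only [_root_.smul_apply, ContinuousLinearMap.comp_apply,
    ContinuousLinearMap.inr_apply]
  congr 1
  have h4 : HasDerivAt (fun t : ℝ => g (u, t)) (fderiv ℝ g (u, 0) (0, 1)) 0 := by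
    have h5 := (h1.differentiable (by simp) (u, 0)).hasFDerivAt
    have h6 : HasDerivAt (fun t : ℝ => (u, t)) ((0 : ℝ), (1 : ℝ)) 0 :=
      (hasDerivAt_const (0 : ℝ) u).prodMk (hasDerivAt_id (0 : ℝ))
    exact HasFDerivAt.comp_hasDerivAt (0 : ℝ) (f := fun t : ℝ => (u, t)) h5 h6
  refine h4.unique ?_
  have h7 := hasDerivAt_pderiv (i.succAbove l) hf (Fin.insertNth (α := fun _ => ℝ) i u s)
    (Fin.insertNth (α := fun _ => Coord d) i j I)
  have e : ∀ t : ℝ, Fin.insertNth (α := fun _ => ℝ) i u s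
      + t • (Pi.single (i.succAbove l) 1 : Fin (n + 1) → ℝ)
      = Fin.insertNth (α := fun _ => ℝ) i u (s + t • Pi.single l 1) := by
    intro t
    funext q
    rcases Fin.eq_self_or_eq_succAbove i q with rfl | ⟨q, rfl⟩
    · simp [(Fin.succAbove_ne q l).symm]
    · simp [Pi.single_apply]
  simp only [e] at h7
  exact h7

theorem pderivList_contract {n : ℕ} (i : Fin (n + 1)) (j : Coord d) {φ : ℝ → ℝ}
    (hφ : Continuous φ) {f : (Fin (n + 1) → ℝ) → ((Fin (n + 1) → Coord d) → 𝕜)}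
    (hf : ContDiff ℝ ∞ f) (l : List (Fin n)) :
    pderivList l (contract i j φ f) = contract i j φ (pderivList (l.map i.succAbove) f) := by
  induction l with
  | nil => rfl
  | cons q l ih =>
    change pderiv q (pderivList l _) = _
    rw [ih, pderiv_contract i j hφ (contDiff_pderivList _ hf)]
    rfl

theorem enorm_contract_le {n : ℕ} (i : Fin (n + 1)) (j : Coord d) {φ : ℝ → ℝ} {M : ℝ≥0}
    (hM : ∀ u ∈ Set.Icc (0 : ℝ) 1, ‖φ u‖ ≤ M)
    (f : (Fin (n + 1) → ℝ) → ((Fin (n + 1) → Coord d) → 𝕜)) (s : Fin n → ℝ) :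
    ‖contract i j φ f s‖ₑ ≤ M * ⨆ t, ‖f t‖ₑ := by
  by_cases hM0 : M = 0
  · subst hM0
    have : contract i j φ f s = 0 := by
      funext I
      rw [contract, intervalIntegral.integral_congr (g := fun _ => (0 : 𝕜))]
      · simp
      · intro u hu
        rw [Set.uIcc_of_le zero_le_one] at hu
        have : φ u = 0 := norm_le_zero_iff.1 (hM u hu)
        simp [this]
    simp [this]
  by_cases htop : (⨆ t, ‖f t‖ₑ) = ⊤
  · rw [htop, ENNReal.mul_top (by simpa using hM0)]
    exact le_top
  obtain ⟨A, hA⟩ := WithTop.ne_top_iff_exists.1 htop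
  replace hA : (⨆ t, ‖f t‖ₑ) = (A : ℝ≥0∞) := hA.symm
  have hfA : ∀ t, ‖f t‖ ≤ A := by
    intro t
    have h1 : ‖f t‖ₑ ≤ (A : ℝ≥0∞) := by
      rw [← hA]
      exact le_iSup_of_le t le_rfl
    exact_mod_cast (by simpa [enorm] using h1 : ‖f t‖₊ ≤ A)
  rw [hA, ← ENNReal.coe_mul]
  have h2 : ‖contract i j φ f s‖ ≤ (M * A : ℝ≥0) := by
    refine (pi_norm_le_iff_of_nonneg (by positivity)).2 fun I => ?_
    have := intervalIntegral.norm_integral_le_of_norm_le_const (a := (0 : ℝ)) (b := 1)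
      (C := (M * A : ℝ≥0)) (f := fun u => φ u • f (Fin.insertNth (α := fun _ => ℝ) i u s)
        (Fin.insertNth (α := fun _ => Coord d) i j I)) (by
        intro u hu
        rw [Set.uIoc_of_le zero_le_one] at hu
        rw [norm_smul, NNReal.coe_mul]
        exact mul_le_mul (hM u ⟨hu.1.le, hu.2⟩)
          ((norm_le_pi_norm _ _).trans (hfA _)) (norm_nonneg _) M.2)
    simpa [contract] using this
  have h3 : ‖contract i j φ f s‖₊ ≤ M * A := h2
  simpa [enorm] using ENNReal.coe_le_coe.2 h3

theorem derivNorm_contract_le {n : ℕ} (k : ℕ) (i : Fin (n + 1)) (j : Coord d) {φ : ℝ → ℝ}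
    (hφ : Continuous φ) {M : ℝ≥0} (hM : ∀ u ∈ Set.Icc (0 : ℝ) 1, ‖φ u‖ ≤ M)
    {f : (Fin (n + 1) → ℝ) → ((Fin (n + 1) → Coord d) → 𝕜)} (hf : ContDiff ℝ ∞ f)
    (l₀ : List (Fin (n + 1))) (h₀ : l₀ = [] ∨ l₀ = [i]) :
    derivNorm k (contract i j φ (pderivList l₀ f)) ≤ M * derivNorm (k + 1) f := by
  unfold derivNorm
  rw [Finset.mul_sum]
  let c : Fin (k + 2) := ⟨l₀.count i, by rcases h₀ with rfl | rfl <;> simp⟩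
  let e : (Fin n → Fin (k + 1)) → (Fin (n + 1) → Fin (k + 1 + 1)) := fun m =>
    Fin.insertNth (α := fun _ => Fin (k + 2)) i c (fun q => (m q).castSucc)
  have he : Function.Injective e := by
    intro m m' h
    funext q
    have := congrFun h (i.succAbove q)
    simpa [e] using this
  calc ∑ m : Fin n → Fin (k + 1),
        ⨆ s, ‖mixedDeriv (fun q => (m q : ℕ)) (contract i j φ (pderivList l₀ f)) s‖ₑ
      ≤ ∑ m : Fin n → Fin (k + 1), M * ⨆ s, ‖mixedDeriv (fun q => (e m q : ℕ)) f s‖ₑ := by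
        refine Finset.sum_le_sum fun m _ => iSup_le fun s => ?_
        rw [mixedDeriv, pderivList_contract i j hφ (contDiff_pderivList _ hf)]
        refine (enorm_contract_le i j hM _ s).trans ?_
        have h1 : pderivList (List.map i.succAbove (indexList fun q => (m q : ℕ)))
            (pderivList l₀ f)
            = pderivList (List.map i.succAbove (indexList fun q => (m q : ℕ)) ++ l₀) f := by
          simp [pderivList]
        rw [h1, pderivList_eq_mixedDeriv _ hf]
        have h2 : (fun q => (List.map i.succAbove (indexList fun q => (m q : ℕ)) ++ l₀).count q)
            = fun q => (e m q : ℕ) := by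
          funext q
          rw [List.count_append]
          rcases Fin.eq_self_or_eq_succAbove i q with rfl | ⟨q, rfl⟩
          · rw [List.count_eq_zero_of_not_mem]
            · simp [e, c]
            · simp [Fin.succAbove_ne]
          · rw [List.count_map_of_injective _ _ Fin.succAbove_right_injective, count_indexList]
            have : l₀.count (i.succAbove q) = 0 := by
              rcases h₀ with rfl | rfl <;> simp [Fin.ne_succAbove]
            simp [e, this]
        rw [h2]
    _ = ∑ m ∈ Finset.univ.image e, M * ⨆ s, ‖mixedDeriv (fun q => (m q : ℕ)) f s‖ₑ := by
        rw [Finset.sum_image he.injOn]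
    _ ≤ _ := Finset.sum_le_sum_of_subset (Finset.subset_univ _)

theorem contract_comp_perm {n : ℕ} (i : Fin (n + 1)) (j : Coord d) (φ : ℝ → ℝ)
    {f : (Fin (n + 1) → ℝ) → ((Fin (n + 1) → Coord d) → 𝕜)}
    (hf : ∀ (σ : Equiv.Perm (Fin (n + 1))), σ i = i → ∀ s I, f (s ∘ σ) (I ∘ σ) = f s I)
    (τ : Equiv.Perm (Fin n)) (s : Fin n → ℝ) (I : Fin n → Coord d) :
    contract i j φ f (s ∘ τ) (I ∘ τ) = contract i j φ f s I := by
  let σ : Equiv.Perm (Fin (n + 1)) :=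
    ((finSuccEquiv' i).trans (Equiv.optionCongr τ)).trans (finSuccEquiv' i).symm
  have h1 : σ i = i := by simp [σ]
  have h2 : ∀ q, σ (i.succAbove q) = i.succAbove (τ q) := by
    intro q
    simp [σ]
  have h3 : ∀ {X : Type} (x : X) (v : Fin n → X),
      Fin.insertNth (α := fun _ => X) i x (v ∘ τ) = Fin.insertNth (α := fun _ => X) i x v ∘ σ := by
    intro X x v
    funext q
    rcases Fin.eq_self_or_eq_succAbove i q with rfl | ⟨q, rfl⟩
    · simp [h1]
    · simp [h2]
  unfold contract
  refine intervalIntegral.integral_congr fun u _ => ?_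
  simp only [h3, hf σ h1]

theorem pderiv_comp_perm {n : ℕ} (i : Fin n) {f : (Fin n → ℝ) → ((Fin n → Coord d) → 𝕜)}
    (hs : ContDiff ℝ ∞ f)
    (hf : ∀ (σ : Equiv.Perm (Fin n)) s I, f (s ∘ σ) (I ∘ σ) = f s I)
    (σ : Equiv.Perm (Fin n)) (hσ : σ i = i) (s : Fin n → ℝ) (I : Fin n → Coord d) :
    pderiv i f (s ∘ σ) (I ∘ σ) = pderiv i f s I := by
  refine (hasDerivAt_pderiv i hs (s ∘ σ) (I ∘ σ)).unique ?_
  have e : ∀ t : ℝ, (s ∘ σ) + t • (Pi.single i 1 : Fin n → ℝ)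
      = (s + t • (Pi.single i 1 : Fin n → ℝ)) ∘ σ := by
    intro t
    funext q
    have : (Pi.single i 1 : Fin n → ℝ) q = (Pi.single i 1 : Fin n → ℝ) (σ q) := by
      nth_rewrite 2 [← hσ]
      simp [Pi.single_apply]
    simp [this]
  simp only [e, hf]
  exact hasDerivAt_pderiv i hs s I

theorem contract_periodic {n : ℕ} (i : Fin (n + 1)) (j : Coord d) (φ : ℝ → ℝ)
    {f : (Fin (n + 1) → ℝ) → ((Fin (n + 1) → Coord d) → 𝕜)}
    (hf : ∀ (s : Fin (n + 1) → ℝ) (z : Fin (n + 1) → ℤ), f (fun q => s q + z q) = f s)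
    (s : Fin n → ℝ) (z : Fin n → ℤ) :
    contract i j φ f (fun q => s q + z q) = contract i j φ f s := by
  funext I
  unfold contract
  refine intervalIntegral.integral_congr fun u _ => ?_
  have e : Fin.insertNth (α := fun _ => ℝ) i u (fun q => s q + z q)
      = fun q => Fin.insertNth (α := fun _ => ℝ) i u s q
        + (Fin.insertNth (α := fun _ => ℤ) i 0 z q : ℤ) := by
    funext q
    rcases Fin.eq_self_or_eq_succAbove i q with rfl | ⟨q, rfl⟩
    · simp
    · simp
  simp only [e, hf]

theorem pderiv_periodic {n : ℕ} (i : Fin n) {f : (Fin n → ℝ) → ((Fin n → Coord d) → 𝕜)}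
    (hf : ∀ (s : Fin n → ℝ) (z : Fin n → ℤ), f (fun q => s q + z q) = f s)
    (s : Fin n → ℝ) (z : Fin n → ℤ) :
    pderiv i f (fun q => s q + z q) = pderiv i f s := by
  have h := fderiv_comp_add_right (𝕜 := ℝ) (f := f) (x := s) (fun q => (z q : ℝ))
  have e : (fun x : Fin n → ℝ => f (x + fun q => (z q : ℝ))) = f := funext fun x => hf x z
  rw [e] at h
  unfold pderiv
  rw [h]
  rfl

theorem isConnes_annihKernel {h : ℝ → Coord d → ℝ} (hc : ∀ j, Continuous fun u => h u j)
    (hd : ∀ j, Continuous (deriv fun u => h u j)) {F : Kernels 𝕜 d} (hF : IsConnes F) :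
    IsConnes (annihKernel h F) := by
  have hsm : ∀ n (i : Fin (n + 1)) (j : Coord d), ContDiff ℝ ∞
      (contract i j (fun u => h u j) (F (n + 1)) +
        contract i j (deriv fun u => h u j) (pderiv i (F (n + 1)))) := fun n i j =>
    (contDiff_contract i j (hc j) (hF.smooth _)).add
      (contDiff_contract i j (hd j) (contDiff_pderiv i (hF.smooth _)))
  have hsm' : ∀ n (i : Fin (n + 1)), ContDiff ℝ ∞
      (∑ j : Coord d, (contract i j (fun u => h u j) (F (n + 1)) +
        contract i j (deriv fun u => h u j) (pderiv i (F (n + 1))))) := by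
    intro n i
    have := ContDiff.sum (s := Finset.univ) fun j _ => hsm n i j
    convert this using 1
    funext s
    simp
  refine ⟨fun n => ?_, fun n s z => ?_, fun n τ s I => ?_, fun k C => ?_⟩
  · have := ContDiff.sum (s := Finset.univ) fun i _ => hsm' n i
    convert this using 1
    funext s
    simp [annihKernel]
  · simp only [annihKernel, Finset.sum_apply, Pi.add_apply]
    refine Finset.sum_congr rfl fun i _ => Finset.sum_congr rfl fun j _ => ?_
    rw [contract_periodic i j _ (hF.periodic _),
      contract_periodic i j _ (pderiv_periodic i (hF.periodic _))]
  · simp only [annihKernel, Finset.sum_apply, Pi.add_apply]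
    refine Finset.sum_congr rfl fun i _ => Finset.sum_congr rfl fun j _ => ?_
    rw [contract_comp_perm i j _ (fun σ _ => hF.symmetric _ σ),
      contract_comp_perm i j _ (pderiv_comp_perm i (hF.smooth _) (hF.symmetric _))]
  · have hb : ∀ j, ∃ M : ℝ≥0, ∀ u ∈ Set.Icc (0 : ℝ) 1, ‖h u j‖ ≤ M ∧
        ‖deriv (fun u => h u j) u‖ ≤ M := by
      intro j
      obtain ⟨M₁, h₁⟩ := (isCompact_Icc (a := (0 : ℝ)) (b := 1)).exists_bound_of_continuousOn
        (hc j).continuousOn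
      obtain ⟨M₂, h₂⟩ := (isCompact_Icc (a := (0 : ℝ)) (b := 1)).exists_bound_of_continuousOn
        (hd j).continuousOn
      refine ⟨Real.toNNReal (max M₁ M₂), fun u hu => ⟨?_, ?_⟩⟩
      · exact ((h₁ u hu).trans (le_max_left _ _)).trans (Real.le_coe_toNNReal _)
      · exact ((h₂ u hu).trans (le_max_right _ _)).trans (Real.le_coe_toNNReal _)
    choose M hM using hb
    have hn : ∀ n, derivNorm k (annihKernel h F n)
        ≤ ((n + 1 : ℕ) : ℝ≥0∞) * ((∑ j, (M j + M j : ℝ≥0∞)) * derivNorm (k + 1) (F (n + 1))) := by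
      intro n
      refine (derivNorm_sum_le k _ _ fun i _ => hsm' n i).trans ?_
      have h1 : ∀ i : Fin (n + 1), derivNorm k
          (∑ j : Coord d, (contract i j (fun u => h u j) (F (n + 1)) +
            contract i j (deriv fun u => h u j) (pderiv i (F (n + 1)))))
          ≤ (∑ j, (M j + M j : ℝ≥0∞)) * derivNorm (k + 1) (F (n + 1)) := by
        intro i
        refine (derivNorm_sum_le k _ _ fun j _ => hsm n i j).trans ?_
        rw [Finset.sum_mul]
        refine Finset.sum_le_sum fun j _ => ?_
        refine (derivNorm_add_le k (contDiff_contract i j (hc j) (hF.smooth _))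
          (contDiff_contract i j (hd j) (contDiff_pderiv i (hF.smooth _)))).trans ?_
        rw [add_mul]
        exact add_le_add
          (derivNorm_contract_le k i j (hc j) (fun u hu => (hM j u hu).1) (hF.smooth _) []
            (Or.inl rfl))
          (derivNorm_contract_le k i j (hd j) (fun u hu => (hM j u hu).2) (hF.smooth _) [i]
            (Or.inr rfl))
      refine (Finset.sum_le_sum fun i _ => h1 i).trans ?_
      rw [Finset.sum_const, Finset.card_univ, Fintype.card_fin, nsmul_eq_mul]
    set A : ℝ≥0∞ := ∑ j, (M j + M j : ℝ≥0∞) with hA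
    have hAt : A ≠ ⊤ := by
      rw [hA]
      exact (ENNReal.sum_lt_top.2 fun j _ => by simp).ne
    have hfin : A * connesNorm (k + 1) (2 * (C + 1)) F ≠ ⊤ :=
      ENNReal.mul_ne_top hAt (hF.finite _ _)
    refine ne_top_of_le_ne_top hfin ?_
    calc connesNorm k C (annihKernel h F)
        ≤ ∑' n, A * (((2 * (C + 1) : ℝ≥0) : ℝ≥0∞) ^ (n + 1) * derivNorm (k + 1) (F (n + 1))) := by
          refine ENNReal.tsum_le_tsum fun n => ?_
          have hC : C ^ n * ((n + 1 : ℕ) : ℝ≥0) ≤ (2 * (C + 1)) ^ (n + 1) := by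
            have e1 : C ^ n ≤ (C + 1) ^ (n + 1) :=
              (pow_le_pow_left₀ zero_le (le_add_of_nonneg_right zero_le_one) n).trans
                (pow_le_pow_right₀ (le_add_of_nonneg_left zero_le) n.le_succ)
            have e2 : ((n + 1 : ℕ) : ℝ≥0) ≤ 2 ^ (n + 1) := by
              exact_mod_cast (Nat.lt_two_pow_self (n := n + 1)).le
            rw [mul_pow, mul_comm]
            exact mul_le_mul' e2 e1
          have hC' : (C : ℝ≥0∞) ^ n * ((n + 1 : ℕ) : ℝ≥0∞)
              ≤ ((2 * (C + 1) : ℝ≥0) : ℝ≥0∞) ^ (n + 1) := by exact_mod_cast hC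
          calc (C : ℝ≥0∞) ^ n * derivNorm k (annihKernel h F n)
              ≤ (C : ℝ≥0∞) ^ n * (((n + 1 : ℕ) : ℝ≥0∞) * (A * derivNorm (k + 1) (F (n + 1)))) := by
                gcongr
                exact hn n
            _ = A * (((C : ℝ≥0∞) ^ n * ((n + 1 : ℕ) : ℝ≥0∞)) * derivNorm (k + 1) (F (n + 1))) := by
                ring
            _ ≤ _ := by gcongr
      _ = A * ∑' n, (((2 * (C + 1) : ℝ≥0) : ℝ≥0∞) ^ (n + 1) * derivNorm (k + 1) (F (n + 1))) :=
          ENNReal.tsum_mul_left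
      _ ≤ A * connesNorm (k + 1) (2 * (C + 1)) F := by
          gcongr
          exact ENNReal.tsum_comp_le_tsum_of_injective (add_left_injective 1)
            (fun n => ((2 * (C + 1) : ℝ≥0) : ℝ≥0∞) ^ n * derivNorm (k + 1) (F n))

/-- The `k`-th element of the Fourier basis of the scalar loop space, orthonormal for the inner
product `∫ x y + ∫ x' y'`: cosines for `k ≥ 0` and sines for `k < 0`. -/
noncomputable def fourierMode (k : ℤ) (s : ℝ) : ℝ :=
  if k = 0 then 1
  else if 0 < k then
    √2 * Real.cos (2 * Real.pi * k * s) / √(4 * Real.pi ^ 2 * (k : ℝ) ^ 2 + 1)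
  else √2 * Real.sin (2 * Real.pi * k * s) / √(4 * Real.pi ^ 2 * (k : ℝ) ^ 2 + 1)

/-- The basis loops: `basisLoop (inl i) k` is `γ_{i,k}` and `basisLoop (inr i) k` is `γ*_{i,k}`. -/
noncomputable def basisLoop (v : Coord d) (k : ℤ) : ℝ → Coord d → ℝ :=
  fun s j => if j = v then fourierMode k s else 0

theorem contDiff_basisLoop (v : Coord d) (k : ℤ) (j : Coord d) :
    ContDiff ℝ ∞ fun s => basisLoop v k s j := by
  unfold basisLoop fourierMode
  split_ifs <;> fun_prop

variable (𝕜) in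
/-- `D v k` is the derivation `D_{γ_{i,k}}` for `v = inl i` and `D_{γ*_{i,k}}` for `v = inr i`: the
annihilation operator of the corresponding basis loop. -/
noncomputable def D (v : Coord d) (k : ℤ) (F : CO 𝕜 d) : CO 𝕜 d :=
  ⟨annihKernel (basisLoop v k) F,
    isConnes_annihKernel (fun j => (contDiff_basisLoop v k j).continuous)
      (fun j => (contDiff_basisLoop v k j).continuous_deriv (by simp)) F.2⟩

/-- The composition of the derivations `D v k` over a finite word of pairs `(v, k)`. -/
noncomputable def iterD {r : ℕ} (w : Fin r → Coord d × ℤ) (F : CO 𝕜 d) : CO 𝕜 d :=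
  (List.ofFn w).foldr (fun x => D 𝕜 x.1 x.2) F

/-! ### Bidifferential operators, Poisson bracket and star products -/

/-- The terms of the `r`-th power, in the sense of bidifferential operators, of
`(F, G) ↦ ∑_{u,v,k} c u v k :D_{u,k} F . D_{v,k} G:`. -/
noncomputable def bidiffTerm (c : Coord d → Coord d → ℤ → 𝕜) (r : ℕ) (F G : CO 𝕜 d)
    (w : Fin r → Coord d × Coord d × ℤ) : CO 𝕜 d :=
  (∏ l, c (w l).1 (w l).2.1 (w l).2.2) •
    wick (iterD (fun l => ((w l).1, (w l).2.2)) F) (iterD (fun l => ((w l).2.1, (w l).2.2)) G)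

/-- The Poisson matrix of the canonical symplectic form: `ω^{ii*} = 1`, `ω^{i*i} = -1`, and all
other entries vanish. -/
def poissonCoeff : Coord d → Coord d → ℤ → 𝕜
  | Sum.inl i, Sum.inr j, _ => if i = j then 1 else 0
  | Sum.inr i, Sum.inl j, _ => if i = j then -1 else 0
  | _, _, _ => 0

/-- The coefficients of the symmetric operator
`E_A(F, G) = ∑_{i,k} α_k (:D_{γ_{i,k}}F . D_{γ*_{i,k}}G: + :D_{γ*_{i,k}}F . D_{γ_{i,k}}G:)`. -/
def symmCoeff (α : ℤ → 𝕜) : Coord d → Coord d → ℤ → 𝕜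
  | Sum.inl i, Sum.inr j, k => if i = j then α k else 0
  | Sum.inr i, Sum.inl j, k => if i = j then α k else 0
  | _, _, _ => 0

/-- The terms of the Poisson bracket. -/
noncomputable def poissonTerm (F G : CO 𝕜 d) (x : Coord d × Coord d × ℤ) : CO 𝕜 d :=
  (poissonCoeff x.1 x.2.1 x.2.2 : 𝕜) • wick (D 𝕜 x.1 x.2.2 F) (D 𝕜 x.2.1 x.2.2 G)

/-- The Poisson bracket `{F, G} = ∑_{u,v,k} ω^{uv} :D_{u,k} F . D_{v,k} G:`. -/
noncomputable def poissonBracket (F G : CO 𝕜 d) : CO 𝕜 d := ∑' x, poissonTerm F G x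

/-- The terms of `P^r(F, G)`. -/
noncomputable def moyalTerm (r : ℕ) (F G : CO 𝕜 d) : (Fin r → Coord d × Coord d × ℤ) → CO 𝕜 d :=
  bidiffTerm poissonCoeff r F G

/-- The operators `P^r` of the Moyal product: the powers of the Poisson bracket. -/
noncomputable def moyal (r : ℕ) (F G : CO 𝕜 d) : CO 𝕜 d := ∑' w, moyalTerm r F G w

/-- The terms of `C_r^A(F, G)`. -/
noncomputable def deformedTerm (α : ℤ → 𝕜) (r : ℕ) (F G : CO 𝕜 d) :
    (Fin r → Coord d × Coord d × ℤ) → CO 𝕜 d :=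
  bidiffTerm (poissonCoeff + symmCoeff α) r F G

/-- The operators `C_r^A = (C_1^A)^r` of the deformed product, where `C_1^A = {·,·} + E_A` for
`A : γ_{i,k} ↦ α_k γ_{i,k}`. -/
noncomputable def deformed (α : ℤ → 𝕜) (r : ℕ) (F G : CO 𝕜 d) : CO 𝕜 d :=
  ∑' w, deformedTerm α r F G w

/-- The terms of the operator `T₁ = -∑_{i,k} α_k D_{γ_{i,k}} D_{γ*_{i,k}}`. -/
noncomputable def intertwinerTerm (α : ℤ → 𝕜) (F : CO 𝕜 d) (x : Fin d × ℤ) : CO 𝕜 d :=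
  -(α x.2 • D 𝕜 (Sum.inl x.1) x.2 (D 𝕜 (Sum.inr x.1) x.2 F))

/-- A Poisson structure on the Connes space. -/
structure IsPoissonStructure (br : CO 𝕜 d → CO 𝕜 d → CO 𝕜 d) : Prop where
  bilinear : ∃ B : CO 𝕜 d →ₗ[𝕜] CO 𝕜 d →ₗ[𝕜] CO 𝕜 d, ∀ F G, B F G = br F G
  antisymm : ∀ F G, br F G = -br G F
  jacobi : ∀ F G H, br F (br G H) + br G (br H F) + br H (br F G) = 0
  leibniz : ∀ F G H, br F (wick G H) = wick (br F G) H + wick G (br F H)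
  bounded : ∀ p, ∃ (K : ℝ) (q : ℕ × ℝ≥0), ∀ F G,
    coSeminorm 𝕜 d p (br F G) ≤ K * coSeminorm 𝕜 d q F * coSeminorm 𝕜 d q G

end Connes

/-! ### Formal power series in `ħ` -/

/-- Formal power series `∑ ħⁿ Fₙ` with coefficients in `M`. -/
def FormalSeries (M : Type u) : Type u := ℕ → M

theorem sum_antidiagonal_assoc {M : Type*} [AddCommMonoid M] (n : ℕ) (g : ℕ → ℕ → ℕ → M) :
    ∑ p ∈ antidiagonal n, ∑ q ∈ antidiagonal p.1, g q.1 q.2 p.2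
      = ∑ p ∈ antidiagonal n, ∑ q ∈ antidiagonal p.2, g p.1 q.1 q.2 := by
  simp only [Finset.sum_sigma']
  refine Finset.sum_nbij' (fun x => ⟨(x.2.1, x.2.2 + x.1.2), (x.2.2, x.1.2)⟩)
    (fun x => ⟨(x.1.1 + x.2.1, x.2.2), (x.1.1, x.2.1)⟩) ?_ ?_ ?_ ?_ ?_
  all_goals
    rintro ⟨⟨a, b⟩, ⟨c, e⟩⟩ h
    simp only [mem_sigma, HasAntidiagonal.mem_antidiagonal] at h
    obtain ⟨h1, h2⟩ := h
    subst h2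
  · simp [← h1, add_assoc]
  · simp [← h1, add_assoc]
  · rfl
  · rfl
  · rfl

theorem sum_antidiagonal_left_comm {M : Type*} [AddCommMonoid M] (n : ℕ) (g : ℕ → ℕ → ℕ → M) :
    ∑ p ∈ antidiagonal n, ∑ q ∈ antidiagonal p.2, g p.1 q.1 q.2
      = ∑ p ∈ antidiagonal n, ∑ q ∈ antidiagonal p.2, g q.1 p.1 q.2 := by
  rw [← sum_antidiagonal_assoc, ← sum_antidiagonal_assoc n fun a b c => g b a c]
  refine Finset.sum_congr rfl fun p _ => ?_
  exact (Finset.Nat.sum_antidiagonal_swap (n := p.1) (f := fun q => g q.1 q.2 p.2)).symm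

namespace FormalSeries

variable {𝕜 : Type u} [RCLike 𝕜] {M : Type u} [AddCommGroup M] [Module 𝕜 M]

instance : AddCommGroup (FormalSeries M) := inferInstanceAs (AddCommGroup (ℕ → M))

/-- Power series act on formal series by the Cauchy product. -/
noncomputable instance : Module 𝕜⟦X⟧ (FormalSeries M) where
  smul f F := fun n => ∑ p ∈ antidiagonal n, PowerSeries.coeff p.1 f • F p.2
  one_smul F := by
    funext n
    change ∑ p ∈ antidiagonal n, PowerSeries.coeff p.1 (1 : 𝕜⟦X⟧) • F p.2 = F n
    rw [Finset.sum_eq_single (0, n)]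
    · simp
    · rintro ⟨a, b⟩ h hne
      rw [HasAntidiagonal.mem_antidiagonal] at h
      have : a ≠ 0 := by
        rintro rfl
        simp at h
        exact hne (by rw [h])
      simp [PowerSeries.coeff_one, this]
    · simp
  mul_smul f g F := by
    funext n
    change ∑ p ∈ antidiagonal n, PowerSeries.coeff p.1 (f * g) • F p.2
      = ∑ p ∈ antidiagonal n, PowerSeries.coeff p.1 f •
        ∑ q ∈ antidiagonal p.2, PowerSeries.coeff q.1 g • F q.2
    simp only [PowerSeries.coeff_mul, Finset.sum_smul, Finset.smul_sum, mul_smul]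
    exact sum_antidiagonal_assoc n fun a b c =>
      PowerSeries.coeff a f • PowerSeries.coeff b g • F c
  smul_zero f := by
    funext n
    exact Finset.sum_eq_zero fun p _ => smul_zero _
  smul_add f F G := by
    funext n
    exact (Finset.sum_congr rfl fun p _ => smul_add _ _ _).trans Finset.sum_add_distrib
  add_smul f g F := by
    funext n
    change ∑ p ∈ antidiagonal n, PowerSeries.coeff p.1 (f + g) • F p.2
      = ∑ p ∈ antidiagonal n, PowerSeries.coeff p.1 f • F p.2
        + ∑ p ∈ antidiagonal n, PowerSeries.coeff p.1 g • F p.2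
    simp [add_smul, Finset.sum_add_distrib]
  zero_smul F := by
    funext n
    change ∑ p ∈ antidiagonal n, PowerSeries.coeff p.1 (0 : 𝕜⟦X⟧) • F p.2 = 0
    simp

end FormalSeries

section Equivalence

variable {𝕜 : Type u} [RCLike 𝕜] {d : ℕ}

/-- The product `F ⋆ G = ∑_r ħʳ/r! P^r(F, G)`, extended from the Connes space to formal series:
the coefficient of `ħⁿ` of `(∑ ħᵃ F_a) ⋆ (∑ ħᵇ G_b)` is `∑_{r+a+b=n} P^r(F_a, G_b)/r!`. -/
noncomputable def starProduct (P : ℕ → CO 𝕜 d → CO 𝕜 d → CO 𝕜 d)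
    (F G : FormalSeries (CO 𝕜 d)) : FormalSeries (CO 𝕜 d) := fun n =>
  ∑ p ∈ antidiagonal n, ∑ q ∈ antidiagonal p.2,
    ((p.1.factorial : 𝕜)⁻¹ • P p.1 (F q.1) (G q.2))

/-- The operators `P^r` define a star product (a deformation quantization) of the bracket `br`. -/
structure IsStarProduct (br : CO 𝕜 d → CO 𝕜 d → CO 𝕜 d)
    (P : ℕ → CO 𝕜 d → CO 𝕜 d → CO 𝕜 d) : Prop where
  bilinear : ∀ r, ∃ B : CO 𝕜 d →ₗ[𝕜] CO 𝕜 d →ₗ[𝕜] CO 𝕜 d, ∀ F G, B F G = P r F G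
  formal_bilinear : ∃ B : FormalSeries (CO 𝕜 d) →ₗ[𝕜⟦X⟧] FormalSeries (CO 𝕜 d) →ₗ[𝕜⟦X⟧]
    FormalSeries (CO 𝕜 d), ∀ F G, B F G = starProduct P F G
  zero : ∀ F G, P 0 F G = wick F G
  one : ∀ F G, P 1 F G - P 1 G F = (2 : 𝕜) • br F G
  bounded : ∀ r, 0 < r → ∀ p, ∃ (K : ℝ) (q : ℕ × ℝ≥0), ∀ F G,
    coSeminorm 𝕜 d p (P r F G) ≤ K * coSeminorm 𝕜 d q F * coSeminorm 𝕜 d q G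
  assoc : ∀ F G H : FormalSeries (CO 𝕜 d),
    starProduct P F (starProduct P G H) = starProduct P (starProduct P F G) H

/-- The `𝕜[[ħ]]`-linear operator `∑_r ħʳ T_r` on formal series. -/
noncomputable def formalOperator (T : ℕ → CO 𝕜 d →L[𝕜] CO 𝕜 d) :
    FormalSeries (CO 𝕜 d) →ₗ[𝕜⟦X⟧] FormalSeries (CO 𝕜 d) where
  toFun F := fun n => ∑ p ∈ antidiagonal n, T p.1 (F p.2)
  map_add' F G := by
    funext n
    exact (Finset.sum_congr rfl fun p _ => map_add (T p.1) _ _).trans Finset.sum_add_distrib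
  map_smul' f F := by
    funext n
    change ∑ p ∈ antidiagonal n, T p.1 (∑ q ∈ antidiagonal p.2, PowerSeries.coeff q.1 f • F q.2)
      = ∑ p ∈ antidiagonal n, PowerSeries.coeff p.1 f • ∑ q ∈ antidiagonal p.2, T q.1 (F q.2)
    simp only [map_sum, map_smul, Finset.smul_sum]
    exact sum_antidiagonal_left_comm n fun a b c => PowerSeries.coeff b f • T a (F c)

/-- `T = id + ∑_{r ≥ 1} ħʳ T_r`, with continuous `T_r`, is an equivalence from the star product of
`P₁` to the star product of `P₂`. -/
structure IsStarEquivalence (P₁ P₂ : ℕ → CO 𝕜 d → CO 𝕜 d → CO 𝕜 d)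
    (T : ℕ → CO 𝕜 d →L[𝕜] CO 𝕜 d) : Prop where
  zero : T 0 = ContinuousLinearMap.id 𝕜 (CO 𝕜 d)
  map_star : ∀ F G : FormalSeries (CO 𝕜 d),
    formalOperator T (starProduct P₁ F G)
      = starProduct P₂ (formalOperator T F) (formalOperator T G)

end Equivalence

end ConnesSpace

namespace ConnesSpace

open scoped ContDiff NNReal ENNReal PowerSeries
open Finset

universe u

/-! ### Series of smooth functions -/

section Series

variable {n : ℕ} {E : Type*} [NormedAddCommGroup E] [NormedSpace ℝ E]

/-! The analysis rests on one fact: the Fourier modes are eigenfunctions of `1 - d²/ds²`, with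
eigenvalue `λ_k = 4π²k² + 1` (`modeEigenvalue`). By integration by parts on the circle, the pairing
`∫ c_k f + ∫ c_k' f'` equals `∫ c_k (1 - ∂²) f = λ_k ∫ c_k f`. The kernels are symmetric, so all
their contractions agree, and `D v k` is `n + 1` times a single `L²` contraction (`coe_D`). Further
integrations by parts trade derivatives of `F` for powers of `λ_k⁻¹`: for every `M`, some `K` and
`q` give `‖D F‖_p ≤ K λ_k⁻ᴹ ‖F‖_q`, uniformly in the mode (`coSeminorm_D_le`). This decay beats the
polynomial growth of `α_k`. Absolutely convergent series have a sum in the Connes space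
(`hasSum_pointwiseSum`), so every series in the theorem converges, with the required seminorm
bounds.

The algebra uses only that the Wick product is commutative and associative, and that the operators
`D v k` are derivations of it (`D_wick`) that commute (`D_comm`). Powers of a bidifferential
operator are handled by the recursion `bidiffPow`, which applies one factor at a time;
`hasSum_bidiffTerm` identifies it with the sum over words. Each `D v k` is then a derivation of
every power as well (`D_bidiffPow`).

The identities between star products follow one pattern: after multiplication by `n!`, both sides
satisfy the same recursion in `n` and agree at `n = 0`. For associativity, the recursion applies the
operator to each of the three pairs of arguments `F, G, H` (`hasSum_rightNested`,
`hasSum_leftNested`). The Jacobi identity is a consequence: the second-order part of associativity,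
summed cyclically, leaves four times the Jacobi sum, because `P²` is symmetric.

For the equivalence, `T₁` is a second-order operator, so its failure to be a derivation of `P^r` is
exactly one more application of the symmetric operator `E_A` (`intertwiner_bidiffPow`). Hence `n!`
times the `n`-th coefficients `X_n` of `T(F ⋆ᴬ G)` and of `T(F) ⋆ T(G)` both satisfy `X_{n+1}(F, G)
= X_n(T₁F, G) + X_n(F, T₁G) + ∑ ω^{uv} X_n(D_u F, D_v G)`, the term with `E_A` having cancelled on
the left-hand side (`expStar_eq_starExp`). -/

theorem pderivList_append (l l' : List (Fin n)) (f : (Fin n → ℝ) → E) :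
    pderivList (l ++ l') f = pderivList l (pderivList l' f) := by
  simp [pderivList]

theorem fderiv_eq_sum_pderiv (f : (Fin n → ℝ) → E) (s : Fin n → ℝ) :
    fderiv ℝ f s = ∑ i, (ContinuousLinearMap.proj (R := ℝ) (φ := fun _ : Fin n => ℝ) i).smulRight
      (pderiv i f s) := by
  ext v
  have : v = ∑ i, v i • (Pi.single i (1 : ℝ) : Fin n → ℝ) := by
    funext j
    simp [Pi.single_apply]
  conv_lhs => rw [this]
  simp [pderiv]

/-- Coordinates are bounded by the sup norm of the vector. Bounds on partial derivatives thus
control the total derivative, as differentiation under the sum requires. -/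
theorem norm_fderiv_le_sum_pderiv (f : (Fin n → ℝ) → E) (s : Fin n → ℝ) :
    ‖fderiv ℝ f s‖ ≤ ∑ i, ‖pderiv i f s‖ := by
  refine ContinuousLinearMap.opNorm_le_bound _ (by positivity) fun v => ?_
  rw [fderiv_eq_sum_pderiv, _root_.sum_apply, Finset.sum_mul]
  refine norm_sum_le_of_le _ fun i _ => ?_
  simp only [ContinuousLinearMap.smulRight_apply, ContinuousLinearMap.proj_apply, norm_smul]
  rw [mul_comm]
  gcongr
  exact norm_le_pi_norm v i

theorem derivNorm_mono {n : ℕ} {k k' : ℕ} (hk : k ≤ k') (f : (Fin n → ℝ) → E) :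
    derivNorm k f ≤ derivNorm k' f := by
  unfold derivNorm
  let e : (Fin n → Fin (k + 1)) ↪ (Fin n → Fin (k' + 1)) :=
    ⟨fun m i => Fin.castLE (by omega) (m i), fun m m' h => by
      funext i
      simpa using congrFun h i⟩
  calc ∑ m : Fin n → Fin (k + 1), ⨆ s, ‖mixedDeriv (fun i => (m i : ℕ)) f s‖ₑ
      = ∑ m ∈ Finset.univ.map e, ⨆ s, ‖mixedDeriv (fun i => (m i : ℕ)) f s‖ₑ := by
        rw [Finset.sum_map]
        rfl
    _ ≤ _ := Finset.sum_le_sum_of_subset (Finset.subset_univ _)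

variable {ι : Type*}

/-- Every iterated partial derivative of the family `f` has a summable uniform bound. -/
def SummableDerivs (f : ι → (Fin n → ℝ) → E) : Prop :=
  ∀ l : List (Fin n), ∃ u : ι → ℝ, Summable u ∧ ∀ x s, ‖pderivList l (f x) s‖ ≤ u x

theorem SummableDerivs.pderivList {f : ι → (Fin n → ℝ) → E} (hs : SummableDerivs f)
    (l' : List (Fin n)) : SummableDerivs fun x => pderivList l' (f x) := by
  intro l
  simpa only [pderivList_append] using hs (l ++ l')

theorem enorm_pderivList_le_derivNorm {k : ℕ} {l : List (Fin n)} (hl : l.length ≤ k)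
    {f : (Fin n → ℝ) → E} (hf : ContDiff ℝ ∞ f) (s : Fin n → ℝ) :
    ‖pderivList l f s‖ₑ ≤ derivNorm k f := by
  rw [pderivList_eq_mixedDeriv l hf]
  refine (le_iSup (fun s => ‖mixedDeriv (fun i => l.count i) f s‖ₑ) s).trans ?_
  -- No coordinate occurs more often than the length of the list, so its multi-index is one of those
  -- summed in `derivNorm k`.
  exact Finset.single_le_sum (f := fun m : Fin n → Fin (k + 1) =>
    ⨆ s, ‖mixedDeriv (fun i => (m i : ℕ)) f s‖ₑ) (fun _ _ => zero_le)
    (Finset.mem_univ fun i => (⟨l.count i, by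
      have := List.count_le_length (a := i) (l := l); omega⟩ : Fin (k + 1)))

theorem summableDerivs_of_derivNorm {f : ι → (Fin n → ℝ) → E} (hf : ∀ x, ContDiff ℝ ∞ (f x))
    (h : ∀ k, ∑' x, derivNorm k (f x) ≠ ⊤) : SummableDerivs f := by
  intro l
  refine ⟨fun x => (derivNorm l.length (f x)).toReal, ENNReal.summable_toReal (h _),
    fun x s => ?_⟩
  rw [← toReal_enorm]
  exact ENNReal.toReal_mono (ENNReal.ne_top_of_tsum_ne_top (h _) x)
    (enorm_pderivList_le_derivNorm le_rfl (hf x) s)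

variable [CompleteSpace E]

theorem SummableDerivs.hasFDerivAt_tsum {f : ι → (Fin n → ℝ) → E} (hs : SummableDerivs f)
    (hf : ∀ x, ContDiff ℝ ∞ (f x)) (s : Fin n → ℝ) :
    HasFDerivAt (fun s => ∑' x, f x s) (∑' x, fderiv ℝ (f x) s) s := by
  choose u hu hb using fun i : Fin n => hs [i]
  obtain ⟨u₀, hu₀, hb₀⟩ := hs []
  refine _root_.hasFDerivAt_tsum (𝕜 := ℝ) (u := fun x => ∑ i, u i x)
    (summable_sum fun i _ => hu i)
    (fun x s => ((hf x).differentiable (by simp) s).hasFDerivAt) (fun x s => ?_) (x₀ := s)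
    (Summable.of_norm_bounded hu₀ fun x => hb₀ x s) s
  exact (norm_fderiv_le_sum_pderiv _ _).trans (Finset.sum_le_sum fun i _ => hb i x s)

theorem SummableDerivs.pderiv_tsum {f : ι → (Fin n → ℝ) → E} (hs : SummableDerivs f)
    (hf : ∀ x, ContDiff ℝ ∞ (f x)) (i : Fin n) :
    pderiv i (fun s => ∑' x, f x s) = fun s => ∑' x, pderiv i (f x) s := by
  funext s
  choose u hu hb using fun i : Fin n => hs [i]
  have hsum : Summable fun x => fderiv ℝ (f x) s :=
    Summable.of_norm_bounded (summable_sum fun i _ => hu i) fun x =>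
      (norm_fderiv_le_sum_pderiv (f x) s).trans (Finset.sum_le_sum fun i _ => hb i x s)
  rw [pderiv, (hs.hasFDerivAt_tsum hf s).fderiv]
  exact (ContinuousLinearMap.apply ℝ E (Pi.single i (1 : ℝ))).map_tsum hsum

/-- The derivative of the sum is a linear expression in the sums of the partial derivatives, and
these families again have summable bounds. The induction on the order of smoothness therefore runs
over all families at once. -/
theorem SummableDerivs.contDiff_tsum {f : ι → (Fin n → ℝ) → E} (hs : SummableDerivs f)
    (hf : ∀ x, ContDiff ℝ ∞ (f x)) : ContDiff ℝ ∞ fun s => ∑' x, f x s := by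
  rw [contDiff_infty]
  intro m
  induction m generalizing f with
  | zero =>
    exact contDiff_zero.2 (continuous_iff_continuousAt.2 fun s =>
      (hs.hasFDerivAt_tsum hf s).continuousAt)
  | succ m ih =>
    push_cast
    rw [contDiff_succ_iff_fderiv]
    refine ⟨fun s => (hs.hasFDerivAt_tsum hf s).differentiableAt, by simp, ?_⟩
    have e : fderiv ℝ (fun s => ∑' x, f x s) = fun s => ∑ i,
        ContinuousLinearMap.smulRightL ℝ (Fin n → ℝ) E
          (ContinuousLinearMap.proj (R := ℝ) (φ := fun _ : Fin n => ℝ) i)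
          (∑' x, pderiv i (f x) s) := by
      funext s
      rw [fderiv_eq_sum_pderiv]
      refine Finset.sum_congr rfl fun i _ => ?_
      rw [hs.pderiv_tsum hf i]
      rfl
    rw [e]
    exact ContDiff.sum fun i _ => (ContinuousLinearMap.contDiff _).comp
      (ih (hs.pderivList [i]) fun x => contDiff_pderiv i (hf x))

theorem SummableDerivs.pderivList_tsum {f : ι → (Fin n → ℝ) → E} (hs : SummableDerivs f)
    (hf : ∀ x, ContDiff ℝ ∞ (f x)) (l : List (Fin n)) :
    ConnesSpace.pderivList l (fun s => ∑' x, f x s)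
      = fun s => ∑' x, ConnesSpace.pderivList l (f x) s := by
  induction l with
  | nil => rfl
  | cons i l ih =>
    change pderiv i (ConnesSpace.pderivList l _) = _
    rw [ih]
    exact (hs.pderivList l).pderiv_tsum (fun x => contDiff_pderivList l (hf x)) i

theorem derivNorm_tsum_le {f : ι → (Fin n → ℝ) → E} (hf : ∀ x, ContDiff ℝ ∞ (f x))
    (h : ∀ k, ∑' x, derivNorm k (f x) ≠ ⊤) (k : ℕ) :
    derivNorm k (fun s => ∑' x, f x s) ≤ ∑' x, derivNorm k (f x) := by
  unfold derivNorm
  rw [Summable.tsum_finsetSum fun _ _ => ENNReal.summable]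
  refine Finset.sum_le_sum fun m _ => iSup_le fun s => ?_
  rw [mixedDeriv, (summableDerivs_of_derivNorm hf h).pderivList_tsum hf]
  exact enorm_tsum_le_tsum_enorm.trans (ENNReal.tsum_le_tsum fun x =>
    le_iSup (fun s => ‖mixedDeriv (fun i => (m i : ℕ)) (f x) s‖ₑ) s)

end Series

/-! ### Absolutely convergent series in the Connes space -/

section Complete

variable {𝕜 : Type u} [RCLike 𝕜] {d : ℕ}

theorem ofReal_coSeminorm (p : ℕ × ℝ≥0) (F : CO 𝕜 d) :
    ENNReal.ofReal (coSeminorm 𝕜 d p F) = connesNorm p.1 p.2 (F : Kernels 𝕜 d) :=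
  ENNReal.ofReal_toReal (F.2.finite _ _)

theorem coSeminorm_le_iff {p : ℕ × ℝ≥0} {F : CO 𝕜 d} {a : ℝ} (ha : 0 ≤ a) :
    coSeminorm 𝕜 d p F ≤ a ↔ connesNorm p.1 p.2 (F : Kernels 𝕜 d) ≤ ENNReal.ofReal a := by
  rw [← ofReal_coSeminorm, ENNReal.ofReal_le_ofReal_iff ha]

theorem derivNorm_le_connesNorm (k : ℕ) (F : Kernels 𝕜 d) (n : ℕ) :
    derivNorm k (F n) ≤ connesNorm k 1 F := by
  refine le_trans ?_ (ENNReal.le_tsum n)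
  simp

/-- The norm `‖·‖_{0,1}` already dominates the sup norm of each component, so the seminorms separate
points. Uniqueness of sums, used throughout the algebra below, depends on it. -/
instance : T2Space (CO 𝕜 d) := by
  have : T1Space (CO 𝕜 d) := by
    refine withSeminorms_coSeminorm.T1_of_separating fun F hF => ?_
    by_contra! h
    refine hF (Subtype.ext (funext fun n => funext fun s => ?_))
    have h1 : connesNorm 0 1 (F : Kernels 𝕜 d) ≤ ENNReal.ofReal 0 :=
      (coSeminorm_le_iff (p := (0, 1)) le_rfl).1 (h (0, 1)).le
    have h2 : ‖(F : Kernels 𝕜 d) n s‖ₑ ≤ derivNorm 0 ((F : Kernels 𝕜 d) n) :=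
      enorm_pderivList_le_derivNorm (k := 0) (l := []) le_rfl (F.2.smooth n) s
    have h3 := (h2.trans (derivNorm_le_connesNorm 0 (F : Kernels 𝕜 d) n)).trans h1
    rw [ENNReal.ofReal_zero, nonpos_iff_eq_zero, enorm_eq_zero] at h3
    exact h3
  infer_instance

variable {ι : Type*}

theorem tsum_derivNorm_ne_top {F : ι → CO 𝕜 d}
    (hF : ∀ p, Summable fun x => coSeminorm 𝕜 d p (F x)) (n k : ℕ) :
    ∑' x, derivNorm k ((F x : Kernels 𝕜 d) n) ≠ ⊤ := by
  refine ne_top_of_le_ne_top ?_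
    (ENNReal.tsum_le_tsum fun x => derivNorm_le_connesNorm k (F x : Kernels 𝕜 d) n)
  simpa only [ofReal_coSeminorm] using (hF (k, 1)).tsum_ofReal_ne_top

theorem summable_kernel {F : ι → CO 𝕜 d}
    (hF : ∀ p, Summable fun x => coSeminorm 𝕜 d p (F x)) (n : ℕ) (s : Fin n → ℝ) :
    Summable fun x => (F x : Kernels 𝕜 d) n s := by
  obtain ⟨u, hu, hb⟩ := summableDerivs_of_derivNorm (fun x => (F x).2.smooth n)
    (tsum_derivNorm_ne_top hF n) []
  exact Summable.of_norm_bounded hu fun x => hb x s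

theorem connesNorm_tsum_le {F : ι → CO 𝕜 d}
    (hF : ∀ p, Summable fun x => coSeminorm 𝕜 d p (F x)) (k : ℕ) (C : ℝ≥0) :
    connesNorm k C (fun n s => ∑' x, (F x : Kernels 𝕜 d) n s)
      ≤ ∑' x, connesNorm k C (F x : Kernels 𝕜 d) := by
  unfold connesNorm
  rw [ENNReal.tsum_comm]
  refine ENNReal.tsum_le_tsum fun n => ?_
  rw [ENNReal.tsum_mul_left]
  gcongr
  exact derivNorm_tsum_le (fun x => (F x).2.smooth n) (tsum_derivNorm_ne_top hF n) k

/-- The pointwise sum of an absolutely convergent series. -/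
noncomputable def pointwiseSum (F : ι → CO 𝕜 d)
    (hF : ∀ p, Summable fun x => coSeminorm 𝕜 d p (F x)) : CO 𝕜 d :=
  ⟨fun n s => ∑' x, (F x : Kernels 𝕜 d) n s, by
    refine ⟨fun n => ?_, fun n s z => ?_, fun n σ s I => ?_, fun k C => ?_⟩
    · exact (summableDerivs_of_derivNorm (fun x => (F x).2.smooth n)
        (tsum_derivNorm_ne_top hF n)).contDiff_tsum fun x => (F x).2.smooth n
    · exact tsum_congr fun x => (F x).2.periodic n s z
    · rw [tsum_apply (summable_kernel hF n _), tsum_apply (summable_kernel hF n _)]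
      exact tsum_congr fun x => (F x).2.symmetric n σ s I
    · refine ne_top_of_le_ne_top ?_ (connesNorm_tsum_le hF k C)
      simpa only [ofReal_coSeminorm] using (hF (k, C)).tsum_ofReal_ne_top⟩

theorem coSeminorm_pointwiseSum_le {F : ι → CO 𝕜 d}
    (hF : ∀ p, Summable fun x => coSeminorm 𝕜 d p (F x)) (p : ℕ × ℝ≥0) :
    coSeminorm 𝕜 d p (pointwiseSum F hF) ≤ ∑' x, coSeminorm 𝕜 d p (F x) := by
  rw [coSeminorm_le_iff (tsum_nonneg fun x => apply_nonneg _ _),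
    ENNReal.ofReal_tsum_of_nonneg (fun x => apply_nonneg _ _) (hF p)]
  simp only [ofReal_coSeminorm]
  exact connesNorm_tsum_le hF p.1 p.2

theorem hasSum_pointwiseSum {F : ι → CO 𝕜 d}
    (hF : ∀ p, Summable fun x => coSeminorm 𝕜 d p (F x)) : HasSum F (pointwiseSum F hF) := by
  refine (withSeminorms_coSeminorm.tendsto_nhds _ _).2 fun p ε hε => ?_
  have hlim := tendsto_tsum_compl_atTop_zero fun x => coSeminorm 𝕜 d p (F x)
  filter_upwards [hlim.eventually_lt_const hε] with t ht
  have hF' : ∀ p, Summable fun x : {x // x ∉ t} => coSeminorm 𝕜 d p (F x) := fun p =>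
    (hF p).subtype _
  -- The remainder after a finite set of terms is itself the pointwise sum of the other terms, so
  -- the tail of the series of norms bounds it.
  have e : pointwiseSum F hF - ∑ x ∈ t, F x = pointwiseSum (fun x : {x // x ∉ t} => F x) hF' := by
    rw [sub_eq_iff_eq_add']
    refine Subtype.ext (funext fun n => funext fun s => ?_)
    have h := (summable_kernel hF n s).sum_add_tsum_subtype_compl t
    rw [Submodule.coe_add, Submodule.coe_sum]
    simp only [Pi.add_apply, Finset.sum_apply]
    exact h.symm
  rw [map_sub_rev, e]
  exact (coSeminorm_pointwiseSum_le hF' p).trans_lt ht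

theorem summable_of_coSeminorm {F : ι → CO 𝕜 d}
    (hF : ∀ p, Summable fun x => coSeminorm 𝕜 d p (F x)) : Summable F :=
  (hasSum_pointwiseSum hF).summable

theorem coSeminorm_tsum_le {F : ι → CO 𝕜 d}
    (hF : ∀ p, Summable fun x => coSeminorm 𝕜 d p (F x)) (p : ℕ × ℝ≥0) :
    coSeminorm 𝕜 d p (∑' x, F x) ≤ ∑' x, coSeminorm 𝕜 d p (F x) := by
  rw [(hasSum_pointwiseSum hF).tsum_eq]
  exact coSeminorm_pointwiseSum_le hF p

/-- A linear operator that satisfies seminorm estimates is continuous. -/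
theorem continuous_of_coSeminorm_le (T : CO 𝕜 d →ₗ[𝕜] CO 𝕜 d)
    (hT : ∀ p, ∃ (K : ℝ) (q : ℕ × ℝ≥0), ∀ F,
      coSeminorm 𝕜 d p (T F) ≤ K * coSeminorm 𝕜 d q F) : Continuous T := by
  refine WithSeminorms.continuous_of_isBounded withSeminorms_coSeminorm withSeminorms_coSeminorm T
    fun p => ?_
  obtain ⟨K, q, h⟩ := hT p
  refine ⟨{q}, K.toNNReal, fun F => ?_⟩
  rw [Finset.sup_singleton]
  refine (h F).trans ?_
  change _ ≤ (K.toNNReal : ℝ) * coSeminorm 𝕜 d q F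
  gcongr
  exact Real.le_coe_toNNReal K

end Complete

/-! ### The algebra of the Wick product -/

section WickAlgebra

variable {𝕜 : Type u} [RCLike 𝕜] {d : ℕ}

variable (𝕜 d) in
/-- Functions of `n` variables with values in the `n`-th tensor power. -/
abbrev Component (n : ℕ) : Type u := (Fin n → ℝ) → ((Fin n → Coord d) → 𝕜)

/-- The tensor product with slots placed along `σ`, as a bilinear map. -/
def tensorL {a b N : ℕ} (σ : Fin a ⊕ Fin b ≃ Fin N) :
    Component 𝕜 d a →ₗ[𝕜] Component 𝕜 d b →ₗ[𝕜] Component 𝕜 d N :=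
  LinearMap.mk₂ 𝕜 (tensor σ) (fun _ _ _ => funext fun _ => funext fun _ => add_mul _ _ _)
    (fun _ _ _ => funext fun _ => funext fun _ => mul_assoc _ _ _)
    (fun _ _ _ => funext fun _ => funext fun _ => mul_add _ _ _)
    (fun _ _ _ => funext fun _ => funext fun _ => mul_left_comm _ _ _)

@[simp]
theorem tensorL_apply {a b N : ℕ} (σ : Fin a ⊕ Fin b ≃ Fin N) (f : Component 𝕜 d a)
    (g : Component 𝕜 d b) : tensorL σ f g = tensor σ f g := rfl

/-- The symmetric tensor product with `N` slots, as a bilinear map. -/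
noncomputable def symTensor (a b N : ℕ) :
    Component 𝕜 d a →ₗ[𝕜] Component 𝕜 d b →ₗ[𝕜] Component 𝕜 d N :=
  (N.factorial : 𝕜)⁻¹ • ∑ σ : Fin a ⊕ Fin b ≃ Fin N, tensorL σ

theorem symTensor_apply {a b N : ℕ} (f : Component 𝕜 d a) (g : Component 𝕜 d b) :
    symTensor a b N f g
      = (N.factorial : 𝕜)⁻¹ • ∑ σ : Fin a ⊕ Fin b ≃ Fin N, tensor σ f g := by
  simp [symTensor, LinearMap.sum_apply]

theorem wickKernel_eq_sum_symTensor (F G : Kernels 𝕜 d) (N : ℕ) :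
    wickKernel F G N = ∑ p ∈ antidiagonal N, symTensor p.1 p.2 N (F p.1) (G p.2) := by
  simp only [symTensor_apply]
  rfl

theorem symTensor_comm {a b N : ℕ} (f : Component 𝕜 d a) (g : Component 𝕜 d b) :
    symTensor a b N f g = symTensor b a N g f := by
  simp only [symTensor_apply]
  congr 1
  refine Fintype.sum_equiv ((Equiv.sumComm (Fin a) (Fin b)).equivCongr (Equiv.refl (Fin N))) _ _
    fun σ => ?_
  rw [tensor_comm]
  rfl

/-- The triple tensor product with slots placed along `ρ`. -/
def tensor₃ {a b c N : ℕ} (ρ : (Fin a ⊕ Fin b) ⊕ Fin c ≃ Fin N) (f : Component 𝕜 d a)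
    (g : Component 𝕜 d b) (h : Component 𝕜 d c) : Component 𝕜 d N := fun s I =>
  f (s ∘ ρ ∘ Sum.inl ∘ Sum.inl) (I ∘ ρ ∘ Sum.inl ∘ Sum.inl) *
    g (s ∘ ρ ∘ Sum.inl ∘ Sum.inr) (I ∘ ρ ∘ Sum.inl ∘ Sum.inr) *
      h (s ∘ ρ ∘ Sum.inr) (I ∘ ρ ∘ Sum.inr)

/-- The mean of a constant. It is used from right to left, to introduce a mean over the inner
placements of an iterated symmetrization. -/
theorem factorial_inv_smul_sum_const {M : Type*} [AddCommGroup M] [Module 𝕜 M] {a b p : ℕ}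
    (h : a + b = p) (x : M) :
    (p.factorial : 𝕜)⁻¹ • ∑ _τ : Fin a ⊕ Fin b ≃ Fin p, x = x := by
  rw [Finset.sum_const, Finset.card_univ, card_sumEquiv h, ← Nat.cast_smul_eq_nsmul 𝕜, smul_smul,
    inv_mul_cancel₀ (by exact_mod_cast p.factorial_ne_zero), one_smul]

/-- For each inner placement `τ`, composition with `τ` is a bijection from outer placements to
placements of three blocks. All `p!` inner placements thus contribute the same sum, which cancels
`1/p!`. The result does not remember the bracketing, whence associativity. -/
theorem symTensor_symTensor_left {a b c p N : ℕ} (hp : a + b = p) (f : Component 𝕜 d a)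
    (g : Component 𝕜 d b) (h : Component 𝕜 d c) :
    symTensor p c N (symTensor a b p f g) h
      = (N.factorial : 𝕜)⁻¹ • ∑ ρ : (Fin a ⊕ Fin b) ⊕ Fin c ≃ Fin N, tensor₃ ρ f g h := by
  rw [symTensor_apply (f := f), map_smul, LinearMap.smul_apply, map_sum, LinearMap.sum_apply]
  rw [← factorial_inv_smul_sum_const (𝕜 := 𝕜) hp ((N.factorial : 𝕜)⁻¹ • _)]
  congr 1
  refine Finset.sum_congr rfl fun τ _ => ?_
  rw [symTensor_apply]
  congr 1
  exact Fintype.sum_equiv ((τ.symm.sumCongr (Equiv.refl (Fin c))).equivCongr (Equiv.refl (Fin N)))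
    _ _ fun σ => by funext s I; simp [tensor, tensor₃, Function.comp_def]

theorem symTensor_symTensor_right {a b c p N : ℕ} (hp : b + c = p) (f : Component 𝕜 d a)
    (g : Component 𝕜 d b) (h : Component 𝕜 d c) :
    symTensor a p N f (symTensor b c p g h)
      = (N.factorial : 𝕜)⁻¹ • ∑ ρ : (Fin a ⊕ Fin b) ⊕ Fin c ≃ Fin N, tensor₃ ρ f g h := by
  rw [symTensor_apply (f := g), map_smul, map_sum]
  rw [← factorial_inv_smul_sum_const (𝕜 := 𝕜) hp ((N.factorial : 𝕜)⁻¹ • _)]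
  congr 1
  refine Finset.sum_congr rfl fun τ _ => ?_
  rw [symTensor_apply]
  congr 1
  exact Fintype.sum_equiv ((((Equiv.refl (Fin a)).sumCongr τ.symm).trans
    (Equiv.sumAssoc _ _ _).symm).equivCongr (Equiv.refl (Fin N)))
    _ _ fun σ => by funext s I; simp [tensor, tensor₃, Function.comp_def, mul_assoc]

theorem coe_wick (F G : CO 𝕜 d) : (wick F G : Kernels 𝕜 d) = wickKernel F G := rfl

variable (𝕜 d) in
/-- The Wick product as a bilinear map. -/
noncomputable def wickL : CO 𝕜 d →ₗ[𝕜] CO 𝕜 d →ₗ[𝕜] CO 𝕜 d :=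
  LinearMap.mk₂ 𝕜 wick
    (fun F F' G => Subtype.ext (funext fun N => by
      simp [coe_wick, wickKernel_eq_sum_symTensor, Finset.sum_add_distrib]))
    (fun c F G => Subtype.ext (funext fun N => by
      simp [coe_wick, wickKernel_eq_sum_symTensor, Finset.smul_sum]))
    (fun F G G' => Subtype.ext (funext fun N => by
      simp [coe_wick, wickKernel_eq_sum_symTensor, Finset.sum_add_distrib]))
    (fun c F G => Subtype.ext (funext fun N => by
      simp [coe_wick, wickKernel_eq_sum_symTensor, Finset.smul_sum]))

theorem wick_add_left (F F' G : CO 𝕜 d) : wick (F + F') G = wick F G + wick F' G :=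
  LinearMap.map_add₂ (wickL 𝕜 d) F F' G

theorem wick_add_right (F G G' : CO 𝕜 d) : wick F (G + G') = wick F G + wick F G' :=
  map_add (wickL 𝕜 d F) G G'

theorem wick_smul_left (c : 𝕜) (F G : CO 𝕜 d) : wick (c • F) G = c • wick F G :=
  LinearMap.map_smul₂ (wickL 𝕜 d) c F G

theorem wick_smul_right (c : 𝕜) (F G : CO 𝕜 d) : wick F (c • G) = c • wick F G :=
  map_smul (wickL 𝕜 d F) c G

theorem wick_comm (F G : CO 𝕜 d) : wick F G = wick G F := by
  refine Subtype.ext (funext fun N => ?_)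
  simp only [coe_wick, wickKernel_eq_sum_symTensor]
  rw [← Finset.Nat.sum_antidiagonal_swap]
  exact Finset.sum_congr rfl fun p _ => symTensor_comm _ _

theorem wick_assoc (F G H : CO 𝕜 d) : wick F (wick G H) = wick (wick F G) H := by
  refine Subtype.ext (funext fun N => ?_)
  simp only [coe_wick, wickKernel_eq_sum_symTensor, map_sum, LinearMap.sum_apply]
  have := sum_antidiagonal_assoc N fun a b c => (N.factorial : 𝕜)⁻¹ •
    ∑ ρ : (Fin a ⊕ Fin b) ⊕ Fin c ≃ Fin N,
      tensor₃ ρ ((F : Kernels 𝕜 d) a) ((G : Kernels 𝕜 d) b) ((H : Kernels 𝕜 d) c)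
  rw [← Finset.sum_congr rfl fun p _ => Finset.sum_congr rfl fun q hq =>
      symTensor_symTensor_left (mem_antidiagonal.1 hq) _ _ _,
    ← Finset.sum_congr rfl fun p _ => Finset.sum_congr rfl fun q hq =>
      symTensor_symTensor_right (mem_antidiagonal.1 hq) _ _ _] at this
  exact this.symm

/-! ### Norm estimates for the Wick product, and monotonicity of the norms -/

theorem coSeminorm_wick_le (p : ℕ × ℝ≥0) (F G : CO 𝕜 d) :
    coSeminorm 𝕜 d p (wick F G) ≤ coSeminorm 𝕜 d p F * coSeminorm 𝕜 d p G := by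
  rw [coSeminorm_le_iff (mul_nonneg (apply_nonneg _ _) (apply_nonneg _ _)),
    ENNReal.ofReal_mul (apply_nonneg _ _), ofReal_coSeminorm, ofReal_coSeminorm]
  exact connesNorm_wickKernel_le p.1 p.2 F.2.smooth G.2.smooth

theorem connesNorm_mono {k k' : ℕ} {C C' : ℝ≥0} (hk : k ≤ k') (hC : C ≤ C') (F : Kernels 𝕜 d) :
    connesNorm k C F ≤ connesNorm k' C' F := by
  refine ENNReal.tsum_le_tsum fun n => ?_
  gcongr
  exact derivNorm_mono hk _

theorem coSeminorm_mono {p q : ℕ × ℝ≥0} (h : p ≤ q) (F : CO 𝕜 d) :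
    coSeminorm 𝕜 d p F ≤ coSeminorm 𝕜 d q F := by
  rw [coSeminorm_le_iff (apply_nonneg _ _), ofReal_coSeminorm]
  exact connesNorm_mono h.1 h.2 _

end WickAlgebra

/-! ### Integration by parts in a contraction -/

section Contraction

variable {𝕜 : Type u} [RCLike 𝕜] {d : ℕ}

theorem hasDerivAt_insertNth {n : ℕ} (i : Fin (n + 1)) (s : Fin n → ℝ) (u : ℝ) :
    HasDerivAt (fun u => Fin.insertNth (α := fun _ => ℝ) i u s)
      (Pi.single i 1 : Fin (n + 1) → ℝ) u := by
  rw [hasDerivAt_pi]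
  intro l
  rcases Fin.eq_self_or_eq_succAbove i l with rfl | ⟨l, rfl⟩
  · simpa using hasDerivAt_id' u
  · simpa [Fin.succAbove_ne] using hasDerivAt_const u (s l)

theorem hasDerivAt_comp_insertNth {n : ℕ} (i : Fin (n + 1)) {f : Component 𝕜 d (n + 1)}
    (hf : ContDiff ℝ ∞ f) (s : Fin n → ℝ) (J : Fin (n + 1) → Coord d) (u : ℝ) :
    HasDerivAt (fun u => f (Fin.insertNth (α := fun _ => ℝ) i u s) J)
      (pderiv i f (Fin.insertNth (α := fun _ => ℝ) i u s) J) u :=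
  hasDerivAt_pi.1 ((hf.differentiable (by simp) _).hasFDerivAt.comp_hasDerivAt u
    (hasDerivAt_insertNth i s u)) J

theorem continuous_comp_insertNth {n : ℕ} (i : Fin (n + 1)) {f : Component 𝕜 d (n + 1)}
    (hf : ContDiff ℝ ∞ f) (s : Fin n → ℝ) (J : Fin (n + 1) → Coord d) :
    Continuous fun u => f (Fin.insertNth (α := fun _ => ℝ) i u s) J :=
  continuous_iff_continuousAt.2 fun u => (hasDerivAt_comp_insertNth i hf s J u).continuousAt

theorem intervalIntegrable_contract {n : ℕ} (i : Fin (n + 1)) {φ : ℝ → ℝ} (hφ : Continuous φ)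
    {f : Component 𝕜 d (n + 1)} (hf : ContDiff ℝ ∞ f) (s : Fin n → ℝ)
    (J : Fin (n + 1) → Coord d) :
    IntervalIntegrable (fun u => φ u • f (Fin.insertNth (α := fun _ => ℝ) i u s) J)
      MeasureTheory.volume 0 1 :=
  (hφ.smul (continuous_comp_insertNth i hf s J)).intervalIntegrable _ _

theorem contract_add {n : ℕ} (i : Fin (n + 1)) (j : Coord d) {φ : ℝ → ℝ} (hφ : Continuous φ)
    {f g : Component 𝕜 d (n + 1)} (hf : ContDiff ℝ ∞ f) (hg : ContDiff ℝ ∞ g) :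
    contract i j φ (f + g) = contract i j φ f + contract i j φ g := by
  funext s I
  simp only [contract, Pi.add_apply, smul_add]
  exact intervalIntegral.integral_add (intervalIntegrable_contract i hφ hf s _)
    (intervalIntegrable_contract i hφ hg s _)

theorem contract_smul {n : ℕ} (i : Fin (n + 1)) (j : Coord d) (φ : ℝ → ℝ) (c : 𝕜)
    (f : Component 𝕜 d (n + 1)) : contract i j φ (c • f) = c • contract i j φ f := by
  funext s I
  simp only [contract, Pi.smul_apply]
  rw [← intervalIntegral.integral_smul]
  exact intervalIntegral.integral_congr fun u _ => smul_comm _ _ _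

theorem contract_neg {n : ℕ} (i : Fin (n + 1)) (j : Coord d) (φ : ℝ → ℝ)
    (f : Component 𝕜 d (n + 1)) : contract i j φ (-f) = -contract i j φ f := by
  simpa using contract_smul i j φ (-1 : 𝕜) f

theorem contract_sub {n : ℕ} (i : Fin (n + 1)) (j : Coord d) {φ : ℝ → ℝ} (hφ : Continuous φ)
    {f g : Component 𝕜 d (n + 1)} (hf : ContDiff ℝ ∞ f) (hg : ContDiff ℝ ∞ g) :
    contract i j φ (f - g) = contract i j φ f - contract i j φ g := by
  have hg' : ContDiff ℝ ∞ (-g) := hg.neg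
  rw [sub_eq_add_neg, contract_add i j hφ hf hg', contract_neg, ← sub_eq_add_neg]

theorem contract_sum {κ : Type*} {n : ℕ} (i : Fin (n + 1)) (j : Coord d) {φ : ℝ → ℝ}
    (hφ : Continuous φ) (t : Finset κ) (f : κ → Component 𝕜 d (n + 1))
    (hf : ∀ x, ContDiff ℝ ∞ (f x)) :
    contract i j φ (∑ x ∈ t, f x) = ∑ x ∈ t, contract i j φ (f x) := by
  funext s I
  simp only [contract, Finset.sum_apply, Finset.smul_sum]
  exact intervalIntegral.integral_finsetSum fun x _ =>
    intervalIntegrable_contract i hφ (hf x) s _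

theorem contract_const_mul {n : ℕ} (i : Fin (n + 1)) (j : Coord d) (c : ℝ) (φ : ℝ → ℝ)
    (f : Component 𝕜 d (n + 1)) :
    contract i j (fun u => c * φ u) f = (c : 𝕜) • contract i j φ f := by
  funext s I
  simp only [contract, Pi.smul_apply, mul_smul]
  rw [intervalIntegral.integral_smul, RCLike.real_smul_eq_coe_smul (K := 𝕜)]

/-- Functions of `n` circle variables, as functions of `n` real variables. -/
def Periodic {n : ℕ} (f : Component 𝕜 d n) : Prop :=
  ∀ (s : Fin n → ℝ) (z : Fin n → ℤ), f (fun q => s q + z q) = f s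

/-- Integration by parts in the contracted variable, with boundary terms that cancel by periodicity.
-/
theorem contract_deriv {n : ℕ} (i : Fin (n + 1)) (j : Coord d) {φ : ℝ → ℝ}
    (hφ : ContDiff ℝ 1 φ) (hφp : φ 1 = φ 0) {f : Component 𝕜 d (n + 1)} (hf : ContDiff ℝ ∞ f)
    (hfp : Periodic f) :
    contract i j (deriv φ) f = -contract i j φ (pderiv i f) := by
  funext s I
  have h1 := intervalIntegral.integral_eq_sub_of_hasDerivAt (a := 0) (b := 1)
    (fun u _ => (hφ.differentiable (by simp) u).hasDerivAt.smul
      (hasDerivAt_comp_insertNth i hf s (Fin.insertNth (α := fun _ => Coord d) i j I) u))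
    (((hφ.continuous.smul (continuous_comp_insertNth i (contDiff_pderiv i hf) s _)).add
      ((hφ.continuous_deriv (by simp)).smul
        (continuous_comp_insertNth i hf s _))).intervalIntegrable _ _)
  -- The two endpoints of the contracted variable differ by an integer vector, so `f` takes the same
  -- value there.
  have h2 : Fin.insertNth (α := fun _ => ℝ) i 1 s
      = fun q => Fin.insertNth (α := fun _ => ℝ) i 0 s q + ((Pi.single i 1 : Fin (n + 1) → ℤ) q) := by
    funext q
    rcases Fin.eq_self_or_eq_succAbove i q with rfl | ⟨q, rfl⟩
    · simp
    · simp [Fin.succAbove_ne]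
  simp only [Pi.smul_apply'] at h1
  rw [h2, hfp, hφp, sub_self, intervalIntegral.integral_add
    (intervalIntegrable_contract i hφ.continuous (contDiff_pderiv i hf) s _)
    (intervalIntegrable_contract i (hφ.continuous_deriv (by simp)) hf s _)] at h1
  exact eq_neg_of_add_eq_zero_right h1

theorem Periodic.pderiv {n : ℕ} (i : Fin n) {f : Component 𝕜 d n} (hf : Periodic f) :
    Periodic (pderiv i f) := pderiv_periodic i hf

/-- The operator `1 - ∂ᵢ²`. -/
noncomputable def oneSubLaplace {n : ℕ} (i : Fin n) (f : Component 𝕜 d n) : Component 𝕜 d n :=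
  f - pderiv i (pderiv i f)

theorem contDiff_oneSubLaplace {n : ℕ} (i : Fin n) {f : Component 𝕜 d n} (hf : ContDiff ℝ ∞ f) :
    ContDiff ℝ ∞ (oneSubLaplace i f) :=
  hf.sub (contDiff_pderiv i (contDiff_pderiv i hf))

theorem Periodic.oneSubLaplace {n : ℕ} (i : Fin n) {f : Component 𝕜 d n} (hf : Periodic f) :
    Periodic (oneSubLaplace i f) := fun s z =>
  congrArg₂ (· - ·) (hf s z) ((hf.pderiv i).pderiv i s z)

/-- Self-adjointness of `1 - ∂²` on the circle: two integrations by parts, which need both `φ` and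
`φ'` to match at the endpoints. -/
theorem contract_oneSubLaplace {n : ℕ} (i : Fin (n + 1)) (j : Coord d) {φ : ℝ → ℝ}
    (hφ : ContDiff ℝ ∞ φ) (hp : φ 1 = φ 0) (hp' : deriv φ 1 = deriv φ 0)
    {f : Component 𝕜 d (n + 1)} (hf : ContDiff ℝ ∞ f) (hfp : Periodic f) :
    contract i j φ (oneSubLaplace i f) = contract i j φ f - contract i j (deriv (deriv φ)) f := by
  have hφ' : ContDiff ℝ ∞ (deriv φ) := (contDiff_infty_iff_deriv.1 hφ).2
  have h1 := contract_deriv i j (hφ'.of_le (by simp)) hp' hf hfp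
  have h2 := contract_deriv i j (hφ.of_le (by simp)) hp (contDiff_pderiv i hf) (hfp.pderiv i)
  rw [oneSubLaplace, contract_sub i j hφ.continuous hf
    (contDiff_pderiv i (contDiff_pderiv i hf)), h1, h2, neg_neg]

/-- The pairing `∫ φ f + ∫ φ' f'` becomes an `L²` pairing after the derivative is moved off `φ`. -/
theorem contract_add_contract_deriv {n : ℕ} (i : Fin (n + 1)) (j : Coord d) {φ : ℝ → ℝ}
    (hφ : ContDiff ℝ ∞ φ) (hp : φ 1 = φ 0) {f : Component 𝕜 d (n + 1)} (hf : ContDiff ℝ ∞ f)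
    (hfp : Periodic f) :
    contract i j φ f + contract i j (deriv φ) (pderiv i f)
      = contract i j φ (oneSubLaplace i f) := by
  rw [contract_deriv i j (hφ.of_le (by simp)) hp (contDiff_pderiv i hf) (hfp.pderiv i),
    oneSubLaplace, contract_sub i j hφ.continuous hf (contDiff_pderiv i (contDiff_pderiv i hf)),
    sub_eq_add_neg]

theorem contract_zero {n : ℕ} (i : Fin (n + 1)) (j : Coord d) (f : Component 𝕜 d (n + 1)) :
    contract i j (fun _ => 0) f = 0 := by
  funext s I
  simp [contract]

/-- A permutation carries slot `i` to slot `0` and keeps the order of the others, and `f` is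
invariant under it. -/
theorem contract_symm {n : ℕ} (i : Fin (n + 1)) (j : Coord d) (φ : ℝ → ℝ)
    {f : Component 𝕜 d (n + 1)}
    (hf : ∀ (σ : Equiv.Perm (Fin (n + 1))) s I, f (s ∘ σ) (I ∘ σ) = f s I) :
    contract i j φ f = contract 0 j φ f := by
  have h : ∀ {X : Type} (x : X) (v : Fin n → X), Fin.insertNth (α := fun _ => X) i x v
      = Fin.insertNth (α := fun _ => X) 0 x v
        ∘ ((finSuccEquiv' i).trans (finSuccEquiv' 0).symm) := by
    intro X x v
    funext q
    rcases Fin.eq_self_or_eq_succAbove i q with rfl | ⟨q, rfl⟩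
    · simp
    · simp
  funext s I
  refine intervalIntegral.integral_congr fun u _ => ?_
  simp only [h, hf]

/-- Raising the `i`-th exponent by one injects the multi-indices bounded by `k` into those bounded
by `k + 1`. -/
theorem derivNorm_pderiv_le {n : ℕ} (k : ℕ) (i : Fin n) {f : Component 𝕜 d n}
    (hf : ContDiff ℝ ∞ f) : derivNorm k (pderiv i f) ≤ derivNorm (k + 1) f := by
  let e : (Fin n → Fin (k + 1)) ↪ (Fin n → Fin (k + 1 + 1)) :=
    ⟨fun m q => if q = i then (m q).succ else (m q).castSucc, fun m m' h => by
      funext q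
      have := congrFun h q
      by_cases hq : q = i <;> simpa [hq] using this⟩
  unfold derivNorm
  calc ∑ m : Fin n → Fin (k + 1), ⨆ s, ‖mixedDeriv (fun q => (m q : ℕ)) (pderiv i f) s‖ₑ
      = ∑ m ∈ Finset.univ.map e, ⨆ s, ‖mixedDeriv (fun q => (m q : ℕ)) f s‖ₑ := by
        rw [Finset.sum_map]
        refine Finset.sum_congr rfl fun m _ => ?_
        have : mixedDeriv (fun q => (m q : ℕ)) (pderiv i f)
            = mixedDeriv (fun q => (e m q : ℕ)) f := by
          rw [mixedDeriv, ← show pderivList [i] f = pderiv i f from rfl, ← pderivList_append,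
            pderivList_eq_mixedDeriv _ hf]
          congr 1
          funext q
          rw [List.count_append, count_indexList]
          have he : e m q = if q = i then (m q).succ else (m q).castSucc := rfl
          rw [he]
          by_cases hq : q = i
          · simp [hq]
          · simp [hq, Ne.symm hq]
        rw [this]
    _ ≤ _ := Finset.sum_le_sum_of_subset (Finset.subset_univ _)

theorem derivNorm_oneSubLaplace_le {n : ℕ} (k : ℕ) (i : Fin n) {f : Component 𝕜 d n}
    (hf : ContDiff ℝ ∞ f) : derivNorm k (oneSubLaplace i f) ≤ 2 * derivNorm (k + 2) f := by
  have h1 := contDiff_pderiv i hf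
  have h2 := contDiff_pderiv i h1
  have h3 : ContDiff ℝ ∞ (-pderiv i (pderiv i f)) := h2.neg
  have h4 : derivNorm k (-pderiv i (pderiv i f)) = derivNorm k (pderiv i (pderiv i f)) := by
    rw [← neg_one_smul 𝕜, derivNorm_smul k _ h2, enorm_neg, enorm_one, one_mul]
  rw [oneSubLaplace, sub_eq_add_neg, two_mul]
  refine (derivNorm_add_le k hf h3).trans (add_le_add (derivNorm_mono (by omega) f) ?_)
  rw [h4]
  exact (derivNorm_pderiv_le k i h1).trans (derivNorm_pderiv_le (k + 1) i hf)

/-- Each factor `1 - ∂ᵢ²` costs a constant `2` and two derivatives. Smoothness is carried along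
because the estimate of the next factor needs it. -/
theorem derivNorm_iterate_oneSubLaplace_le {n : ℕ} (k M : ℕ) (i : Fin n) {f : Component 𝕜 d n}
    (hf : ContDiff ℝ ∞ f) : ContDiff ℝ ∞ ((oneSubLaplace i)^[M] f) ∧
      derivNorm k ((oneSubLaplace i)^[M] f) ≤ 2 ^ M * derivNorm (k + 2 * M) f := by
  induction M generalizing k with
  | zero => exact ⟨hf, by simp⟩
  | succ M ih =>
    rw [Function.iterate_succ_apply']
    refine ⟨contDiff_oneSubLaplace i (ih k).1, ?_⟩
    refine (derivNorm_oneSubLaplace_le k i (ih k).1).trans ?_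
    calc 2 * derivNorm (k + 2) ((oneSubLaplace i)^[M] f)
        ≤ 2 * (2 ^ M * derivNorm (k + 2 + 2 * M) f) := by gcongr; exact (ih (k + 2)).2
      _ = _ := by rw [pow_succ', mul_assoc]; congr 3; ring_nf

end Contraction

/-! ### The Fourier modes -/

section Modes

/-- The eigenvalue of `1 - d²/ds²` on the `k`-th Fourier mode. -/
noncomputable def modeEigenvalue (k : ℤ) : ℝ := 4 * Real.pi ^ 2 * (k : ℝ) ^ 2 + 1

theorem one_le_modeEigenvalue (k : ℤ) : 1 ≤ modeEigenvalue k := by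
  unfold modeEigenvalue
  have : 0 ≤ 4 * Real.pi ^ 2 * (k : ℝ) ^ 2 := by positivity
  linarith

theorem modeEigenvalue_pos (k : ℤ) : 0 < modeEigenvalue k :=
  zero_lt_one.trans_le (one_le_modeEigenvalue k)

/-- Turns polynomial growth in `|k|` into polynomial growth in the eigenvalue, the scale in which
all estimates are made. -/
theorem abs_le_modeEigenvalue (k : ℤ) : |(k : ℝ)| ≤ modeEigenvalue k := by
  unfold modeEigenvalue
  have h1 : 1 ≤ Real.pi ^ 2 := one_le_pow₀ (by linarith [Real.pi_gt_three])
  have h2 : (k : ℝ) ^ 2 ≤ Real.pi ^ 2 * (k : ℝ) ^ 2 := le_mul_of_one_le_left (sq_nonneg _) h1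
  have h3 := sq_abs (k : ℝ)
  nlinarith [sq_nonneg (|(k : ℝ)| - 1)]

theorem summable_inv_modeEigenvalue : Summable fun k : ℤ => (modeEigenvalue k)⁻¹ := by
  have h : Summable fun k : ℤ => 1 / (k : ℝ) ^ 2 := Real.summable_one_div_int_pow.2 one_lt_two
  refine Summable.of_norm_bounded_eventually h ?_
  filter_upwards [(Set.finite_singleton (0 : ℤ)).compl_mem_cofinite] with k hk
  have hk0 : (k : ℝ) ≠ 0 := by simpa using hk
  rw [Real.norm_of_nonneg (inv_nonneg.2 (modeEigenvalue_pos k).le), one_div]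
  refine inv_anti₀ (by positivity) ?_
  unfold modeEigenvalue
  have h1 : 1 ≤ 4 * Real.pi ^ 2 := by nlinarith [Real.pi_gt_three]
  linarith [le_mul_of_one_le_left (sq_nonneg (k : ℝ)) h1]

theorem contDiff_fourierMode (k : ℤ) : ContDiff ℝ ∞ (fourierMode k) := by
  unfold fourierMode
  split_ifs <;> fun_prop

theorem fourierMode_one (k : ℤ) : fourierMode k 1 = fourierMode k 0 := by
  have h1 : Real.cos (2 * Real.pi * k * 1) = 1 := by
    rw [show 2 * Real.pi * k * 1 = k * (2 * Real.pi) by ring]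
    exact Real.cos_int_mul_two_pi k
  have h2 : Real.sin (2 * Real.pi * k * 1) = 0 := by
    rw [show 2 * Real.pi * k * 1 = ((2 * k : ℤ) : ℝ) * Real.pi by push_cast; ring]
    exact Real.sin_int_mul_pi _
  unfold fourierMode
  rw [h1, h2]
  simp

theorem deriv_fourierMode (k : ℤ) : deriv (fourierMode k) = fun s =>
    if k = 0 then 0 else if 0 < k then
      -(2 * Real.pi * k) * (√2 * Real.sin (2 * Real.pi * k * s) / √(4 * Real.pi ^ 2 * (k : ℝ) ^ 2 + 1))
    else (2 * Real.pi * k) * (√2 * Real.cos (2 * Real.pi * k * s) / √(4 * Real.pi ^ 2 * (k : ℝ) ^ 2 + 1))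
    := by
  funext s
  have hl : HasDerivAt (fun s : ℝ => 2 * Real.pi * k * s) (2 * Real.pi * k) s := by
    simpa using (hasDerivAt_id s).const_mul (2 * Real.pi * k)
  unfold fourierMode
  split_ifs with h0 h1
  · simp
  · rw [((hl.cos.const_mul √2).div_const _).deriv]
    ring
  · rw [((hl.sin.const_mul √2).div_const _).deriv]
    ring

/-- The eigenvalue equation `(1 - d²/ds²) c_k = λ_k c_k`. The constant mode fits in, since `λ_0 =
1`. -/
theorem deriv_deriv_fourierMode (k : ℤ) : deriv (deriv (fourierMode k)) = fun s =>
    (1 - modeEigenvalue k) * fourierMode k s := by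
  rw [deriv_fourierMode]
  funext s
  have hl : HasDerivAt (fun s : ℝ => 2 * Real.pi * k * s) (2 * Real.pi * k) s := by
    simpa using (hasDerivAt_id s).const_mul (2 * Real.pi * k)
  unfold fourierMode modeEigenvalue
  split_ifs with h0 h1
  · simp [h0]
  · rw [(((hl.sin.const_mul √2).div_const _).const_mul _).deriv]
    ring
  · rw [(((hl.cos.const_mul √2).div_const _).const_mul _).deriv]
    ring

theorem deriv_fourierMode_one (k : ℤ) : deriv (fourierMode k) 1 = deriv (fourierMode k) 0 := by
  have h1 : Real.cos (2 * Real.pi * k * 1) = 1 := by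
    rw [show 2 * Real.pi * k * 1 = k * (2 * Real.pi) by ring]
    exact Real.cos_int_mul_two_pi k
  have h2 : Real.sin (2 * Real.pi * k * 1) = 0 := by
    rw [show 2 * Real.pi * k * 1 = ((2 * k : ℤ) : ℝ) * Real.pi by push_cast; ring]
    exact Real.sin_int_mul_pi _
  simp only [deriv_fourierMode, h1, h2]
  simp

theorem abs_fourierMode_le (k : ℤ) (s : ℝ) : |fourierMode k s| ≤ 2 := by
  have hr : 1 ≤ √(4 * Real.pi ^ 2 * (k : ℝ) ^ 2 + 1) :=
    Real.one_le_sqrt.2 (one_le_modeEigenvalue k)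
  have h2 : √2 ≤ 2 := by rw [Real.sqrt_le_left (by norm_num)]; norm_num
  have key : ∀ x : ℝ, |x| ≤ 1 → |√2 * x / √(4 * Real.pi ^ 2 * (k : ℝ) ^ 2 + 1)| ≤ 2 := by
    intro x hx
    rw [abs_div, abs_mul, abs_of_nonneg (Real.sqrt_nonneg 2), abs_of_nonneg (Real.sqrt_nonneg _)]
    refine (div_le_self (by positivity) hr).trans ?_
    nlinarith [abs_nonneg x, Real.sqrt_nonneg 2]
  unfold fourierMode
  split_ifs
  · norm_num
  · exact key _ (Real.abs_cos_le_one _)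
  · exact key _ (Real.abs_sin_le_one _)

end Modes

/-! ### Annihilation operators in terms of one contraction -/

section Annihilation

variable {𝕜 : Type u} [RCLike 𝕜] {d : ℕ}

/-- The `k`-th Fourier mode, normalized so that its `L²` pairing with a function is the pairing of
`fourierMode k` with this function in the inner product `∫ x y + ∫ x' y'`. -/
noncomputable def dualMode (k : ℤ) (s : ℝ) : ℝ := modeEigenvalue k * fourierMode k s

theorem continuous_dualMode (k : ℤ) : Continuous (dualMode k) :=
  continuous_const.mul (contDiff_fourierMode k).continuous

/-- Self-adjointness moves `1 - ∂²` to the mode, where it acts as multiplication by the eigenvalue.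
-/
theorem contract_fourierMode_oneSubLaplace {n : ℕ} (i : Fin (n + 1)) (j : Coord d) (k : ℤ)
    {f : Component 𝕜 d (n + 1)} (hf : ContDiff ℝ ∞ f) (hfp : Periodic f) :
    contract i j (fourierMode k) (oneSubLaplace i f) = contract i j (dualMode k) f := by
  rw [contract_oneSubLaplace i j (contDiff_fourierMode k) (fourierMode_one k)
    (deriv_fourierMode_one k) hf hfp, deriv_deriv_fourierMode, contract_const_mul]
  unfold dualMode
  rw [contract_const_mul]
  push_cast
  module

/-- The coordinates other than `v` contribute nothing, the energy pairing reduces to an `L²` pairing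
with `dualMode k`, and symmetry makes the `n + 1` contractions equal. All later computations with
`D` start from this formula. -/
theorem coe_D (v : Coord d) (k : ℤ) (F : CO 𝕜 d) (n : ℕ) :
    (D 𝕜 v k F : Kernels 𝕜 d) n
      = ((n + 1 : ℕ) : 𝕜) • contract 0 v (dualMode k) ((F : Kernels 𝕜 d) (n + 1)) := by
  have hs := F.2.smooth (n + 1)
  have hp : Periodic ((F : Kernels 𝕜 d) (n + 1)) := F.2.periodic (n + 1)
  change annihKernel (basisLoop v k) (F : Kernels 𝕜 d) n = _
  have h1 : ∀ i : Fin (n + 1), ∑ j : Coord d,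
      (contract i j (fun u => basisLoop v k u j) ((F : Kernels 𝕜 d) (n + 1)) +
        contract i j (deriv fun u => basisLoop v k u j) (pderiv i ((F : Kernels 𝕜 d) (n + 1))))
      = contract 0 v (dualMode k) ((F : Kernels 𝕜 d) (n + 1)) := by
    intro i
    rw [Finset.sum_eq_single v]
    · simp only [basisLoop, if_true]
      rw [← contract_symm i v (dualMode k) (F.2.symmetric (n + 1)),
        ← contract_fourierMode_oneSubLaplace i v k hs hp]
      exact contract_add_contract_deriv i v (contDiff_fourierMode k) (fourierMode_one k) hs hp
    · intro j _ hj
      have e : (fun u => basisLoop v k u j) = fun _ => 0 := by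
        funext u
        simp [basisLoop, hj]
      have e' : deriv (fun _ : ℝ => (0 : ℝ)) = fun _ => 0 := by
        funext u
        simp
      rw [e, e', contract_zero, contract_zero, add_zero]
    · simp
  rw [annihKernel, Finset.sum_congr rfl fun i _ => h1 i, Finset.sum_const, Finset.card_univ,
    Fintype.card_fin, Nat.cast_smul_eq_nsmul]

/-- The source of the decay in `k`: each power of the eigenvalue is paid for by one application of
`1 - ∂ᵢ²` to `f`. The exponent is `M + 1` because `dualMode k` already contains one eigenvalue. -/
theorem pow_smul_contract_dualMode {n : ℕ} (i : Fin (n + 1)) (j : Coord d) (k : ℤ) (M : ℕ)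
    {f : Component 𝕜 d (n + 1)} (hf : ContDiff ℝ ∞ f) (hfp : Periodic f) :
    ((modeEigenvalue k ^ M : ℝ) : 𝕜) • contract i j (dualMode k) f
      = contract i j (fourierMode k) ((oneSubLaplace i)^[M + 1] f) := by
  induction M generalizing f with
  | zero => simp [contract_fourierMode_oneSubLaplace i j k hf hfp]
  | succ M ih =>
    rw [Function.iterate_succ_apply, ← ih (contDiff_oneSubLaplace i hf) (hfp.oneSubLaplace i)]
    have e : contract i j (dualMode k) (oneSubLaplace i f)
        = (modeEigenvalue k : 𝕜) • contract i j (dualMode k) f := by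
      rw [← contract_fourierMode_oneSubLaplace i j k hf hfp]
      exact contract_const_mul i j _ _ _
    rw [e, smul_smul]
    push_cast
    rw [pow_succ]

theorem derivNorm_pow_smul_contract_dualMode_le {n : ℕ} (i : Fin (n + 1)) (j : Coord d) (k : ℤ)
    (M l : ℕ) {f : Component 𝕜 d (n + 1)} (hf : ContDiff ℝ ∞ f) (hfp : Periodic f) :
    derivNorm l (((modeEigenvalue k ^ M : ℝ) : 𝕜) • contract i j (dualMode k) f)
      ≤ 2 ^ (M + 2) * derivNorm (l + 1 + 2 * (M + 1)) f := by
  have h := derivNorm_iterate_oneSubLaplace_le (l + 1) (M + 1) i hf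
  rw [pow_smul_contract_dualMode i j k M hf hfp]
  refine (derivNorm_contract_le l i j (contDiff_fourierMode k).continuous (M := 2)
    (fun u _ => abs_fourierMode_le k u) h.1 [] (Or.inl rfl)).trans ?_
  calc ((2 : ℝ≥0) : ℝ≥0∞) * derivNorm (l + 1) ((oneSubLaplace i)^[M + 1] f)
      ≤ 2 * (2 ^ (M + 1) * derivNorm (l + 1 + 2 * (M + 1)) f) := by
        rw [ENNReal.coe_ofNat]
        gcongr
        exact h.2
    _ = _ := by ring

/-! ### Rapid decay and continuity of the derivations -/

theorem contDiff_smul_component {n : ℕ} (c : 𝕜) {f : Component 𝕜 d n} (hf : ContDiff ℝ ∞ f) :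
    ContDiff ℝ ∞ (c • f) := hf.const_smul c

/-- The factor `n + 1` in the annihilation operator is absorbed into a larger constant `C`. -/
theorem pow_mul_succ_le (C : ℝ≥0) (n : ℕ) :
    (C : ℝ≥0∞) ^ n * ((n + 1 : ℕ) : ℝ≥0∞) ≤ ((2 * (C + 1) : ℝ≥0) : ℝ≥0∞) ^ (n + 1) := by
  have hC : C ^ n * ((n + 1 : ℕ) : ℝ≥0) ≤ (2 * (C + 1)) ^ (n + 1) := by
    have e1 : C ^ n ≤ (C + 1) ^ (n + 1) :=
      (pow_le_pow_left₀ zero_le (le_add_of_nonneg_right zero_le_one) n).trans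
        (pow_le_pow_right₀ (le_add_of_nonneg_left zero_le) n.le_succ)
    have e2 : ((n + 1 : ℕ) : ℝ≥0) ≤ 2 ^ (n + 1) := by
      exact_mod_cast (Nat.lt_two_pow_self (n := n + 1)).le
    rw [mul_pow, mul_comm]
    exact mul_le_mul' e2 e1
  exact_mod_cast hC

/-- The derivations along the Fourier modes decay faster than any power of the frequency. -/
theorem coSeminorm_D_le (p : ℕ × ℝ≥0) (M : ℕ) : ∃ (K : ℝ) (q : ℕ × ℝ≥0), 0 ≤ K ∧
    ∀ (v : Coord d) (k : ℤ) (F : CO 𝕜 d),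
      coSeminorm 𝕜 d p (D 𝕜 v k F) ≤ K * (modeEigenvalue k)⁻¹ ^ M * coSeminorm 𝕜 d q F := by
  -- One factor `2` comes from `|c_k| ≤ 2`, the other `2 ^ (M + 1)` from the `M + 1` operators `1 -
  -- ∂²`, which also use `2 * (M + 1)` derivatives. The remaining `+ 1` is the loss in
  -- `derivNorm_contract_le`.
  refine ⟨2 ^ (M + 2), (p.1 + 1 + 2 * (M + 1), 2 * (p.2 + 1)), by positivity, fun v k F => ?_⟩
  have hk := modeEigenvalue_pos k
  have hsm : ∀ n, ContDiff ℝ ∞ (contract 0 v (dualMode k) ((F : Kernels 𝕜 d) (n + 1))) := fun n =>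
    contDiff_contract 0 v (continuous_dualMode k) (F.2.smooth _)
  suffices h : coSeminorm 𝕜 d p (((modeEigenvalue k ^ M : ℝ) : 𝕜) • D 𝕜 v k F)
      ≤ 2 ^ (M + 2) * coSeminorm 𝕜 d (p.1 + 1 + 2 * (M + 1), 2 * (p.2 + 1)) F by
    rw [map_smul_eq_mul, RCLike.norm_ofReal, abs_of_pos (by positivity)] at h
    rw [mul_right_comm, inv_pow, ← div_eq_mul_inv, le_div_iff₀ (by positivity), mul_comm]
    exact h
  rw [coSeminorm_le_iff (by positivity), ENNReal.ofReal_mul (by positivity), ofReal_coSeminorm,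
    ENNReal.ofReal_pow (by norm_num), ENNReal.ofReal_ofNat]
  calc connesNorm p.1 p.2 ((((modeEigenvalue k ^ M : ℝ) : 𝕜) • D 𝕜 v k F : CO 𝕜 d) : Kernels 𝕜 d)
      ≤ ∑' n, 2 ^ (M + 2) * (((2 * (p.2 + 1) : ℝ≥0) : ℝ≥0∞) ^ (n + 1) *
          derivNorm (p.1 + 1 + 2 * (M + 1)) ((F : Kernels 𝕜 d) (n + 1))) := by
        refine ENNReal.tsum_le_tsum fun n => ?_
        rw [Submodule.coe_smul, Pi.smul_apply, coe_D, smul_comm,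
          derivNorm_smul _ _ (contDiff_smul_component _ (hsm n))]
        have e : ‖((n + 1 : ℕ) : 𝕜)‖ₑ = ((n + 1 : ℕ) : ℝ≥0∞) := by
          rw [← ofReal_norm, RCLike.norm_natCast, ENNReal.ofReal_natCast]
        rw [e, ← mul_assoc]
        calc _ ≤ (((2 * (p.2 + 1) : ℝ≥0) : ℝ≥0∞) ^ (n + 1)) * (2 ^ (M + 2) *
              derivNorm (p.1 + 1 + 2 * (M + 1)) ((F : Kernels 𝕜 d) (n + 1))) :=
            mul_le_mul' (pow_mul_succ_le p.2 n)
              (derivNorm_pow_smul_contract_dualMode_le 0 v k M p.1 (F.2.smooth _)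
                (F.2.periodic _))
          _ = _ := by ring
    _ = 2 ^ (M + 2) * ∑' n, (((2 * (p.2 + 1) : ℝ≥0) : ℝ≥0∞) ^ (n + 1) *
          derivNorm (p.1 + 1 + 2 * (M + 1)) ((F : Kernels 𝕜 d) (n + 1))) := ENNReal.tsum_mul_left
    _ ≤ _ := by
        gcongr
        -- The shift `n ↦ n + 1` only omits the term of degree zero.
        exact ENNReal.tsum_comp_le_tsum_of_injective (add_left_injective 1)
          (fun n => ((2 * (p.2 + 1) : ℝ≥0) : ℝ≥0∞) ^ n *
            derivNorm (p.1 + 1 + 2 * (M + 1)) ((F : Kernels 𝕜 d) n))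

variable (𝕜 d) in
/-- The derivation `D v k` as a linear operator. -/
noncomputable def DLin (v : Coord d) (k : ℤ) : CO 𝕜 d →ₗ[𝕜] CO 𝕜 d where
  toFun := D 𝕜 v k
  map_add' F G := by
    refine Subtype.ext (funext fun n => ?_)
    rw [Submodule.coe_add, Pi.add_apply, coe_D, coe_D, coe_D, ← smul_add,
      ← contract_add 0 v (continuous_dualMode k) (F.2.smooth _) (G.2.smooth _)]
    rfl
  map_smul' c F := by
    refine Subtype.ext (funext fun n => ?_)
    rw [RingHom.id_apply, Submodule.coe_smul, Pi.smul_apply, coe_D, coe_D, Submodule.coe_smul,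
      Pi.smul_apply, contract_smul, smul_comm]

variable (𝕜) in
/-- The derivation `D v k` as a continuous linear operator. -/
noncomputable def DL (v : Coord d) (k : ℤ) : CO 𝕜 d →L[𝕜] CO 𝕜 d where
  toLinearMap := DLin 𝕜 d v k
  cont := by
    refine continuous_of_coSeminorm_le (DLin 𝕜 d v k) fun p => ?_
    obtain ⟨K, q, _, h⟩ := coSeminorm_D_le (𝕜 := 𝕜) (d := d) p 0
    exact ⟨K, q, fun F => (h v k F).trans_eq (by simp)⟩

theorem DL_apply (v : Coord d) (k : ℤ) (F : CO 𝕜 d) : DL 𝕜 v k F = D 𝕜 v k F := rfl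

/-! ### The derivations commute -/

/-- Fubini's theorem exchanges the two integrals, and the symmetry of `f` under the transposition of
the first two slots exchanges the arguments. -/
theorem contract_contract_comm {n : ℕ} (v w : Coord d) {φ ψ : ℝ → ℝ} (hφ : Continuous φ)
    (hψ : Continuous ψ) {f : Component 𝕜 d (n + 2)} (hf : ContDiff ℝ ∞ f)
    (hs : ∀ (σ : Equiv.Perm (Fin (n + 2))) s I, f (s ∘ σ) (I ∘ σ) = f s I) :
    contract 0 v φ (contract 0 w ψ f) = contract 0 w ψ (contract 0 v φ f) := by
  have hswap : ∀ {X : Type} (x y : X) (z : Fin n → X),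
      (Fin.cons x (Fin.cons y z : Fin (n + 1) → X) : Fin (n + 2) → X)
        = (Fin.cons y (Fin.cons x z : Fin (n + 1) → X) : Fin (n + 2) → X) ∘ Equiv.swap 0 1 := by
    intro X x y z
    funext q
    refine Fin.cases ?_ (fun q => Fin.cases ?_ (fun q => ?_) q) q
    · rw [Function.comp_apply, Equiv.swap_apply_left]
      rfl
    · rw [Function.comp_apply, show (Fin.succ 0 : Fin (n + 2)) = 1 from rfl,
        Equiv.swap_apply_right]
      rfl
    · rw [Function.comp_apply, Equiv.swap_apply_of_ne_of_ne]
      · simp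
      · exact Fin.succ_ne_zero _
      · exact fun h => Fin.succ_ne_zero q (Fin.succ_injective _ h)
  funext s I
  simp only [contract, Fin.insertNth_zero', ← intervalIntegral.integral_smul]
  rw [MeasureTheory.intervalIntegral_intervalIntegral_swap]
  · refine intervalIntegral.integral_congr fun t _ => intervalIntegral.integral_congr fun u _ => ?_
    rw [hswap t u s, hswap w v I, hs, smul_comm]
  · have hc : Continuous (Function.uncurry fun u t : ℝ => φ u • ψ t •
        f (Fin.cons t (Fin.cons u s : Fin (n + 1) → ℝ) : Fin (n + 2) → ℝ)
          (Fin.cons w (Fin.cons v I : Fin (n + 1) → Coord d) : Fin (n + 2) → Coord d)) := by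
      have h1 : Continuous fun p : ℝ × ℝ =>
          (Fin.cons p.2 (Fin.cons p.1 s : Fin (n + 1) → ℝ) : Fin (n + 2) → ℝ) := by
        refine continuous_pi fun q => ?_
        refine Fin.cases ?_ (fun q => Fin.cases ?_ (fun q => ?_) q) q
        · simpa using continuous_snd
        · simpa using continuous_fst
        · simpa using continuous_const
      exact (hφ.comp continuous_fst).smul ((hψ.comp continuous_snd).smul
        ((continuous_apply _).comp (hf.continuous.comp h1)))
    exact (hc.continuousOn.integrableOn_compact (isCompact_uIcc.prod isCompact_uIcc)).mono_set
      (Set.prod_mono Set.uIoc_subset_uIcc Set.uIoc_subset_uIcc)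

theorem D_comm (v w : Coord d) (k l : ℤ) (F : CO 𝕜 d) :
    D 𝕜 v k (D 𝕜 w l F) = D 𝕜 w l (D 𝕜 v k F) := by
  refine Subtype.ext (funext fun n => ?_)
  simp only [coe_D, contract_smul]
  rw [contract_contract_comm v w (continuous_dualMode k) (continuous_dualMode l)
    (F.2.smooth _) (F.2.symmetric _)]

/-! ### The Leibniz rule -/

/-- `Option` commutes with sums in the left summand. -/
def optionSumEquiv (X Y : Type*) : Option X ⊕ Y ≃ Option (X ⊕ Y) where
  toFun := Sum.elim (Option.map Sum.inl) fun y => some (Sum.inr y)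
  invFun o := o.elim (Sum.inl none) (Sum.map some id)
  left_inv := by rintro ((_ | x) | y) <;> rfl
  right_inv := by rintro (_ | x | y) <;> rfl

/-- The placement of `a + 1 + b` slots for which the slot `j` of the first factor comes first, and
the other ones are placed along `σ`. -/
def insertSlot {a b n : ℕ} (j : Fin (a + 1)) (σ : Fin a ⊕ Fin b ≃ Fin n) :
    Fin (a + 1) ⊕ Fin b ≃ Fin (n + 1) :=
  (((finSuccEquiv' j).sumCongr (Equiv.refl (Fin b))).trans (optionSumEquiv _ _)).trans
    ((Equiv.optionCongr σ).trans (finSuccEquiv n).symm)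

theorem insertSlot_self {a b n : ℕ} (j : Fin (a + 1)) (σ : Fin a ⊕ Fin b ≃ Fin n) :
    insertSlot j σ (Sum.inl j) = 0 := by
  simp [insertSlot, optionSumEquiv]

theorem insertSlot_inl {a b n : ℕ} (j : Fin (a + 1)) (σ : Fin a ⊕ Fin b ≃ Fin n) (l : Fin a) :
    insertSlot j σ (Sum.inl (j.succAbove l)) = (σ (Sum.inl l)).succ := by
  simp [insertSlot, optionSumEquiv]

theorem insertSlot_inr {a b n : ℕ} (j : Fin (a + 1)) (σ : Fin a ⊕ Fin b ≃ Fin n) (l : Fin b) :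
    insertSlot j σ (Sum.inr l) = (σ (Sum.inr l)).succ := by
  simp [insertSlot, optionSumEquiv]

theorem insertSlot_injective {a b n : ℕ} (j : Fin (a + 1)) :
    Function.Injective (insertSlot (b := b) (n := n) j) := by
  intro σ τ h
  refine Equiv.ext fun x => ?_
  rcases x with l | l
  · have := congrArg (fun e => e (Sum.inl (j.succAbove l))) h
    simpa [insertSlot_inl] using this
  · have := congrArg (fun e => e (Sum.inr l)) h
    simpa [insertSlot_inr] using this

theorem exists_insertSlot_eq {a b n : ℕ} (j : Fin (a + 1)) (σ : Fin (a + 1) ⊕ Fin b ≃ Fin (n + 1))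
    (h : σ (Sum.inl j) = 0) : ∃ τ, insertSlot j τ = σ := by
  let e := ((finSuccEquiv' j).sumCongr (Equiv.refl (Fin b))).trans (optionSumEquiv _ _)
  let ρ : Option (Fin a ⊕ Fin b) ≃ Option (Fin n) := (e.symm.trans σ).trans (finSuccEquiv n)
  have hρ : ρ none = none := by
    have : e.symm none = Sum.inl j := by
      simp [e, optionSumEquiv]
    simp [ρ, this, h]
  refine ⟨Equiv.removeNone ρ, ?_⟩
  have h2 : Equiv.optionCongr (Equiv.removeNone ρ) = ρ := by
    ext1 o
    cases o with
    | none => simp [hρ]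
    | some x =>
      have hx : ρ (some x) ≠ none := fun hx => by simpa using ρ.injective (hx.trans hρ.symm)
      simpa using Equiv.removeNone_some ρ (Option.ne_none_iff_exists'.1 hx)
  change e.trans ((Equiv.optionCongr (Equiv.removeNone ρ)).trans (finSuccEquiv n).symm) = σ
  rw [h2]
  ext1 x
  simp [ρ]

/-- A placement that sends slot `j` to position `0` is determined by where it puts the remaining
slots, and these may be placed freely. -/
theorem sum_filter_insertSlot {M : Type*} [AddCommMonoid M] {a b n : ℕ} (j : Fin (a + 1))
    (X : (Fin (a + 1) ⊕ Fin b ≃ Fin (n + 1)) → M) :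
    ∑ σ with σ (Sum.inl j) = 0, X σ = ∑ τ : Fin a ⊕ Fin b ≃ Fin n, X (insertSlot j τ) := by
  refine (Finset.sum_nbij (insertSlot j) (fun τ _ => ?_) (insertSlot_injective j).injOn
    (fun σ hσ => ?_) fun _ _ => rfl).symm
  · simp [insertSlot_self]
  · obtain ⟨τ, rfl⟩ := exists_insertSlot_eq j σ (by simpa using hσ)
    exact ⟨τ, by simp, rfl⟩

/-- Exactly one slot lands in position `0`, the one that will be contracted. Whether it belongs to
the first or to the second factor gives the two terms of the Leibniz rule. -/
theorem sum_placements {M : Type*} [AddCommMonoid M] {a b n : ℕ}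
    (X : (Fin a ⊕ Fin b ≃ Fin (n + 1)) → M) :
    ∑ σ, X σ = ∑ j : Fin a, ∑ σ with σ (Sum.inl j) = 0, X σ
      + ∑ j : Fin b, ∑ σ with σ (Sum.inr j) = 0, X σ := by
  rw [← Fintype.sum_sum_type (fun x : Fin a ⊕ Fin b => ∑ σ with σ x = 0, X σ)]
  simp only [Finset.sum_filter]
  rw [Finset.sum_comm]
  refine Finset.sum_congr rfl fun σ _ => ?_
  rw [Finset.sum_eq_single (σ.symm 0)]
  · simp
  · intro x _ hx
    rw [if_neg]
    rintro h
    exact hx (by simp [← h])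
  · simp

/-- The contracted variable enters only the first factor, so the second one leaves the integral as a
constant. -/
theorem contract_tensor_insertSlot {a b n : ℕ} (v : Coord d) (φ : ℝ → ℝ) (j : Fin (a + 1))
    (τ : Fin a ⊕ Fin b ≃ Fin n) (f : Component 𝕜 d (a + 1)) (g : Component 𝕜 d b) :
    contract 0 v φ (tensor (insertSlot j τ) f g) = tensor τ (contract j v φ f) g := by
  have h1 : ∀ {X : Type} (x : X) (z : Fin n → X),
      Fin.insertNth (α := fun _ => X) 0 x z ∘ insertSlot j τ ∘ Sum.inl
        = Fin.insertNth (α := fun _ => X) j x (z ∘ τ ∘ Sum.inl) := by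
    intro X x z
    funext q
    rcases Fin.eq_self_or_eq_succAbove j q with rfl | ⟨q, rfl⟩
    · simp [insertSlot_self]
    · simp [insertSlot_inl]
  have h2 : ∀ {X : Type} (x : X) (z : Fin n → X),
      Fin.insertNth (α := fun _ => X) 0 x z ∘ insertSlot j τ ∘ Sum.inr = z ∘ τ ∘ Sum.inr := by
    intro X x z
    funext q
    simp [insertSlot_inr]
  funext s I
  simp only [contract, tensor, h1, h2, ← smul_mul_assoc]
  exact intervalIntegral.integral_mul_const _ _

/-- The part of the contraction of `F ⊗̂ G` in which a slot of `F` is contracted. -/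
theorem smul_sum_contract_tensor (v : Coord d) (k : ℤ) (F G : CO 𝕜 d) (n : ℕ) :
    ∑ p ∈ antidiagonal (n + 1), (n.factorial : 𝕜)⁻¹ • ∑ j : Fin p.1,
      ∑ σ : Fin p.1 ⊕ Fin p.2 ≃ Fin (n + 1) with σ (Sum.inl j) = 0,
        contract 0 v (dualMode k) (tensor σ ((F : Kernels 𝕜 d) p.1) ((G : Kernels 𝕜 d) p.2))
      = wickKernel (D 𝕜 v k F) G n := by
  -- The term with no slot in the first factor vanishes. In the others, the `p.1 + 1` choices of
  -- contracted slot contribute equally and produce the integer factor of `coe_D`.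
  rw [Finset.Nat.sum_antidiagonal_succ, wickKernel_eq_sum_symTensor]
  simp only [Finset.univ_eq_empty, Finset.sum_empty, smul_zero, zero_add]
  refine Finset.sum_congr rfl fun p _ => ?_
  simp only [sum_filter_insertSlot, contract_tensor_insertSlot,
    contract_symm _ v (dualMode k) (F.2.symmetric (p.1 + 1))]
  rw [coe_D, map_smul, LinearMap.smul_apply, symTensor_apply, Finset.sum_const, Finset.card_univ,
    Fintype.card_fin, Nat.cast_smul_eq_nsmul, smul_comm]

/-- Placements are sorted by the slot in position `0`. Those that take it from `F` give `:DF.G:`,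
those that take it from `G` give `:DG.F:`. -/
theorem D_wick (v : Coord d) (k : ℤ) (F G : CO 𝕜 d) :
    D 𝕜 v k (wick F G) = wick (D 𝕜 v k F) G + wick F (D 𝕜 v k G) := by
  refine Subtype.ext (funext fun n => ?_)
  rw [wick_comm F (D 𝕜 v k G), Submodule.coe_add, Pi.add_apply, coe_wick, coe_wick,
    ← smul_sum_contract_tensor, ← smul_sum_contract_tensor v k G F, coe_D, coe_wick, wickKernel,
    contract_sum 0 v (continuous_dualMode k) _ _ fun p =>
      contDiff_smul_component _ (contDiff_sum_tensor _ (F.2.smooth _) (G.2.smooth _)),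
    ← Finset.Nat.sum_antidiagonal_swap (n := n + 1)
      (f := fun p : ℕ × ℕ => (n.factorial : 𝕜)⁻¹ • ∑ j : Fin p.1,
      ∑ σ : Fin p.1 ⊕ Fin p.2 ≃ Fin (n + 1) with σ (Sum.inl j) = 0,
        contract 0 v (dualMode k) (tensor σ ((G : Kernels 𝕜 d) p.1) ((F : Kernels 𝕜 d) p.2))),
    ← Finset.sum_add_distrib, Finset.smul_sum]
  refine Finset.sum_congr rfl fun p _ => ?_
  have hn : ((n + 1 : ℕ) : 𝕜) ≠ 0 := by exact_mod_cast n.succ_ne_zero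
  -- The factor `n + 1` of the annihilation operator turns the normalization `1/(n+1)!` of `:F.G:`
  -- into the `1/n!` of the products on the right.
  rw [contract_smul, smul_smul, Nat.factorial_succ, Nat.cast_mul, mul_inv, ← mul_assoc,
    mul_inv_cancel₀ hn, one_mul, ← smul_add,
    contract_sum 0 v (continuous_dualMode k) _ _ fun σ =>
      contDiff_tensor σ (F.2.smooth _) (G.2.smooth _), sum_placements]
  congr 2
  refine Finset.sum_congr rfl fun j _ => ?_
  refine Finset.sum_equiv ((Equiv.sumComm _ _).equivCongr (Equiv.refl _)) (fun σ => ?_)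
    fun σ _ => ?_
  · simp
  · rw [tensor_comm]
    rfl

end Annihilation

/-! ### Bounded bilinear operations -/

section BoundedBilinear

variable {𝕜 : Type u} [RCLike 𝕜] {d : ℕ}

/-- A bilinear operation on the Connes space that is bounded for the norms `‖·‖_{k,C}`. -/
structure BoundedBilinear (B : CO 𝕜 d → CO 𝕜 d → CO 𝕜 d) : Prop where
  add_left : ∀ F F' G, B (F + F') G = B F G + B F' G
  smul_left : ∀ (c : 𝕜) F G, B (c • F) G = c • B F G
  add_right : ∀ F G G', B F (G + G') = B F G + B F G'
  smul_right : ∀ (c : 𝕜) F G, B F (c • G) = c • B F G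
  bounded : ∀ p, ∃ (K : ℝ) (q : ℕ × ℝ≥0), 0 ≤ K ∧ ∀ F G,
    coSeminorm 𝕜 d p (B F G) ≤ K * coSeminorm 𝕜 d q F * coSeminorm 𝕜 d q G

namespace BoundedBilinear

variable {B : CO 𝕜 d → CO 𝕜 d → CO 𝕜 d}

/-- The bilinear map of a bounded bilinear operation. -/
def toLinearMap (hB : BoundedBilinear B) : CO 𝕜 d →ₗ[𝕜] CO 𝕜 d →ₗ[𝕜] CO 𝕜 d :=
  LinearMap.mk₂ 𝕜 B hB.add_left hB.smul_left hB.add_right hB.smul_right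

theorem flip (hB : BoundedBilinear B) : BoundedBilinear fun F G => B G F where
  add_left F F' G := hB.add_right G F F'
  smul_left c F G := hB.smul_right c G F
  add_right F G G' := hB.add_left G G' F
  smul_right c F G := hB.smul_left c G F
  bounded p := by
    obtain ⟨K, q, hK, h⟩ := hB.bounded p
    exact ⟨K, q, hK, fun F G => (h G F).trans_eq (by ring)⟩

theorem continuous_right (hB : BoundedBilinear B) (F : CO 𝕜 d) : Continuous (B F) := by
  refine continuous_of_coSeminorm_le (hB.toLinearMap F) fun p => ?_
  obtain ⟨K, q, -, h⟩ := hB.bounded p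
  exact ⟨K * coSeminorm 𝕜 d q F, q, h F⟩

theorem hasSum_right (hB : BoundedBilinear B) (F : CO 𝕜 d) {ι : Type*} {f : ι → CO 𝕜 d}
    {a : CO 𝕜 d} (h : HasSum f a) : HasSum (fun x => B F (f x)) (B F a) :=
  h.map (hB.toLinearMap F) (hB.continuous_right F)

theorem hasSum_left (hB : BoundedBilinear B) (G : CO 𝕜 d) {ι : Type*} {f : ι → CO 𝕜 d}
    {a : CO 𝕜 d} (h : HasSum f a) : HasSum (fun x => B (f x) G) (B a G) :=
  hB.flip.hasSum_right G h

theorem sum_right (hB : BoundedBilinear B) {κ : Type*} (t : Finset κ) (F : CO 𝕜 d)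
    (f : κ → CO 𝕜 d) : B F (∑ x ∈ t, f x) = ∑ x ∈ t, B F (f x) :=
  map_sum (hB.toLinearMap F) f t

theorem sum_left (hB : BoundedBilinear B) {κ : Type*} (t : Finset κ) (f : κ → CO 𝕜 d)
    (G : CO 𝕜 d) : B (∑ x ∈ t, f x) G = ∑ x ∈ t, B (f x) G :=
  hB.flip.sum_right t G f

end BoundedBilinear

theorem boundedBilinear_wick : BoundedBilinear (wick (𝕜 := 𝕜) (d := d)) where
  add_left := wick_add_left
  smul_left := wick_smul_left
  add_right := wick_add_right
  smul_right := wick_smul_right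
  bounded p := ⟨1, p, zero_le_one, fun F G => by simpa using coSeminorm_wick_le p F G⟩

/-- Series of bilinear operations, with a summable bound, are bounded bilinear operations. -/
theorem boundedBilinear_tsum {ι : Type*} {B : ι → CO 𝕜 d → CO 𝕜 d → CO 𝕜 d}
    (hB : ∀ x, BoundedBilinear (B x))
    (hb : ∀ p, ∃ (w : ι → ℝ) (q : ℕ × ℝ≥0), (∀ x, 0 ≤ w x) ∧ Summable w ∧ ∀ x F G,
      coSeminorm 𝕜 d p (B x F G) ≤ w x * coSeminorm 𝕜 d q F * coSeminorm 𝕜 d q G) :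
    (∀ F G, Summable fun x => B x F G) ∧ BoundedBilinear fun F G => ∑' x, B x F G := by
  have h1 : ∀ F G p, Summable fun x => coSeminorm 𝕜 d p (B x F G) := by
    intro F G p
    obtain ⟨w, q, -, hw, h⟩ := hb p
    exact Summable.of_nonneg_of_le (fun x => apply_nonneg _ _) (fun x => h x F G)
      ((hw.mul_right _).mul_right _)
  have h2 : ∀ F G, Summable fun x => B x F G := fun F G => summable_of_coSeminorm (h1 F G)
  refine ⟨h2, fun F F' G => ?_, fun c F G => ?_, fun F G G' => ?_, fun c F G => ?_, fun p => ?_⟩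
  · rw [← (h2 F G).tsum_add (h2 F' G)]
    exact tsum_congr fun x => (hB x).add_left F F' G
  · rw [← (h2 F G).tsum_const_smul c]
    exact tsum_congr fun x => (hB x).smul_left c F G
  · rw [← (h2 F G).tsum_add (h2 F G')]
    exact tsum_congr fun x => (hB x).add_right F G G'
  · rw [← (h2 F G).tsum_const_smul c]
    exact tsum_congr fun x => (hB x).smul_right c F G
  · obtain ⟨w, q, hw0, hw, h⟩ := hb p
    refine ⟨∑' x, w x, q, tsum_nonneg hw0, fun F G => ?_⟩
    refine (coSeminorm_tsum_le (h1 F G) p).trans ?_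
    rw [← tsum_mul_right, ← tsum_mul_right]
    exact (h1 F G p).tsum_le_tsum (fun x => h x F G) ((hw.mul_right _).mul_right _)

/-! ### Powers of bidifferential operators -/

/-- Coefficients that grow at most polynomially in the frequency. -/
def HasModerateGrowth (c : Coord d → Coord d → ℤ → 𝕜) : Prop :=
  ∃ (K : ℝ) (m : ℕ), 0 ≤ K ∧ ∀ u v k, ‖c u v k‖ ≤ K * modeEigenvalue k ^ m

theorem HasModerateGrowth.add {c e : Coord d → Coord d → ℤ → 𝕜} (hc : HasModerateGrowth c)
    (he : HasModerateGrowth e) : HasModerateGrowth (c + e) := by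
  obtain ⟨K, m, hK, h⟩ := hc
  obtain ⟨K', m', hK', h'⟩ := he
  refine ⟨K + K', max m m', by positivity, fun u v k => ?_⟩
  have h1 := one_le_modeEigenvalue k
  calc ‖(c + e) u v k‖ ≤ ‖c u v k‖ + ‖e u v k‖ := norm_add_le _ _
    _ ≤ K * modeEigenvalue k ^ max m m' + K' * modeEigenvalue k ^ max m m' := by
        refine add_le_add ((h u v k).trans ?_) ((h' u v k).trans ?_)
        · gcongr
          · exact le_max_left _ _
        · gcongr
          · exact le_max_right _ _
    _ = _ := by ring

/-- The operation `(F, G) ↦ c_{u,v,k} B(D_{u,k} F, D_{v,k} G)`, for `x = (u, v, k)`. -/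
noncomputable def bidiffStep (c : Coord d → Coord d → ℤ → 𝕜) (B : CO 𝕜 d → CO 𝕜 d → CO 𝕜 d)
    (F G : CO 𝕜 d) (x : Coord d × Coord d × ℤ) : CO 𝕜 d :=
  c x.1 x.2.1 x.2.2 • B (D 𝕜 x.1 x.2.2 F) (D 𝕜 x.2.1 x.2.2 G)

theorem D_add (v : Coord d) (k : ℤ) (F G : CO 𝕜 d) :
    D 𝕜 v k (F + G) = D 𝕜 v k F + D 𝕜 v k G := map_add (DL 𝕜 v k) F G

theorem D_smul (v : Coord d) (k : ℤ) (c : 𝕜) (F : CO 𝕜 d) :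
    D 𝕜 v k (c • F) = c • D 𝕜 v k F := map_smul (DL 𝕜 v k) c F

/-- The derivative of `F` is estimated with decay of order `m + 1`: `m` powers cancel the growth of
the coefficient, and the last one makes the bound summable in `k`. No decay is asked of the
derivative of `G`. -/
theorem HasModerateGrowth.coSeminorm_le {c : Coord d → Coord d → ℤ → 𝕜}
    (hc : HasModerateGrowth c) (p : ℕ × ℝ≥0) : ∃ (K : ℝ) (q : ℕ × ℝ≥0), 0 ≤ K ∧
      ∀ (x : Coord d × Coord d × ℤ) (F G : CO 𝕜 d),
        ‖c x.1 x.2.1 x.2.2‖ * coSeminorm 𝕜 d p (D 𝕜 x.1 x.2.2 F)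
          * coSeminorm 𝕜 d p (D 𝕜 x.2.1 x.2.2 G)
        ≤ K * (modeEigenvalue x.2.2)⁻¹ * coSeminorm 𝕜 d q F * coSeminorm 𝕜 d q G := by
  obtain ⟨K, m, hK, h⟩ := hc
  obtain ⟨K₁, q₁, hK₁, h₁⟩ := coSeminorm_D_le (𝕜 := 𝕜) (d := d) p (m + 1)
  obtain ⟨K₂, q₂, hK₂, h₂⟩ := coSeminorm_D_le (𝕜 := 𝕜) (d := d) p 0
  refine ⟨K * K₁ * K₂, q₁ ⊔ q₂, by positivity, fun x F G => ?_⟩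
  have hpos := modeEigenvalue_pos x.2.2
  calc _ ≤ (K * modeEigenvalue x.2.2 ^ m)
        * (K₁ * (modeEigenvalue x.2.2)⁻¹ ^ (m + 1) * coSeminorm 𝕜 d (q₁ ⊔ q₂) F)
        * (K₂ * coSeminorm 𝕜 d (q₁ ⊔ q₂) G) := by
        have e₁ := (h₁ x.1 x.2.2 F).trans
          (mul_le_mul_of_nonneg_left (coSeminorm_mono (le_sup_left (b := q₂)) F) (by positivity))
        have e₂ := (h₂ x.2.1 x.2.2 G).trans
          (mul_le_mul_of_nonneg_left (coSeminorm_mono (le_sup_right (a := q₁)) G) (by positivity))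
        rw [pow_zero, mul_one] at e₂
        gcongr
        exact h x.1 x.2.1 x.2.2
    _ = _ := by
        rw [inv_pow, pow_succ]
        field_simp

theorem summable_inv_modeEigenvalue_coord :
    Summable fun x : Coord d × Coord d × ℤ => (modeEigenvalue x.2.2)⁻¹ := by
  have hi : ∀ k, 0 ≤ (modeEigenvalue k)⁻¹ := fun k => inv_nonneg.2 (modeEigenvalue_pos k).le
  have h0 : ∀ f : Coord d → ℝ, Summable f := fun f => (hasSum_fintype f).summable
  have h1 := (h0 fun _ => 1).mul_of_nonneg summable_inv_modeEigenvalue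
    (fun _ => zero_le_one) hi
  have h2 := (h0 fun _ => 1).mul_of_nonneg h1 (fun _ => zero_le_one)
    fun x => mul_nonneg zero_le_one (hi _)
  simpa using h2

/-- The class of bounded bilinear operations is stable under one more factor of the bidifferential
operator, so the powers can be built by induction. -/
theorem BoundedBilinear.bidiffStep {B : CO 𝕜 d → CO 𝕜 d → CO 𝕜 d} (hB : BoundedBilinear B)
    {c : Coord d → Coord d → ℤ → 𝕜} (hc : HasModerateGrowth c) :
    (∀ F G, Summable (bidiffStep c B F G)) ∧
      BoundedBilinear fun F G => ∑' x, ConnesSpace.bidiffStep c B F G x := by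
  have key : ∀ p, ∃ (K : ℝ) (q : ℕ × ℝ≥0), 0 ≤ K ∧ ∀ x F G,
      coSeminorm 𝕜 d p (ConnesSpace.bidiffStep c B F G x)
        ≤ K * (modeEigenvalue x.2.2)⁻¹ * coSeminorm 𝕜 d q F * coSeminorm 𝕜 d q G := by
    intro p
    obtain ⟨K, q, hK, h⟩ := hB.bounded p
    obtain ⟨K', q', hK', h'⟩ := hc.coSeminorm_le q
    refine ⟨K * K', q', by positivity, fun x F G => ?_⟩
    rw [ConnesSpace.bidiffStep, map_smul_eq_mul]
    calc _ ≤ ‖c x.1 x.2.1 x.2.2‖ * (K * coSeminorm 𝕜 d q (D 𝕜 x.1 x.2.2 F)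
          * coSeminorm 𝕜 d q (D 𝕜 x.2.1 x.2.2 G)) := by gcongr; exact h _ _
      _ = K * (‖c x.1 x.2.1 x.2.2‖ * coSeminorm 𝕜 d q (D 𝕜 x.1 x.2.2 F)
          * coSeminorm 𝕜 d q (D 𝕜 x.2.1 x.2.2 G)) := by ring
      _ ≤ K * (K' * (modeEigenvalue x.2.2)⁻¹ * coSeminorm 𝕜 d q' F * coSeminorm 𝕜 d q' G) := by
          exact mul_le_mul_of_nonneg_left (h' x F G) hK
      _ = _ := by ring
  refine boundedBilinear_tsum (B := fun x F G => ConnesSpace.bidiffStep c B F G x)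
    (fun x => ⟨?_, ?_, ?_, ?_, fun p => ?_⟩) fun p => ?_
  · intro F F' G
    simp only [ConnesSpace.bidiffStep, D_add, hB.add_left, smul_add]
  · intro a F G
    simp only [ConnesSpace.bidiffStep, D_smul, hB.smul_left]
    exact smul_comm _ _ _
  · intro F F' G
    simp only [ConnesSpace.bidiffStep, D_add, hB.add_right, smul_add]
  · intro a F G
    simp only [ConnesSpace.bidiffStep, D_smul, hB.smul_right]
    exact smul_comm _ _ _
  · obtain ⟨K, q, hK, h⟩ := key p
    exact ⟨_, q, mul_nonneg hK (inv_nonneg.2 (modeEigenvalue_pos x.2.2).le), h x⟩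
  · obtain ⟨K, q, hK, h⟩ := key p
    exact ⟨_, q, fun x => mul_nonneg hK (inv_nonneg.2 (modeEigenvalue_pos x.2.2).le),
      summable_inv_modeEigenvalue_coord.mul_left K, h⟩

/-- The `r`-th power of the bidifferential operator with coefficients `c`, by recursion. -/
noncomputable def bidiffPow (c : Coord d → Coord d → ℤ → 𝕜) : ℕ → CO 𝕜 d → CO 𝕜 d → CO 𝕜 d
  | 0 => wick
  | r + 1 => fun F G => ∑' x, bidiffStep c (bidiffPow c r) F G x

theorem boundedBilinear_bidiffPow {c : Coord d → Coord d → ℤ → 𝕜} (hc : HasModerateGrowth c)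
    (r : ℕ) : BoundedBilinear (bidiffPow c r) := by
  induction r with
  | zero => exact boundedBilinear_wick
  | succ r ih => exact (ih.bidiffStep hc).2

theorem hasSum_bidiffPow_succ {c : Coord d → Coord d → ℤ → 𝕜} (hc : HasModerateGrowth c) (r : ℕ)
    (F G : CO 𝕜 d) : HasSum (bidiffStep c (bidiffPow c r) F G) (bidiffPow c (r + 1) F G) :=
  (((boundedBilinear_bidiffPow hc r).bidiffStep hc).1 F G).hasSum

theorem iterD_D {r : ℕ} (w : Fin r → Coord d × ℤ) (v : Coord d) (k : ℤ) (F : CO 𝕜 d) :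
    iterD w (D 𝕜 v k F) = D 𝕜 v k (iterD w F) := by
  unfold iterD
  induction List.ofFn w with
  | nil => rfl
  | cons x l ih => simp only [List.foldr_cons, ih, D_comm v]

/-- Since the derivations commute, the first letter can be applied first instead of last, which is
the order in the recursion of `bidiffPow`. -/
theorem iterD_cons {r : ℕ} (w : Fin (r + 1) → Coord d × ℤ) (F : CO 𝕜 d) :
    iterD w F = iterD (fun l => w l.succ) (D 𝕜 (w 0).1 (w 0).2 F) := by
  rw [iterD_D]
  unfold iterD
  rw [List.ofFn_succ, List.foldr_cons]

theorem bidiffTerm_cons (c : Coord d → Coord d → ℤ → 𝕜) (r : ℕ) (F G : CO 𝕜 d)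
    (x : Coord d × Coord d × ℤ) (w : Fin r → Coord d × Coord d × ℤ) :
    bidiffTerm c (r + 1) F G (Fin.cons x w : Fin (r + 1) → Coord d × Coord d × ℤ)
      = c x.1 x.2.1 x.2.2 • bidiffTerm c r (D 𝕜 x.1 x.2.2 F) (D 𝕜 x.2.1 x.2.2 G) w := by
  unfold bidiffTerm
  rw [iterD_cons, iterD_cons, Fin.prod_univ_succ, smul_smul]
  simp only [Fin.cons_zero, Fin.cons_succ]

theorem summable_prod_words {ι : Type*} {f : ι → ℝ} (hf : Summable f) (h0 : ∀ x, 0 ≤ f x) (r : ℕ) :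
    Summable fun w : Fin r → ι => ∏ l, f (w l) := by
  induction r with
  | zero => exact (hasSum_fintype _).summable
  | succ r ih =>
    rw [← (Fin.consEquiv fun _ : Fin (r + 1) => ι).summable_iff]
    have := hf.mul_of_nonneg ih h0 fun w => Finset.prod_nonneg fun l _ => h0 _
    convert this using 2 with x
    simp [Fin.consEquiv, Fin.prod_univ_succ]

/-- One letter is peeled off at a time. Each contributes its own factor `λ_k⁻¹`, and the product of
these is summable over words of fixed length. -/
theorem coSeminorm_bidiffTerm_le {c : Coord d → Coord d → ℤ → 𝕜} (hc : HasModerateGrowth c)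
    (r : ℕ) (p : ℕ × ℝ≥0) : ∃ (K : ℝ) (q : ℕ × ℝ≥0), 0 ≤ K ∧ ∀ F G w,
      coSeminorm 𝕜 d p (bidiffTerm c r F G w)
        ≤ K * (∏ l, (modeEigenvalue (w l).2.2)⁻¹) * coSeminorm 𝕜 d q F * coSeminorm 𝕜 d q G := by
  induction r with
  | zero =>
    refine ⟨1, p, zero_le_one, fun F G w => ?_⟩
    simpa [bidiffTerm, iterD] using coSeminorm_wick_le p F G
  | succ r ih =>
    obtain ⟨K, q, hK, h⟩ := ih
    obtain ⟨K', q', hK', h'⟩ := hc.coSeminorm_le q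
    refine ⟨K * K', q', by positivity, fun F G w => ?_⟩
    obtain ⟨⟨x, w⟩, rfl⟩ := (Fin.consEquiv fun _ : Fin (r + 1) => Coord d × Coord d × ℤ).surjective w
    change coSeminorm 𝕜 d p (bidiffTerm c (r + 1) F G (Fin.cons x w)) ≤ K * K' *
      (∏ l : Fin (r + 1), (modeEigenvalue
        ((Fin.cons x w : Fin (r + 1) → Coord d × Coord d × ℤ) l).2.2)⁻¹) * _ * _
    rw [bidiffTerm_cons, map_smul_eq_mul, Fin.prod_univ_succ]
    simp only [Fin.cons_zero, Fin.cons_succ]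
    have hw : 0 ≤ ∏ l, (modeEigenvalue (w l).2.2)⁻¹ :=
      Finset.prod_nonneg fun l _ => inv_nonneg.2 (modeEigenvalue_pos _).le
    calc _ ≤ ‖c x.1 x.2.1 x.2.2‖ * (K * (∏ l, (modeEigenvalue (w l).2.2)⁻¹)
          * coSeminorm 𝕜 d q (D 𝕜 x.1 x.2.2 F) * coSeminorm 𝕜 d q (D 𝕜 x.2.1 x.2.2 G)) := by
          gcongr
          exact h _ _ _
      _ = K * (∏ l, (modeEigenvalue (w l).2.2)⁻¹) * (‖c x.1 x.2.1 x.2.2‖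
          * coSeminorm 𝕜 d q (D 𝕜 x.1 x.2.2 F) * coSeminorm 𝕜 d q (D 𝕜 x.2.1 x.2.2 G)) := by ring
      _ ≤ K * (∏ l, (modeEigenvalue (w l).2.2)⁻¹) * (K' * (modeEigenvalue x.2.2)⁻¹
          * coSeminorm 𝕜 d q' F * coSeminorm 𝕜 d q' G) := by
          exact mul_le_mul_of_nonneg_left (h' x F G) (mul_nonneg hK hw)
      _ = _ := by ring

/-- Absolute convergence over words allows summation first over the tail of the word and then over
its first letter, which is the recursion of `bidiffPow`. -/
theorem hasSum_bidiffTerm {c : Coord d → Coord d → ℤ → 𝕜} (hc : HasModerateGrowth c)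
    (r : ℕ) (F G : CO 𝕜 d) : HasSum (bidiffTerm c r F G) (bidiffPow c r F G) := by
  have hs : ∀ r F G, Summable (bidiffTerm c r F G) := by
    intro r F G
    refine summable_of_coSeminorm fun p => ?_
    obtain ⟨K, q, hK, h⟩ := coSeminorm_bidiffTerm_le hc r p
    refine Summable.of_nonneg_of_le (fun w => apply_nonneg _ _) (fun w => h F G w) ?_
    exact (((summable_prod_words summable_inv_modeEigenvalue_coord
      (fun x => inv_nonneg.2 (modeEigenvalue_pos _).le) r).mul_left K).mul_right _).mul_right _
  induction r generalizing F G with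
  | zero =>
    have := hasSum_fintype (bidiffTerm c 0 F G)
    rw [Fintype.sum_unique] at this
    convert this using 1
    simp [bidiffTerm, iterD, bidiffPow]
  | succ r ih =>
    have h1 := (hs (r + 1) F G).hasSum
    rw [← (Fin.consEquiv fun _ : Fin (r + 1) => Coord d × Coord d × ℤ).hasSum_iff] at h1
    -- The words that begin with `x` sum, by induction, to the `x`-th term of the recursion.
    have h2 := h1.prod_fiberwise (g := bidiffStep c (bidiffPow c r) F G) fun x => by
      have := (ih (D 𝕜 x.1 x.2.2 F) (D 𝕜 x.2.1 x.2.2 G)).const_smul (c x.1 x.2.1 x.2.2)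
      simp only [← bidiffTerm_cons] at this
      exact this
    rw [(hasSum_bidiffPow_succ hc r F G).unique h2]
    exact (hs (r + 1) F G).hasSum

/-- The derivation passes through the series by continuity and through the inner derivations by
`D_comm`. The induction starts from the Leibniz rule for the Wick product. -/
theorem D_bidiffPow {c : Coord d → Coord d → ℤ → 𝕜} (hc : HasModerateGrowth c) (r : ℕ)
    (v : Coord d) (k : ℤ) (F G : CO 𝕜 d) :
    D 𝕜 v k (bidiffPow c r F G) = bidiffPow c r (D 𝕜 v k F) G + bidiffPow c r F (D 𝕜 v k G) := by
  induction r generalizing F G with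
  | zero => exact D_wick v k F G
  | succ r ih =>
    refine ((hasSum_bidiffPow_succ hc r F G).map (DL 𝕜 v k) (DL 𝕜 v k).continuous).unique ?_
    convert (hasSum_bidiffPow_succ hc r (D 𝕜 v k F) G).add
      (hasSum_bidiffPow_succ hc r F (D 𝕜 v k G)) using 1
    funext x
    simp only [bidiffStep, Function.comp_apply, DL_apply, D_smul, ih, smul_add]
    rw [D_comm v x.1, D_comm v x.2.1]

/-- Exchanging `u` and `v` reindexes the sum, and each of the `r` factors contributes one `ε`. It is
used with `ε = -1` for the Poisson coefficients and `ε = 1` for the symmetric ones. -/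
theorem bidiffPow_swap {c : Coord d → Coord d → ℤ → 𝕜} (hc : HasModerateGrowth c) (ε : 𝕜)
    (h : ∀ u v k, c v u k = ε * c u v k) (r : ℕ) (F G : CO 𝕜 d) :
    bidiffPow c r G F = ε ^ r • bidiffPow c r F G := by
  induction r generalizing F G with
  | zero => simpa [bidiffPow] using wick_comm G F
  | succ r ih =>
    let e : Coord d × Coord d × ℤ ≃ Coord d × Coord d × ℤ :=
      ⟨fun x => (x.2.1, x.1, x.2.2), fun x => (x.2.1, x.1, x.2.2), fun _ => rfl, fun _ => rfl⟩
    have h1 := e.hasSum_iff.2 (hasSum_bidiffPow_succ hc r G F)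
    refine h1.unique ?_
    convert (hasSum_bidiffPow_succ hc r F G).const_smul (ε ^ (r + 1)) using 1
    funext x
    change c x.2.1 x.1 x.2.2 • bidiffPow c r (D 𝕜 x.2.1 x.2.2 G) (D 𝕜 x.1 x.2.2 F)
      = ε ^ (r + 1) • c x.1 x.2.1 x.2.2 • bidiffPow c r (D 𝕜 x.1 x.2.2 F) (D 𝕜 x.2.1 x.2.2 G)
    rw [ih, h, smul_smul, smul_smul]
    congr 1
    ring

/-! ### Associativity -/

/-- Passes from exponential to ordinary coefficients: with binomial weights the recursions have
integer coefficients, while star products carry inverse factorials. -/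
theorem smul_choose_sum {M : Type*} [AddCommGroup M] [Module 𝕜 M] (n : ℕ) (f : ℕ → ℕ → M) :
    (n.factorial : 𝕜)⁻¹ • ∑ p ∈ antidiagonal n, n.choose p.1 • f p.1 p.2
      = ∑ p ∈ antidiagonal n, (p.1.factorial : 𝕜)⁻¹ • (p.2.factorial : 𝕜)⁻¹ • f p.1 p.2 := by
  rw [Finset.smul_sum]
  refine Finset.sum_congr rfl fun p hp => ?_
  obtain rfl := mem_antidiagonal.1 hp
  rw [← Nat.cast_smul_eq_nsmul 𝕜, smul_smul, smul_smul]
  congr 1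
  have h1 : (p.1.factorial : 𝕜) ≠ 0 := by exact_mod_cast p.1.factorial_ne_zero
  have h2 : (p.2.factorial : 𝕜) ≠ 0 := by exact_mod_cast p.2.factorial_ne_zero
  have h3 : ((p.1 + p.2).factorial : 𝕜) ≠ 0 := by exact_mod_cast (p.1 + p.2).factorial_ne_zero
  have h4 : ((p.1 + p.2).choose p.1 : 𝕜) * p.1.factorial * p.2.factorial
      = (p.1 + p.2).factorial := by
    have := Nat.choose_mul_factorial_mul_factorial (Nat.le_add_right p.1 p.2)
    rw [Nat.add_sub_cancel_left] at this
    exact_mod_cast this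
  field_simp
  linear_combination h4

/-- Pascal's rule, with the binomial coefficient brought to the same form in both halves. It is the
step from `n` to `n + 1` in all the recursions below. -/
theorem sum_choose_succ {M : Type*} [AddCommMonoid M] (n : ℕ) (f : ℕ → ℕ → M) :
    ∑ p ∈ antidiagonal (n + 1), (n + 1).choose p.1 • f p.1 p.2
      = ∑ p ∈ antidiagonal n, n.choose p.1 • (f p.1 (p.2 + 1) + f (p.1 + 1) p.2) := by
  rw [Finset.sum_antidiagonal_choose_succ_nsmul, ← Finset.sum_add_distrib]
  refine Finset.sum_congr rfl fun p hp => ?_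
  rw [Nat.choose_symm_of_eq_add (mem_antidiagonal.1 hp).symm, smul_add]

/-- `n!` times the coefficient of `ħⁿ` in `F ⋆ (G ⋆ H)`. -/
noncomputable def rightNested (c : Coord d → Coord d → ℤ → 𝕜) (n : ℕ) (F G H : CO 𝕜 d) : CO 𝕜 d :=
  ∑ p ∈ antidiagonal n, n.choose p.1 • bidiffPow c p.1 F (bidiffPow c p.2 G H)

/-- `n!` times the coefficient of `ħⁿ` in `(F ⋆ G) ⋆ H`. -/
noncomputable def leftNested (c : Coord d → Coord d → ℤ → 𝕜) (n : ℕ) (F G H : CO 𝕜 d) : CO 𝕜 d :=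
  ∑ p ∈ antidiagonal n, n.choose p.1 • bidiffPow c p.1 (bidiffPow c p.2 F G) H

/-- By Pascal's rule, the extra factor is inner or outer. An inner one acts on the pair `(G, H)`. An
outer one acts on `F` and on the inner result, and the Leibniz rule distributes it over the pairs
`(F, G)` and `(F, H)`. -/
theorem hasSum_rightNested {c : Coord d → Coord d → ℤ → 𝕜} (hc : HasModerateGrowth c) (n : ℕ)
    (F G H : CO 𝕜 d) :
    HasSum (fun x : Coord d × Coord d × ℤ => c x.1 x.2.1 x.2.2 •
      (rightNested c n F (D 𝕜 x.1 x.2.2 G) (D 𝕜 x.2.1 x.2.2 H)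
        + rightNested c n (D 𝕜 x.1 x.2.2 F) (D 𝕜 x.2.1 x.2.2 G) H
        + rightNested c n (D 𝕜 x.1 x.2.2 F) G (D 𝕜 x.2.1 x.2.2 H)))
      (rightNested c (n + 1) F G H) := by
  have hB := boundedBilinear_bidiffPow hc
  rw [rightNested, sum_choose_succ n fun a b => bidiffPow c a F (bidiffPow c b G H)]
  convert hasSum_sum fun (p : ℕ × ℕ) (_ : p ∈ antidiagonal n) => (((hB p.1).hasSum_right F
    (hasSum_bidiffPow_succ hc p.2 G H)).add
    (hasSum_bidiffPow_succ hc p.1 F (bidiffPow c p.2 G H))).const_smul (n.choose p.1) using 1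
  funext x
  simp only [bidiffStep, rightNested, D_bidiffPow hc, (hB _).add_right, (hB _).smul_right,
    ← Finset.sum_add_distrib, Finset.smul_sum]
  refine Finset.sum_congr rfl fun p _ => ?_
  module

/-- Here the inner factor gives the pair `(F, G)` and the outer one, by the Leibniz rule, the pairs
`(F, H)` and `(G, H)`. The total is the same recursion as for the other bracketing. -/
theorem hasSum_leftNested {c : Coord d → Coord d → ℤ → 𝕜} (hc : HasModerateGrowth c) (n : ℕ)
    (F G H : CO 𝕜 d) :
    HasSum (fun x : Coord d × Coord d × ℤ => c x.1 x.2.1 x.2.2 •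
      (leftNested c n F (D 𝕜 x.1 x.2.2 G) (D 𝕜 x.2.1 x.2.2 H)
        + leftNested c n (D 𝕜 x.1 x.2.2 F) (D 𝕜 x.2.1 x.2.2 G) H
        + leftNested c n (D 𝕜 x.1 x.2.2 F) G (D 𝕜 x.2.1 x.2.2 H)))
      (leftNested c (n + 1) F G H) := by
  have hB := boundedBilinear_bidiffPow hc
  rw [leftNested, sum_choose_succ n fun a b => bidiffPow c a (bidiffPow c b F G) H]
  convert hasSum_sum fun (p : ℕ × ℕ) (_ : p ∈ antidiagonal n) => (((hB p.1).hasSum_left H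
    (hasSum_bidiffPow_succ hc p.2 F G)).add
    (hasSum_bidiffPow_succ hc p.1 (bidiffPow c p.2 F G) H)).const_smul (n.choose p.1) using 1
  funext x
  simp only [bidiffStep, leftNested, D_bidiffPow hc, (hB _).add_left, (hB _).smul_left,
    ← Finset.sum_add_distrib, Finset.smul_sum]
  refine Finset.sum_congr rfl fun p _ => ?_
  module

/-- The common recursion determines both sides from their value at `n = 0`, where the claim is
associativity of the Wick product. The arguments vary in the induction because the recursion
differentiates them. -/
theorem rightNested_eq_leftNested {c : Coord d → Coord d → ℤ → 𝕜} (hc : HasModerateGrowth c)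
    (n : ℕ) (F G H : CO 𝕜 d) : rightNested c n F G H = leftNested c n F G H := by
  induction n generalizing F G H with
  | zero => simpa [rightNested, leftNested, bidiffPow] using wick_assoc F G H
  | succ n ih =>
    have h := hasSum_rightNested hc n F G H
    simp only [ih] at h
    exact h.unique (hasSum_leftNested hc n F G H)

end BoundedBilinear

/-! ### Star products of bidifferential operators -/

section Star

variable {𝕜 : Type u} [RCLike 𝕜] {d : ℕ}

theorem smul_formal_apply {M : Type u} [AddCommGroup M] [Module 𝕜 M] (f : 𝕜⟦X⟧)
    (F : FormalSeries M) (n : ℕ) :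
    (f • F) n = ∑ p ∈ antidiagonal n, PowerSeries.coeff p.1 f • F p.2 := rfl

theorem formal_add_apply {M : Type u} [AddCommGroup M] (F G : FormalSeries M) (n : ℕ) :
    (F + G) n = F n + G n := rfl

theorem starProduct_add_left {P : ℕ → CO 𝕜 d → CO 𝕜 d → CO 𝕜 d} (hP : ∀ r, BoundedBilinear (P r))
    (F F' G : FormalSeries (CO 𝕜 d)) :
    starProduct P (F + F') G = starProduct P F G + starProduct P F' G := by
  funext n
  simp only [starProduct, formal_add_apply, (hP _).add_left, smul_add, Finset.sum_add_distrib]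

theorem starProduct_add_right {P : ℕ → CO 𝕜 d → CO 𝕜 d → CO 𝕜 d}
    (hP : ∀ r, BoundedBilinear (P r)) (F G G' : FormalSeries (CO 𝕜 d)) :
    starProduct P F (G + G') = starProduct P F G + starProduct P F G' := by
  funext n
  simp only [starProduct, formal_add_apply, (hP _).add_right, smul_add, Finset.sum_add_distrib]

theorem starProduct_smul_left {P : ℕ → CO 𝕜 d → CO 𝕜 d → CO 𝕜 d}
    (hP : ∀ r, BoundedBilinear (P r)) (f : 𝕜⟦X⟧) (F G : FormalSeries (CO 𝕜 d)) :
    starProduct P (f • F) G = f • starProduct P F G := by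
  funext n
  simp only [starProduct, smul_formal_apply, (hP _).sum_left, (hP _).smul_left, Finset.smul_sum]
  calc _ = ∑ p ∈ antidiagonal n, ∑ q ∈ antidiagonal p.2, ∑ t ∈ antidiagonal q.2,
        PowerSeries.coeff q.1 f • (p.1.factorial : 𝕜)⁻¹ • P p.1 (F t.1) (G t.2) :=
        Finset.sum_congr rfl fun p _ => by
          simp only [smul_comm (p.1.factorial : 𝕜)⁻¹]
          exact sum_antidiagonal_assoc p.2 fun a b l =>
            PowerSeries.coeff a f • (p.1.factorial : 𝕜)⁻¹ • P p.1 (F b) (G l)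
    _ = _ := sum_antidiagonal_left_comm n fun r t l => ∑ q ∈ antidiagonal l,
        PowerSeries.coeff t f • (r.factorial : 𝕜)⁻¹ • P r (F q.1) (G q.2)

theorem starProduct_smul_right {P : ℕ → CO 𝕜 d → CO 𝕜 d → CO 𝕜 d}
    (hP : ∀ r, BoundedBilinear (P r)) (f : 𝕜⟦X⟧) (F G : FormalSeries (CO 𝕜 d)) :
    starProduct P F (f • G) = f • starProduct P F G := by
  funext n
  simp only [starProduct, smul_formal_apply, (hP _).sum_right, (hP _).smul_right, Finset.smul_sum]
  calc _ = ∑ p ∈ antidiagonal n, ∑ q ∈ antidiagonal p.2, ∑ t ∈ antidiagonal q.2,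
        PowerSeries.coeff q.1 f • (p.1.factorial : 𝕜)⁻¹ • P p.1 (F t.1) (G t.2) :=
        Finset.sum_congr rfl fun p _ => by
          simp only [smul_comm (p.1.factorial : 𝕜)⁻¹]
          exact sum_antidiagonal_left_comm p.2 fun a b l =>
            PowerSeries.coeff b f • (p.1.factorial : 𝕜)⁻¹ • P p.1 (F a) (G l)
    _ = _ := sum_antidiagonal_left_comm n fun r t l => ∑ q ∈ antidiagonal l,
        PowerSeries.coeff t f • (r.factorial : 𝕜)⁻¹ • P r (F q.1) (G q.2)

theorem inv_factorial_smul_rightNested (c : Coord d → Coord d → ℤ → 𝕜) (n : ℕ) (F G H : CO 𝕜 d) :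
    (n.factorial : 𝕜)⁻¹ • rightNested c n F G H = ∑ p ∈ antidiagonal n, (p.1.factorial : 𝕜)⁻¹ •
      (p.2.factorial : 𝕜)⁻¹ • bidiffPow c p.1 F (bidiffPow c p.2 G H) :=
  smul_choose_sum n fun a b => bidiffPow c a F (bidiffPow c b G H)

theorem inv_factorial_smul_leftNested (c : Coord d → Coord d → ℤ → 𝕜) (n : ℕ) (F G H : CO 𝕜 d) :
    (n.factorial : 𝕜)⁻¹ • leftNested c n F G H = ∑ p ∈ antidiagonal n, (p.1.factorial : 𝕜)⁻¹ •
      (p.2.factorial : 𝕜)⁻¹ • bidiffPow c p.1 (bidiffPow c p.2 F G) H :=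
  smul_choose_sum n fun a b => bidiffPow c a (bidiffPow c b F G) H

/-- Pure reindexing: the orders of the inner and outer operators are collected into one index, so
that associativity reduces to arguments in the Connes space. -/
theorem starProduct_starProduct_right {c : Coord d → Coord d → ℤ → 𝕜} (hc : HasModerateGrowth c)
    (F G H : FormalSeries (CO 𝕜 d)) (n : ℕ) :
    starProduct (bidiffPow c) F (starProduct (bidiffPow c) G H) n
      = ∑ p ∈ antidiagonal n, ∑ q ∈ antidiagonal p.2, ∑ s ∈ antidiagonal q.2,
          (p.1.factorial : 𝕜)⁻¹ • rightNested c p.1 (F q.1) (G s.1) (H s.2) := by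
  have hB := boundedBilinear_bidiffPow hc
  simp only [inv_factorial_smul_rightNested]
  simp only [starProduct, (hB _).sum_right, (hB _).smul_right, Finset.smul_sum]
  calc _ = ∑ p ∈ antidiagonal n, ∑ q ∈ antidiagonal p.2, ∑ s ∈ antidiagonal q.2,
        ∑ t ∈ antidiagonal s.2, (p.1.factorial : 𝕜)⁻¹ • (q.1.factorial : 𝕜)⁻¹ •
          bidiffPow c p.1 (F s.1) (bidiffPow c q.1 (G t.1) (H t.2)) :=
        Finset.sum_congr rfl fun p _ => sum_antidiagonal_left_comm p.2 fun a b l =>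
          ∑ t ∈ antidiagonal l, (p.1.factorial : 𝕜)⁻¹ • (b.factorial : 𝕜)⁻¹ •
            bidiffPow c p.1 (F a) (bidiffPow c b (G t.1) (H t.2))
    _ = ∑ p ∈ antidiagonal n, ∑ q ∈ antidiagonal p.1, ∑ s ∈ antidiagonal p.2,
        ∑ t ∈ antidiagonal s.2, (q.1.factorial : 𝕜)⁻¹ • (q.2.factorial : 𝕜)⁻¹ •
          bidiffPow c q.1 (F s.1) (bidiffPow c q.2 (G t.1) (H t.2)) :=
        (sum_antidiagonal_assoc n fun a b l => ∑ s ∈ antidiagonal l, ∑ t ∈ antidiagonal s.2,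
          (a.factorial : 𝕜)⁻¹ • (b.factorial : 𝕜)⁻¹ •
            bidiffPow c a (F s.1) (bidiffPow c b (G t.1) (H t.2))).symm
    _ = _ := by
        refine Finset.sum_congr rfl fun p _ => ?_
        rw [Finset.sum_comm]
        exact Finset.sum_congr rfl fun s _ => Finset.sum_comm

theorem starProduct_starProduct_left {c : Coord d → Coord d → ℤ → 𝕜} (hc : HasModerateGrowth c)
    (F G H : FormalSeries (CO 𝕜 d)) (n : ℕ) :
    starProduct (bidiffPow c) (starProduct (bidiffPow c) F G) H n
      = ∑ p ∈ antidiagonal n, ∑ q ∈ antidiagonal p.2, ∑ s ∈ antidiagonal q.2,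
          (p.1.factorial : 𝕜)⁻¹ • leftNested c p.1 (F q.1) (G s.1) (H s.2) := by
  have hB := boundedBilinear_bidiffPow hc
  simp only [inv_factorial_smul_leftNested]
  simp only [starProduct, (hB _).sum_left, (hB _).smul_left, Finset.smul_sum]
  calc _ = ∑ p ∈ antidiagonal n, ∑ q ∈ antidiagonal p.2, ∑ s ∈ antidiagonal q.2,
        ∑ t ∈ antidiagonal s.1, (p.1.factorial : 𝕜)⁻¹ • (q.1.factorial : 𝕜)⁻¹ •
          bidiffPow c p.1 (bidiffPow c q.1 (F t.1) (G t.2)) (H s.2) :=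
        Finset.sum_congr rfl fun p _ => sum_antidiagonal_assoc p.2 fun a l b =>
          ∑ t ∈ antidiagonal l, (p.1.factorial : 𝕜)⁻¹ • (a.factorial : 𝕜)⁻¹ •
            bidiffPow c p.1 (bidiffPow c a (F t.1) (G t.2)) (H b)
    _ = ∑ p ∈ antidiagonal n, ∑ q ∈ antidiagonal p.2, ∑ s ∈ antidiagonal q.2,
        ∑ t ∈ antidiagonal s.2, (p.1.factorial : 𝕜)⁻¹ • (q.1.factorial : 𝕜)⁻¹ •
          bidiffPow c p.1 (bidiffPow c q.1 (F s.1) (G t.1)) (H t.2) :=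
        Finset.sum_congr rfl fun p _ => Finset.sum_congr rfl fun q _ =>
          sum_antidiagonal_assoc q.2 fun a b l => (p.1.factorial : 𝕜)⁻¹ •
            (q.1.factorial : 𝕜)⁻¹ • bidiffPow c p.1 (bidiffPow c q.1 (F a) (G b)) (H l)
    _ = ∑ p ∈ antidiagonal n, ∑ q ∈ antidiagonal p.1, ∑ s ∈ antidiagonal p.2,
        ∑ t ∈ antidiagonal s.2, (q.1.factorial : 𝕜)⁻¹ • (q.2.factorial : 𝕜)⁻¹ •
          bidiffPow c q.1 (bidiffPow c q.2 (F s.1) (G t.1)) (H t.2) :=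
        (sum_antidiagonal_assoc n fun a b l => ∑ s ∈ antidiagonal l, ∑ t ∈ antidiagonal s.2,
          (a.factorial : 𝕜)⁻¹ • (b.factorial : 𝕜)⁻¹ •
            bidiffPow c a (bidiffPow c b (F s.1) (G t.1)) (H t.2)).symm
    _ = _ := by
        refine Finset.sum_congr rfl fun p _ => ?_
        rw [Finset.sum_comm]
        exact Finset.sum_congr rfl fun s _ => Finset.sum_comm

theorem isStarProduct_bidiffPow {c : Coord d → Coord d → ℤ → 𝕜} (hc : HasModerateGrowth c)
    {br : CO 𝕜 d → CO 𝕜 d → CO 𝕜 d}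
    (hbr : ∀ F G, bidiffPow c 1 F G - bidiffPow c 1 G F = (2 : 𝕜) • br F G) :
    IsStarProduct br (bidiffPow c) where
  bilinear r := ⟨(boundedBilinear_bidiffPow hc r).toLinearMap, fun _ _ => rfl⟩
  formal_bilinear :=
    ⟨LinearMap.mk₂ 𝕜⟦X⟧ (starProduct (bidiffPow c))
      (starProduct_add_left (boundedBilinear_bidiffPow hc))
      (starProduct_smul_left (boundedBilinear_bidiffPow hc))
      (starProduct_add_right (boundedBilinear_bidiffPow hc))
      (starProduct_smul_right (boundedBilinear_bidiffPow hc)), fun _ _ => rfl⟩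
  zero _ _ := rfl
  one := hbr
  bounded r _ p := by
    obtain ⟨K, q, -, h⟩ := (boundedBilinear_bidiffPow hc r).bounded p
    exact ⟨K, q, h⟩
  assoc F G H := by
    funext n
    rw [starProduct_starProduct_right hc, starProduct_starProduct_left hc]
    simp only [rightNested_eq_leftNested hc]

/-! ### The Poisson bracket -/

theorem hasModerateGrowth_poissonCoeff :
    HasModerateGrowth (poissonCoeff : Coord d → Coord d → ℤ → 𝕜) := by
  refine ⟨1, 0, zero_le_one, fun u v k => ?_⟩
  rcases u with i | i <;> rcases v with j | j <;> simp only [poissonCoeff] <;>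
    first | split_ifs | skip
  all_goals simp

theorem poissonCoeff_swap (u v : Coord d) (k : ℤ) :
    (poissonCoeff v u k : 𝕜) = -1 * poissonCoeff u v k := by
  rcases u with i | i <;> rcases v with j | j <;> simp [poissonCoeff, eq_comm]

theorem symmCoeff_swap (α : ℤ → 𝕜) (u v : Coord d) (k : ℤ) :
    symmCoeff α v u k = 1 * symmCoeff α u v k := by
  rcases u with i | i <;> rcases v with j | j <;> simp [symmCoeff, eq_comm]

theorem poissonBracket_eq (F G : CO 𝕜 d) :
    poissonBracket F G = bidiffPow poissonCoeff 1 F G := rfl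

theorem bidiffPow_zero (c : Coord d → Coord d → ℤ → 𝕜) : bidiffPow c 0 = wick := rfl

theorem hasSum_poissonBracket (F G : CO 𝕜 d) :
    HasSum (poissonTerm F G) (poissonBracket F G) :=
  hasSum_bidiffPow_succ hasModerateGrowth_poissonCoeff 0 F G

theorem poissonBracket_antisymm (F G : CO 𝕜 d) : poissonBracket F G = -poissonBracket G F := by
  have := bidiffPow_swap (𝕜 := 𝕜) hasModerateGrowth_poissonCoeff (-1) poissonCoeff_swap 1 G F
  rw [pow_one] at this
  have h := neg_one_smul 𝕜 (poissonBracket G F)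
  exact this.trans h

/-- A consequence of associativity at order two; the terms with `P²` cancel in the cyclic sum
because `P²` is symmetric. -/
theorem poissonBracket_jacobi (F G H : CO 𝕜 d) :
    poissonBracket F (poissonBracket G H) + poissonBracket G (poissonBracket H F)
      + poissonBracket H (poissonBracket F G) = 0 := by
  have key : ∀ F G H : CO 𝕜 d,
      wick F (bidiffPow poissonCoeff 2 G H) + (2 : 𝕜) • poissonBracket F (poissonBracket G H)
        + bidiffPow poissonCoeff 2 F (wick G H)
      = wick H (bidiffPow poissonCoeff 2 F G) - (2 : 𝕜) • poissonBracket H (poissonBracket F G)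
        + bidiffPow poissonCoeff 2 H (wick F G) := by
    intro F G H
    have h := rightNested_eq_leftNested (𝕜 := 𝕜) hasModerateGrowth_poissonCoeff 2 F G H
    have h2 := bidiffPow_swap (𝕜 := 𝕜) hasModerateGrowth_poissonCoeff (-1) poissonCoeff_swap 2
      H (wick F G)
    rw [neg_one_sq, one_smul] at h2
    have h1 := poissonBracket_antisymm (poissonBracket F G) H
    simp [rightNested, leftNested, Finset.Nat.antidiagonal_succ, bidiffPow_zero,
      ← poissonBracket_eq] at h
    rw [h1, wick_comm (bidiffPow poissonCoeff 2 F G) H, h2] at h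
    linear_combination (norm := module) h
  -- In the cyclic sum the terms `:F.P²(G, H):` and `P²(F, :G.H:)` occur once on each side. The
  -- brackets occur with coefficient `2` on the left and `-2` on the right.
  have h := congrArg₂ (· + ·) (congrArg₂ (· + ·) (key F G H) (key G H F)) (key H F G)
  have h4 : (4 : 𝕜) • (poissonBracket F (poissonBracket G H) + poissonBracket G (poissonBracket H F)
      + poissonBracket H (poissonBracket F G)) = 0 := by
    rw [← sub_eq_zero] at h
    rw [← h]
    module
  exact (smul_eq_zero.1 h4).resolve_left (by norm_num)

theorem poissonBracket_leibniz (F G H : CO 𝕜 d) :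
    poissonBracket F (wick G H) = wick (poissonBracket F G) H + wick G (poissonBracket F H) := by
  have hw := boundedBilinear_wick (𝕜 := 𝕜) (d := d)
  refine (hasSum_poissonBracket F (wick G H)).unique ?_
  convert (hw.hasSum_left H (hasSum_poissonBracket F G)).add
    (hw.hasSum_right G (hasSum_poissonBracket F H)) using 1
  funext x
  simp only [poissonTerm, D_wick, wick_add_right, wick_smul_left, wick_smul_right, smul_add]
  rw [wick_assoc, wick_assoc, wick_assoc, wick_comm (D 𝕜 x.1 x.2.2 F) G]

theorem isPoissonStructure_poissonBracket :
    IsPoissonStructure (poissonBracket (𝕜 := 𝕜) (d := d)) where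
  bilinear := ⟨(boundedBilinear_bidiffPow hasModerateGrowth_poissonCoeff 1).toLinearMap,
    fun _ _ => rfl⟩
  antisymm := poissonBracket_antisymm
  jacobi := poissonBracket_jacobi
  leibniz := poissonBracket_leibniz
  bounded p := by
    obtain ⟨K, q, -, h⟩ :=
      (boundedBilinear_bidiffPow (𝕜 := 𝕜) (d := d) hasModerateGrowth_poissonCoeff 1).bounded p
    exact ⟨K, q, h⟩

/-- The added operator is symmetric in `F` and `G`, so it drops out of the commutator. -/
theorem bidiffPow_add_symmCoeff_one {α : ℤ → 𝕜}
    (hα : HasModerateGrowth (symmCoeff α : Coord d → Coord d → ℤ → 𝕜)) (F G : CO 𝕜 d) :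
    bidiffPow (poissonCoeff + symmCoeff α) 1 F G - bidiffPow (poissonCoeff + symmCoeff α) 1 G F
      = (2 : 𝕜) • poissonBracket F G := by
  have hp := hasModerateGrowth_poissonCoeff (𝕜 := 𝕜) (d := d)
  have h : ∀ F G : CO 𝕜 d, bidiffPow (poissonCoeff + symmCoeff α) 1 F G
      = poissonBracket F G + bidiffPow (symmCoeff α) 1 F G := by
    intro F G
    refine (hasSum_bidiffPow_succ (hp.add hα) 0 F G).unique ?_
    have hadd : HasSum _ (poissonBracket F G + bidiffPow (symmCoeff α) 1 F G) :=
      (hasSum_bidiffPow_succ hp 0 F G).add (hasSum_bidiffPow_succ hα 0 F G)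
    convert hadd using 1
    funext x
    exact add_smul _ _ _
  have hs := bidiffPow_swap hα 1 (symmCoeff_swap α) 1 F G
  rw [h, h, hs, poissonBracket_antisymm G F]
  module

end Star

/-! ### The intertwining operator -/

section Intertwiner

variable {𝕜 : Type u} [RCLike 𝕜] {d : ℕ}

/-- For `k ≠ 0`, `|k| ≥ 1` permits rounding the exponent up to an integer. The summand `‖α 0‖` takes
care of the frequency that the growth condition leaves free, and `|K|` makes the constant
nonnegative. -/
theorem exists_norm_le_modeEigenvalue_pow {α : ℤ → 𝕜} {K μ : ℝ}
    (hα : ∀ k : ℤ, k ≠ 0 → ‖α k‖ ≤ K * |(k : ℝ)| ^ μ) :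
    ∃ (K' : ℝ) (m : ℕ), 0 ≤ K' ∧ ∀ k, ‖α k‖ ≤ K' * modeEigenvalue k ^ m := by
  refine ⟨|K| + ‖α 0‖, ⌈μ⌉₊, by positivity, fun k => ?_⟩
  have h1 : 1 ≤ modeEigenvalue k ^ ⌈μ⌉₊ := one_le_pow₀ (one_le_modeEigenvalue k)
  by_cases hk : k = 0
  · subst hk
    nlinarith [abs_nonneg K, norm_nonneg (α 0)]
  · have hk1 : 1 ≤ |(k : ℝ)| := by exact_mod_cast Int.one_le_abs hk
    have h2 : |(k : ℝ)| ^ μ ≤ modeEigenvalue k ^ ⌈μ⌉₊ := by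
      calc |(k : ℝ)| ^ μ ≤ |(k : ℝ)| ^ (⌈μ⌉₊ : ℝ) :=
            Real.rpow_le_rpow_of_exponent_le hk1 (Nat.le_ceil μ)
        _ = |(k : ℝ)| ^ ⌈μ⌉₊ := Real.rpow_natCast _ _
        _ ≤ _ := pow_le_pow_left₀ (abs_nonneg _) (abs_le_modeEigenvalue k) _
    have h3 : 0 ≤ |(k : ℝ)| ^ μ := Real.rpow_nonneg (abs_nonneg _) _
    calc ‖α k‖ ≤ K * |(k : ℝ)| ^ μ := hα k hk
      _ ≤ |K| * modeEigenvalue k ^ ⌈μ⌉₊ := mul_le_mul (le_abs_self K) h2 h3 (abs_nonneg K)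
      _ ≤ _ := mul_le_mul_of_nonneg_right (le_add_of_nonneg_right (norm_nonneg _)) (by linarith)

theorem hasModerateGrowth_symmCoeff {α : ℤ → 𝕜} {K : ℝ} {m : ℕ} (hK : 0 ≤ K)
    (hα : ∀ k, ‖α k‖ ≤ K * modeEigenvalue k ^ m) :
    HasModerateGrowth (symmCoeff α : Coord d → Coord d → ℤ → 𝕜) := by
  refine ⟨K, m, hK, fun u v k => ?_⟩
  have h0 : 0 ≤ K * modeEigenvalue k ^ m := (norm_nonneg _).trans (hα k)
  rcases u with i | i <;> rcases v with j | j <;> simp only [symmCoeff] <;>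
    first | split_ifs | skip
  all_goals first | exact hα k | simpa using h0

/-- The outer derivation supplies decay of order `m + 1`, enough to cancel the growth of `α` and
leave a summable factor; the inner one only needs to be bounded. -/
theorem coSeminorm_intertwinerTerm_le {α : ℤ → 𝕜} {K : ℝ} {m : ℕ} (hK : 0 ≤ K)
    (hα : ∀ k, ‖α k‖ ≤ K * modeEigenvalue k ^ m) (p : ℕ × ℝ≥0) :
    ∃ (K' : ℝ) (q : ℕ × ℝ≥0), 0 ≤ K' ∧ ∀ (F : CO 𝕜 d) x,
      coSeminorm 𝕜 d p (intertwinerTerm α F x)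
        ≤ K' * (modeEigenvalue x.2)⁻¹ * coSeminorm 𝕜 d q F := by
  obtain ⟨K₁, q₁, hK₁, h₁⟩ := coSeminorm_D_le (𝕜 := 𝕜) (d := d) p (m + 1)
  obtain ⟨K₂, q₂, hK₂, h₂⟩ := coSeminorm_D_le (𝕜 := 𝕜) (d := d) q₁ 0
  refine ⟨K * K₁ * K₂, q₂, by positivity, fun F x => ?_⟩
  have hpos := modeEigenvalue_pos x.2
  rw [intertwinerTerm, map_neg_eq_map, map_smul_eq_mul]
  calc _ ≤ (K * modeEigenvalue x.2 ^ m)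
        * (K₁ * (modeEigenvalue x.2)⁻¹ ^ (m + 1) * (K₂ * coSeminorm 𝕜 d q₂ F)) := by
        have e₂ := h₂ (Sum.inr x.1) x.2 F
        rw [pow_zero, mul_one] at e₂
        exact mul_le_mul (hα x.2) ((h₁ _ _ _).trans
          (mul_le_mul_of_nonneg_left e₂ (by positivity))) (apply_nonneg _ _) (by positivity)
    _ = _ := by
        rw [inv_pow, pow_succ]
        field_simp

theorem summable_inv_modeEigenvalue_fin :
    Summable fun x : Fin d × ℤ => (modeEigenvalue x.2)⁻¹ := by
  have h1 := ((hasSum_fintype fun _ : Fin d => (1 : ℝ)).summable).mul_of_nonneg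
    summable_inv_modeEigenvalue (fun _ => zero_le_one)
    fun k => inv_nonneg.2 (modeEigenvalue_pos k).le
  simpa using h1

/-- The terms of the intertwining operator, as continuous linear operators. -/
noncomputable def intertwinerTermL (α : ℤ → 𝕜) (x : Fin d × ℤ) : CO 𝕜 d →L[𝕜] CO 𝕜 d :=
  -(α x.2 • (DL 𝕜 (Sum.inl x.1) x.2).comp (DL 𝕜 (Sum.inr x.1) x.2))

theorem exists_intertwiner {α : ℤ → 𝕜} {K : ℝ} {m : ℕ} (hK : 0 ≤ K)
    (hα : ∀ k, ‖α k‖ ≤ K * modeEigenvalue k ^ m) :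
    ∃ T : CO 𝕜 d →L[𝕜] CO 𝕜 d, ∀ F, HasSum (intertwinerTerm α F) (T F) := by
  have h1 : ∀ F p, Summable fun x => coSeminorm 𝕜 d p (intertwinerTerm α F x) := by
    intro F p
    obtain ⟨K', q, -, h⟩ := coSeminorm_intertwinerTerm_le (d := d) hK hα p
    exact Summable.of_nonneg_of_le (fun x => apply_nonneg _ _) (fun x => h F x)
      ((summable_inv_modeEigenvalue_fin.mul_left K').mul_right _)
  have h2 : ∀ F : CO 𝕜 d, HasSum (intertwinerTerm α F) (∑' x, intertwinerTerm α F x) := fun F =>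
    (summable_of_coSeminorm (h1 F)).hasSum
  let T : CO 𝕜 d →ₗ[𝕜] CO 𝕜 d :=
    { toFun := fun F => ∑' x, intertwinerTerm α F x
      map_add' := fun F G => (h2 (F + G)).unique (by
        convert (h2 F).add (h2 G) using 1
        funext x
        exact map_add (intertwinerTermL α x) F G)
      map_smul' := fun c F => (h2 (c • F)).unique (by
        have h3 : HasSum _ (c • ∑' x, intertwinerTerm α F x) := (h2 F).const_smul c
        rwa [← show _ = fun x => c • intertwinerTerm α F x from
          funext fun x => map_smul (intertwinerTermL α x) c F] at h3) }
  refine ⟨⟨T, continuous_of_coSeminorm_le T fun p => ?_⟩, h2⟩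
  obtain ⟨K', q, -, h⟩ := coSeminorm_intertwinerTerm_le (d := d) hK hα p
  refine ⟨∑' x : Fin d × ℤ, K' * (modeEigenvalue x.2)⁻¹, q, fun F => ?_⟩
  refine (coSeminorm_tsum_le (h1 F) p).trans ?_
  rw [← tsum_mul_right]
  exact (h1 F p).tsum_le_tsum (h F) ((summable_inv_modeEigenvalue_fin.mul_left K').mul_right _)

section Intertwine

/-! ### Conjugation of star products by the exponential of `ħT₁` -/

variable {α : ℤ → 𝕜} {T : CO 𝕜 d →L[𝕜] CO 𝕜 d}

theorem D_intertwiner (hT : ∀ F, HasSum (intertwinerTerm α F) (T F)) (v : Coord d) (k : ℤ)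
    (F : CO 𝕜 d) : D 𝕜 v k (T F) = T (D 𝕜 v k F) := by
  refine ((hT F).map (DL 𝕜 v k) (DL 𝕜 v k).continuous).unique ?_
  convert hT (D 𝕜 v k F) using 1
  funext x
  rw [Function.comp_apply, intertwinerTerm, map_neg, map_smul, DL_apply, intertwinerTerm,
    D_comm v (Sum.inl x.1), D_comm v (Sum.inr x.1)]

theorem D_intertwiner_pow (hT : ∀ F, HasSum (intertwinerTerm α F) (T F)) (v : Coord d) (k : ℤ)
    (a : ℕ) (F : CO 𝕜 d) : D 𝕜 v k ((T ^ a) F) = (T ^ a) (D 𝕜 v k F) := by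
  induction a with
  | zero => rfl
  | succ a ih =>
    rw [pow_succ', mul_apply_eq_comp, mul_apply_eq_comp, D_intertwiner hT, ih]

/-- The symmetric bidifferential operator as a sum over the pairs `(i, k)`. -/
theorem hasSum_bidiffStep_symmCoeff (hα : HasModerateGrowth (symmCoeff α : Coord d → _))
    {B : CO 𝕜 d → CO 𝕜 d → CO 𝕜 d} (hB : BoundedBilinear B) (F G : CO 𝕜 d) :
    HasSum (fun x : Fin d × ℤ => α x.2 •
      (B (D 𝕜 (Sum.inl x.1) x.2 F) (D 𝕜 (Sum.inr x.1) x.2 G)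
        + B (D 𝕜 (Sum.inr x.1) x.2 F) (D 𝕜 (Sum.inl x.1) x.2 G)))
      (∑' x, bidiffStep (symmCoeff α) B F G x) := by
  -- The index triples whose coefficient can be nonzero; the Boolean records which of the two
  -- entries is the undual one.
  let ι : (Fin d × ℤ) × Bool → Coord d × Coord d × ℤ := fun x =>
    cond x.2 (Sum.inl x.1.1, Sum.inr x.1.1, x.1.2) (Sum.inr x.1.1, Sum.inl x.1.1, x.1.2)
  have hι : Function.Injective ι := by
    rintro ⟨⟨i, k⟩, _ | _⟩ ⟨⟨j, l⟩, _ | _⟩ h <;> simp_all [ι]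
  have hs := ((hB.bidiffStep hα).1 F G).hasSum
  rw [← hι.hasSum_iff] at hs
  · convert hs.prod_fiberwise fun x => hasSum_fintype _ using 1
    funext x
    simp [bidiffStep, ι, symmCoeff]
  · rintro ⟨u, v, k⟩ hx
    suffices h : symmCoeff α u v k = 0 by simp [bidiffStep, h]
    rcases u with i | i <;> rcases v with j | j <;> simp only [symmCoeff]
    · exact if_neg fun h => hx ⟨((i, k), true), by simp [ι, h]⟩
    · exact if_neg fun h => hx ⟨((i, k), false), by simp [ι, h]⟩

/-- Apply the Leibniz rule twice to each term `-α_k D_{γ} D_{γ*}`. When both derivations hit the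
same argument, the terms form `T` of that argument; the mixed terms form the symmetric operator,
with a minus sign. -/
theorem intertwiner_bidiffPow (hT : ∀ F, HasSum (intertwinerTerm α F) (T F))
    (hα : HasModerateGrowth (symmCoeff α : Coord d → _))
    {c : Coord d → Coord d → ℤ → 𝕜} (hc : HasModerateGrowth c) (r : ℕ) (F G : CO 𝕜 d) :
    T (bidiffPow c r F G) = bidiffPow c r (T F) G + bidiffPow c r F (T G)
      - ∑' x, bidiffStep (symmCoeff α) (bidiffPow c r) F G x := by
  have hB := boundedBilinear_bidiffPow hc r
  refine (hT _).unique ?_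
  have h : HasSum _ (bidiffPow c r (T F) G + bidiffPow c r F (T G)
      - ∑' x, bidiffStep (symmCoeff α) (bidiffPow c r) F G x) :=
    ((hB.hasSum_left G (hT F)).add (hB.hasSum_right F (hT G))).sub
      (hasSum_bidiffStep_symmCoeff hα hB F G)
  convert h using 1
  funext x
  have e : ∀ F : CO 𝕜 d, intertwinerTerm α F x
      = (-α x.2) • D 𝕜 (Sum.inl x.1) x.2 (D 𝕜 (Sum.inr x.1) x.2 F) := fun F => (neg_smul _ _).symm
  rw [e, e, e, hB.smul_left, hB.smul_right]
  simp only [D_bidiffPow hc, D_add]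
  module

/-- `n!` times the coefficient of `ħⁿ` in `exp (ħ T) (F ⋆ G)`. -/
noncomputable def expStar (c : Coord d → Coord d → ℤ → 𝕜) (T : CO 𝕜 d →L[𝕜] CO 𝕜 d) (n : ℕ)
    (F G : CO 𝕜 d) : CO 𝕜 d :=
  ∑ p ∈ antidiagonal n, n.choose p.1 • (T ^ p.1) (bidiffPow c p.2 F G)

/-- `m!` times the coefficient of `ħᵐ` in `P (exp (ħ T) F) (exp (ħ T) G)`. -/
noncomputable def bilinExp (B : CO 𝕜 d → CO 𝕜 d → CO 𝕜 d) (T : CO 𝕜 d →L[𝕜] CO 𝕜 d) (m : ℕ)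
    (F G : CO 𝕜 d) : CO 𝕜 d :=
  ∑ p ∈ antidiagonal m, m.choose p.1 • B ((T ^ p.1) F) ((T ^ p.2) G)

/-- `n!` times the coefficient of `ħⁿ` in `exp (ħ T) F ⋆ exp (ħ T) G`. -/
noncomputable def starExp (c : Coord d → Coord d → ℤ → 𝕜) (T : CO 𝕜 d →L[𝕜] CO 𝕜 d) (n : ℕ)
    (F G : CO 𝕜 d) : CO 𝕜 d :=
  ∑ p ∈ antidiagonal n, n.choose p.1 • bilinExp (bidiffPow c p.1) T p.2 F G

/-- By Pascal's rule, the new factor is either `T` or the bidifferential operator with coefficients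
`c + symmCoeff α`. Moving `T` onto the arguments costs the symmetric operator, which cancels the
summand `symmCoeff α` and leaves `c`. -/
theorem hasSum_expStar (hT : ∀ F, HasSum (intertwinerTerm α F) (T F))
    (hα : HasModerateGrowth (symmCoeff α : Coord d → _))
    {c : Coord d → Coord d → ℤ → 𝕜} (hc : HasModerateGrowth c) (n : ℕ) (F G : CO 𝕜 d) :
    HasSum (bidiffStep c (expStar (c + symmCoeff α) T n) F G)
      (expStar (c + symmCoeff α) T (n + 1) F G
        - (expStar (c + symmCoeff α) T n (T F) G + expStar (c + symmCoeff α) T n F (T G))) := by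
  have hca := hc.add hα
  have e : expStar (c + symmCoeff α) T (n + 1) F G
        - (expStar (c + symmCoeff α) T n (T F) G + expStar (c + symmCoeff α) T n F (T G))
      = ∑ p ∈ antidiagonal n, n.choose p.1 •
        ((T ^ p.1) (bidiffPow (c + symmCoeff α) (p.2 + 1) F G)
          - (T ^ p.1) (∑' x, bidiffStep (symmCoeff α) (bidiffPow (c + symmCoeff α) p.2) F G x)) := by
    rw [expStar, sum_choose_succ n fun a b => (T ^ a) (bidiffPow (c + symmCoeff α) b F G), expStar,
      expStar, ← Finset.sum_add_distrib, ← Finset.sum_sub_distrib]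
    refine Finset.sum_congr rfl fun p _ => ?_
    rw [pow_succ, mul_apply_eq_comp, intertwiner_bidiffPow hT hα hca, map_sub, map_add]
    module
  rw [e]
  have h : HasSum _ _ := hasSum_sum fun (p : ℕ × ℕ) (_ : p ∈ antidiagonal n) =>
    (((hasSum_bidiffPow_succ hca p.2 F G).map (T ^ p.1) (T ^ p.1).continuous).sub
      ((((boundedBilinear_bidiffPow hca p.2).bidiffStep hα).1 F G).hasSum.map (T ^ p.1)
        (T ^ p.1).continuous)).const_smul (n.choose p.1)
  refine (congrArg (HasSum · _) (funext fun x => ?_)).mp h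
  simp only [bidiffStep, expStar, Function.comp_apply, map_smul, Finset.smul_sum, Pi.add_apply]
  refine Finset.sum_congr rfl fun p _ => ?_
  module

/-- The new factor is either the operator with coefficients `c` or an operator `T` acting on `F` or
on `G`. As `T` commutes with all the derivations, the former can be applied to the arguments first.
-/
theorem hasSum_starExp (hT : ∀ F, HasSum (intertwinerTerm α F) (T F))
    {c : Coord d → Coord d → ℤ → 𝕜} (hc : HasModerateGrowth c) (n : ℕ) (F G : CO 𝕜 d) :
    HasSum (bidiffStep c (starExp c T n) F G)
      (starExp c T (n + 1) F G - (starExp c T n (T F) G + starExp c T n F (T G))) := by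
  have h1 : ∀ (B : CO 𝕜 d → CO 𝕜 d → CO 𝕜 d) m, bilinExp B T (m + 1) F G
      = bilinExp B T m (T F) G + bilinExp B T m F (T G) := by
    intro B m
    rw [bilinExp, sum_choose_succ m fun a b => B ((T ^ a) F) ((T ^ b) G), bilinExp, bilinExp,
      ← Finset.sum_add_distrib]
    refine Finset.sum_congr rfl fun p _ => ?_
    rw [pow_succ, pow_succ, mul_apply_eq_comp, mul_apply_eq_comp,
      ← smul_add, add_comm]
  have h2 : ∀ r m, HasSum (bidiffStep c (bilinExp (bidiffPow c r) T m) F G)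
      (bilinExp (bidiffPow c (r + 1)) T m F G) := by
    intro r m
    unfold bilinExp
    convert hasSum_sum fun (p : ℕ × ℕ) (_ : p ∈ antidiagonal m) =>
      (hasSum_bidiffPow_succ hc r ((T ^ p.1) F) ((T ^ p.2) G)).const_smul (m.choose p.1) using 1
    funext x
    simp only [bidiffStep, D_intertwiner_pow hT, Finset.smul_sum]
    exact Finset.sum_congr rfl fun p _ => smul_comm _ _ _
  have e : starExp c T (n + 1) F G - (starExp c T n (T F) G + starExp c T n F (T G))
      = ∑ p ∈ antidiagonal n, n.choose p.1 • bilinExp (bidiffPow c (p.1 + 1)) T p.2 F G := by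
    rw [starExp, sum_choose_succ n fun a b => bilinExp (bidiffPow c a) T b F G, starExp,
      starExp, ← Finset.sum_add_distrib, ← Finset.sum_sub_distrib]
    refine Finset.sum_congr rfl fun p _ => ?_
    rw [h1]
    module
  rw [e]
  convert hasSum_sum fun (p : ℕ × ℕ) (_ : p ∈ antidiagonal n) =>
    (h2 p.1 p.2).const_smul (n.choose p.1) using 1
  funext x
  simp only [bidiffStep, starExp, Finset.smul_sum]
  exact Finset.sum_congr rfl fun p _ => smul_comm _ _ _

theorem expStar_eq_starExp (hT : ∀ F, HasSum (intertwinerTerm α F) (T F))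
    (hα : HasModerateGrowth (symmCoeff α : Coord d → _))
    {c : Coord d → Coord d → ℤ → 𝕜} (hc : HasModerateGrowth c) (n : ℕ) (F G : CO 𝕜 d) :
    expStar (c + symmCoeff α) T n F G = starExp c T n F G := by
  induction n generalizing F G with
  | zero => simp [expStar, starExp, bilinExp, bidiffPow_zero]
  | succ n ih =>
    have h1 := hasSum_expStar hT hα hc n F G
    -- The recursion evaluates the `n`-th coefficient at derivatives of `F` and `G`, so equality is
    -- needed for all arguments.
    have e : expStar (c + symmCoeff α) T n = starExp c T n := funext₂ ih
    rw [e] at h1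
    exact sub_left_injective (h1.unique (hasSum_starExp hT hc n F G))

/-! ### From coefficients to formal power series -/

theorem formalOperator_apply (T : ℕ → CO 𝕜 d →L[𝕜] CO 𝕜 d) (F : FormalSeries (CO 𝕜 d)) (n : ℕ) :
    formalOperator T F n = ∑ p ∈ antidiagonal n, T p.1 (F p.2) := rfl

theorem formalOperator_starProduct {c : Coord d → Coord d → ℤ → 𝕜}
    (F G : FormalSeries (CO 𝕜 d)) (n : ℕ) :
    formalOperator (fun r => (r.factorial : 𝕜)⁻¹ • T ^ r) (starProduct (bidiffPow c) F G) n
      = ∑ p ∈ antidiagonal n, ∑ q ∈ antidiagonal p.2,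
        (p.1.factorial : 𝕜)⁻¹ • expStar c T p.1 (F q.1) (G q.2) := by
  have h1 : ∀ m F G, (m.factorial : 𝕜)⁻¹ • expStar c T m F G = ∑ p ∈ antidiagonal m,
      (p.1.factorial : 𝕜)⁻¹ • (p.2.factorial : 𝕜)⁻¹ • (T ^ p.1) (bidiffPow c p.2 F G) :=
    fun m F G => smul_choose_sum m fun a b => (T ^ a) (bidiffPow c b F G)
  simp only [h1, formalOperator_apply, starProduct, map_sum, map_smul,
    _root_.smul_apply]
  calc _ = ∑ p ∈ antidiagonal n, ∑ q ∈ antidiagonal p.2, ∑ s ∈ antidiagonal q.2,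
        (p.1.factorial : 𝕜)⁻¹ • (q.1.factorial : 𝕜)⁻¹ • (T ^ p.1) (bidiffPow c q.1 (F s.1) (G s.2)) :=
        Finset.sum_congr rfl fun p _ => Finset.sum_congr rfl fun q _ =>
          Finset.sum_congr rfl fun s _ => smul_comm _ _ _
    _ = ∑ p ∈ antidiagonal n, ∑ q ∈ antidiagonal p.1, ∑ s ∈ antidiagonal p.2,
        (q.1.factorial : 𝕜)⁻¹ • (q.2.factorial : 𝕜)⁻¹ • (T ^ q.1) (bidiffPow c q.2 (F s.1) (G s.2)) :=
        (sum_antidiagonal_assoc n fun a b l => ∑ s ∈ antidiagonal l, (a.factorial : 𝕜)⁻¹ •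
          (b.factorial : 𝕜)⁻¹ • (T ^ a) (bidiffPow c b (F s.1) (G s.2))).symm
    _ = _ := Finset.sum_congr rfl fun p _ => Finset.sum_comm

/-- Reindexing again: the power of the bidifferential operator and the two powers of `T` are
collected into a single order, whose coefficient is `starExp`. -/
theorem starProduct_formalOperator {c : Coord d → Coord d → ℤ → 𝕜} (hc : HasModerateGrowth c)
    (F G : FormalSeries (CO 𝕜 d)) (n : ℕ) :
    starProduct (bidiffPow c) (formalOperator (fun r => (r.factorial : 𝕜)⁻¹ • T ^ r) F)
        (formalOperator (fun r => (r.factorial : 𝕜)⁻¹ • T ^ r) G) n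
      = ∑ p ∈ antidiagonal n, ∑ q ∈ antidiagonal p.2,
        (p.1.factorial : 𝕜)⁻¹ • starExp c T p.1 (F q.1) (G q.2) := by
  have hB := boundedBilinear_bidiffPow hc
  have h1 : ∀ m r F G, (m.factorial : 𝕜)⁻¹ • bilinExp (bidiffPow c r) T m F G
      = ∑ p ∈ antidiagonal m, (p.1.factorial : 𝕜)⁻¹ • (p.2.factorial : 𝕜)⁻¹ •
        bidiffPow c r ((T ^ p.1) F) ((T ^ p.2) G) :=
    fun m r F G => smul_choose_sum m fun a b => bidiffPow c r ((T ^ a) F) ((T ^ b) G)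
  have h2 : ∀ m F G, (m.factorial : 𝕜)⁻¹ • starExp c T m F G = ∑ p ∈ antidiagonal m,
      (p.1.factorial : 𝕜)⁻¹ • (p.2.factorial : 𝕜)⁻¹ • bilinExp (bidiffPow c p.1) T p.2 F G :=
    fun m F G => smul_choose_sum m fun a b => bilinExp (bidiffPow c a) T b F G
  simp only [h2, h1, formalOperator_apply, starProduct, (hB _).sum_left, (hB _).sum_right,
    (hB _).smul_left, (hB _).smul_right, _root_.smul_apply, Finset.smul_sum]
  let X : ℕ → ℕ → ℕ → ℕ → ℕ → CO 𝕜 d := fun r a a' b b' => (r.factorial : 𝕜)⁻¹ •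
    (a.factorial : 𝕜)⁻¹ • (a'.factorial : 𝕜)⁻¹ • bidiffPow c r ((T ^ a) (F b)) ((T ^ a') (G b'))
  calc _ = ∑ p ∈ antidiagonal n, ∑ q ∈ antidiagonal p.2, ∑ s ∈ antidiagonal q.2,
        ∑ t ∈ antidiagonal s.2, X p.1 q.1 t.1 s.1 t.2 := by
        refine Finset.sum_congr rfl fun p _ => ?_
        rw [← sum_antidiagonal_assoc p.2 fun a b l => ∑ t ∈ antidiagonal l, X p.1 a t.1 b t.2]
    _ = ∑ p ∈ antidiagonal n, ∑ q ∈ antidiagonal p.2, ∑ s ∈ antidiagonal q.1,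
        ∑ t ∈ antidiagonal q.2, X p.1 s.1 s.2 t.1 t.2 := by
        refine Finset.sum_congr rfl fun p _ => ?_
        rw [sum_antidiagonal_assoc p.2 fun a a' l => ∑ t ∈ antidiagonal l, X p.1 a a' t.1 t.2]
        exact Finset.sum_congr rfl fun q _ =>
          sum_antidiagonal_left_comm q.2 fun b a' b' => X p.1 q.1 a' b b'
    _ = ∑ p ∈ antidiagonal n, ∑ q ∈ antidiagonal p.1, ∑ s ∈ antidiagonal q.2,
        ∑ t ∈ antidiagonal p.2, X q.1 s.1 s.2 t.1 t.2 :=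
        (sum_antidiagonal_assoc n fun r m l => ∑ s ∈ antidiagonal m, ∑ t ∈ antidiagonal l,
          X r s.1 s.2 t.1 t.2).symm
    _ = _ := by
        refine Finset.sum_congr rfl fun p _ => ?_
        rw [Finset.sum_comm]
        exact Finset.sum_congr rfl fun q _ => Finset.sum_comm

theorem isStarEquivalence_intertwiner (hT : ∀ F, HasSum (intertwinerTerm α F) (T F))
    (hα : HasModerateGrowth (symmCoeff α : Coord d → _))
    {c : Coord d → Coord d → ℤ → 𝕜} (hc : HasModerateGrowth c) :
    IsStarEquivalence (bidiffPow (c + symmCoeff α)) (bidiffPow c)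
      (fun r => (r.factorial : 𝕜)⁻¹ • T ^ r) where
  zero := by
    rw [Nat.factorial_zero, Nat.cast_one, inv_one, one_smul, pow_zero]
    rfl
  map_star F G := by
    funext n
    rw [formalOperator_starProduct, starProduct_formalOperator hc]
    simp only [expStar_eq_starExp hT hα hc]

end Intertwine

/-! ### The Moyal product and its deformations -/

theorem bidiffPow_poissonCoeff_one (F G : CO 𝕜 d) :
    bidiffPow poissonCoeff 1 F G - bidiffPow poissonCoeff 1 G F
      = (2 : 𝕜) • poissonBracket F G := by
  have h := poissonBracket_antisymm G F
  simp only [poissonBracket_eq] at h ⊢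
  rw [h]
  module

theorem moyal_eq_bidiffPow : moyal (𝕜 := 𝕜) (d := d) = bidiffPow poissonCoeff :=
  funext fun r => funext₂ fun F G =>
    (hasSum_bidiffTerm hasModerateGrowth_poissonCoeff r F G).tsum_eq

theorem deformed_eq_bidiffPow {α : ℤ → 𝕜}
    (hα : HasModerateGrowth (symmCoeff α : Coord d → Coord d → ℤ → 𝕜)) :
    deformed (d := d) α = bidiffPow (poissonCoeff + symmCoeff α) :=
  funext fun r => funext₂ fun F G =>
    (hasSum_bidiffTerm (hasModerateGrowth_poissonCoeff.add hα) r F G).tsum_eq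

end Intertwiner

end ConnesSpace

/-! ### The main theorem -/

theorem proposition5 {𝕜 : Type*} [RCLike 𝕜] (d : ℕ) (α : ℤ → 𝕜) (K μ : ℝ) (hμ : 0 < μ)
    (hα : ∀ k : ℤ, k ≠ 0 → ‖α k‖ ≤ K * |(k : ℝ)| ^ μ) :
    -- the series that define the bracket and both products converge
    (∀ F G : ConnesSpace.CO 𝕜 d, Summable (ConnesSpace.poissonTerm F G)) ∧
    (∀ (r : ℕ) (F G : ConnesSpace.CO 𝕜 d), Summable (ConnesSpace.moyalTerm r F G)) ∧
    (∀ (r : ℕ) (F G : ConnesSpace.CO 𝕜 d), Summable (ConnesSpace.deformedTerm α r F G)) ∧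
    -- both products are deformation quantizations of the same Poisson bracket
    ConnesSpace.IsPoissonStructure (ConnesSpace.poissonBracket (𝕜 := 𝕜) (d := d)) ∧
    ConnesSpace.IsStarProduct (ConnesSpace.poissonBracket (𝕜 := 𝕜) (d := d))
      ConnesSpace.moyal ∧
    ConnesSpace.IsStarProduct (ConnesSpace.poissonBracket (𝕜 := 𝕜) (d := d))
      (ConnesSpace.deformed α) ∧
    -- they are equivalent, through `T = exp (ħ T₁)`
    ∃ T₁ : ConnesSpace.CO 𝕜 d →L[𝕜] ConnesSpace.CO 𝕜 d,
      (∀ F, HasSum (ConnesSpace.intertwinerTerm α F) (T₁ F)) ∧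
      ConnesSpace.IsStarEquivalence (ConnesSpace.deformed α) ConnesSpace.moyal
        (fun r => (r.factorial : 𝕜)⁻¹ • T₁ ^ r) := by
  obtain ⟨K', m, hK', h⟩ := ConnesSpace.exists_norm_le_modeEigenvalue_pow hα
  have hs := ConnesSpace.hasModerateGrowth_symmCoeff (d := d) hK' h
  have hp := ConnesSpace.hasModerateGrowth_poissonCoeff (𝕜 := 𝕜) (d := d)
  obtain ⟨T₁, hT₁⟩ := ConnesSpace.exists_intertwiner (d := d) hK' h
  -- Both products are replaced by their recursive form, for which the star product axioms and the
  -- intertwining relation were proved.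
  rw [ConnesSpace.moyal_eq_bidiffPow, ConnesSpace.deformed_eq_bidiffPow hs]
  exact ⟨fun F G => (ConnesSpace.hasSum_poissonBracket F G).summable,
    fun r F G => (ConnesSpace.hasSum_bidiffTerm hp r F G).summable,
    fun r F G => (ConnesSpace.hasSum_bidiffTerm (hp.add hs) r F G).summable,
    ConnesSpace.isPoissonStructure_poissonBracket,
    ConnesSpace.isStarProduct_bidiffPow hp (ConnesSpace.bidiffPow_poissonCoeff_one),
    ConnesSpace.isStarProduct_bidiffPow (hp.add hs) (ConnesSpace.bidiffPow_add_symmCoeff_one hs),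
    T₁, hT₁, ConnesSpace.isStarEquivalence_intertwiner hT₁ hs hp⟩
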